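/- Let $i\ge 0$ and $r\ge 1$ be integers and let $s\in(-1/2,i]$ be real with $r>\max\{s,i-1\}$. Let $\mathcal P_k$ be the space of complex polynomials in one variable of degree strictly less than $k$ ($\mathcal P_0=\{0\}$). For a finite or countable family $h=\{h_m\}$ of measurable functions on $\mathbb R$ put $$M_{k,2,s}h(x)=\sup_{Q\ni x}\ \inf_{P}\ \frac1{|Q|^{s}}\Big(\frac1{|Q|}\int_Q \sum_m|h_m-P_m|^2\Big)^{1/2}\in[0,\infty],$$ where the supremum is over all bounded nondegenerate intervals $Q$ containing $x$ and the infimum is over all families $P=\{P_m\}$ with $P_m\in\mathcal P_k$; a single function is regarded as a family with one member. Use the Fourier transform $\widehat f(\xi)=\int f(x)e^{-2\pi i x\xi}\,dx$, extended to tempered distributions. Let $\psi^1,\psi^2\in C^\infty([0,1])$ satisfy $\operatorname{supp}\psi^1\subset[0,\tfrac23]$, $\operatorname{supp}\psi^2\subset[\tfrac13,1]$ and $\psi^1+\psi^2\equiv1$ on $[0,1]$, and extend them by zero to $\mathbb R$. Then there is a constant $C$, depending only on $i,r,s,\psi^1,\psi^2$, such that the following holds. Let $\Delta_m=[a_m,b_m]$,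 $a_m<b_m$, $m\in\mathcal M$, be a finite or countable collection of pairwise disjoint intervals with $0\notin(a_m,b_m)$ for all $m$, and put $\psi^\sigma_m(\xi)=\psi^\sigma\big((\xi-a_m)/(b_m-a_m)\big)$, $\sigma=1,2$. Then there are functions $\psi^\sigma_{m,\nu}\in\mathcal S(\mathbb R)$ ($\sigma=1,2$, $m\in\mathcal M$, $\nu\in\mathbb N$) such that 1) $\psi^\sigma_{m,\nu}\to\psi^\sigma_m$ in $L^2(\mathbb R)$ as $\nu\to\infty$, for all $\sigma$ and $m$; and such that for every measurable $f:\mathbb R\to\mathbb C$ for which $M_{i,2,s}f$ is finite at some point (the functions $\psi^\sigma_{m,\nu}$ do not depend on $f$), $f$ is a tempered distribution, each $(\widehat f\,\psi^\sigma_{m,\nu})^\vee$ is a continuous function, and there are polynomials $p^\sigma_{m,\nu}\in\mathcal P_r$ and families $g^\sigma=\{g^\sigma_m\}_{m\in\mathcal M}\in L^2_{\mathrm{loc}}(\mathbb R,l^2)$, $\sigma=1,2$, with 2) $$\big\{e^{-2\pi i a_m x}(\widehat f\,\psi^1_{m,\nu})^\vee(x)-p^1_{m,\nu}(x)\big\}_{m\in\mathcal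 M}\to g^1,\qquad \big\{e^{-2\pi i b_m x}(\widehat f\,\psi^2_{m,\nu})^\vee(x)-p^2_{m,\nu}(x)\big\}_{m\in\mathcal M}\to g^2$$ as $\nu\to\infty$ in $L^2(I,l^2)$ for every bounded interval $I$ (all members of these sequences lie in $L^2_{\mathrm{loc}}(\mathbb R,l^2)$); 3) putting $\widetilde S^\sigma f=g^\sigma$, one has $M_{r,2,s}(\widetilde S^\sigma f)(x)\le C\,M_{i,2,s}f(x)$ for all $x\in\mathbb R$ and $\sigma=1,2$. -/

import Mathlib

open MeasureTheory Set Filter Topology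
open scoped ENNReal NNReal SchwartzMap ContDiff Polynomial

noncomputable section

/-- The `ℓ²` norm, with values in `[0, ∞]`, of an arbitrary family of complex numbers. -/
def l2Norm {ι : Type*} (v : ι → ℂ) : ℝ≥0∞ :=
  (∑' m, ‖v m‖ₑ ^ (2 : ℝ)) ^ (1 / 2 : ℝ)

/-- The maximal function `M_{i,p,s} h (x)` on the real line, with values in `[0, ∞]`, of a family
`h = (h_m)` of functions: the supremum over all nondegenerate compact intervals `Q = [c, d]`
containing `x` of the infimum, over all families `P = (P_m)` of polynomials of degree `< i`, of
`|Q|^{-s} (|Q|⁻¹ ∫_Q |h - P|_{ℓ²}^p)^{1/p}`. Neither `h` nor `P` has to be `ℓ²`-valued. -/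
def maximalFn {ι : Type*} (i : ℕ) (p s : ℝ) (h : ι → ℝ → ℂ) (x : ℝ) : ℝ≥0∞ :=
  ⨆ (c : ℝ) (d : ℝ) (_ : c < d) (_ : x ∈ Icc c d),
    ⨅ (P : ι → ℂ[X]) (_ : ∀ m, P m ∈ Polynomial.degreeLT ℂ i),
      ENNReal.ofReal (d - c) ^ (-s) *
        ((ENNReal.ofReal (d - c))⁻¹ *
          ∫⁻ y in Icc c d, l2Norm (fun m => h m y - (P m).eval (y : ℂ)) ^ p) ^ (1 / p)

/-- Membership in `L²_loc(ℝ, ℓ²)` of a countable family of functions. -/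
def MemL2Loc {ι : Type*} (h : ι → ℝ → ℂ) : Prop :=
  (∀ m, AEMeasurable (h m) volume) ∧
    ∀ c d : ℝ, ∫⁻ x in Icc c d, l2Norm (fun m => h m x) ^ (2 : ℝ) < ⊤

/-- Convergence of a sequence of families of functions in `L²(I, ℓ²)` for every bounded interval
`I`; the terms of the sequence and the limit belong to `L²_loc(ℝ, ℓ²)`. -/
def TendstoL2Loc {ι : Type*} (h : ℕ → ι → ℝ → ℂ) (g : ι → ℝ → ℂ) : Prop :=
  (∀ ν, MemL2Loc (h ν)) ∧ MemL2Loc g ∧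
    ∀ c d : ℝ, Tendsto
      (fun ν => ∫⁻ x in Icc c d, l2Norm (fun m => h ν m x - g m x) ^ (2 : ℝ)) atTop (𝓝 0)

/-- The tempered distribution `T` is the function `u`: the pairing of `T` with a Schwartz function
is the absolutely convergent integral against `u`. -/
def IsGivenBy (T : 𝓢'(ℝ, ℂ)) (u : ℝ → ℂ) : Prop :=
  ∀ φ : 𝓢(ℝ, ℂ), Integrable (fun x => φ x * u x) volume ∧ T φ = ∫ x, φ x * u x

/-- The function `ξ ↦ ψ ((ξ - a) / (b - a))`, which carries a cut-off from `[0, 1]` to `[a, b]`. -/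
def rescale (ψ : ℝ → ℂ) (a b : ℝ) (ξ : ℝ) : ℂ :=
  ψ ((ξ - a) / (b - a))

/-- The function `x ↦ e^{-2πi c x} F(x)`. -/
def freqShift (c : ℝ) (F : ℝ → ℂ) (x : ℝ) : ℂ :=
  Complex.exp (-(2 * Real.pi * Complex.I * c * x)) * F x

end

/-! Run through each segment from one of its ends `a`, with a signed length `ℓ`; this treats both
ends of the given intervals at once. Shifted by `a` in frequency, the cut-off operator is
convolution with `osKer χ ℓ 0`, whose symbol jumps only at the chosen end. Its n-th derivative is
bounded by constants times `|ℓ|^(n+1)` and `|z|^(-(n+1))`. Since polynomials of degree `< r` are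
free in the conclusion, one may subtract from the kernel, for `y` outside the double of an interval
with centre `c` and half-length `ρ`, its Taylor polynomial of degree `< r` in `x`. This gives
`modOp`, which converges for inputs of the growth that occurs here, and which changes only by
polynomials of degree `< r` when the interval changes.

The estimate on one interval (`IsCutoff.exists_lintegral_modOp_le`) splits the input into a near
part and dyadic shells. The near part is Plancherel together with disjointness of the segments. On a
shell of radius `R`, Taylor's formula leaves the r-th derivative of the kernel, and
`IsCutoff.exists_tsum_annulus_le` bounds the sum over the segments. Segments with `R|ℓ| < 1` are
handled by Bessel's inequality. For the others, integration by parts produces a power of `z - y`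
times a boundary term and a superposition of characters from the segment. The latter is again
Bessel; the boundary term involves the values of a Fourier transform at the ends of disjoint
segments of length at least `1/R`, which is a large sieve inequality (`DisjointSegments.sieve`). The
shells sum geometrically when the growth exponent of the input is below `r`.

The input is `f - P`, where `P` is a nearly optimal polynomial on the interval. Comparing nearly
optimal polynomials on successive dilations shows that its mean square over the dilation by `2^j`
has root `O(2^(γj))` for every `γ > max(s, i - 1)` (`exists_growth_bound`); the assumption on `r`
leaves room for `γ < r`.

The results on different intervals must be pieces of one function modulo polynomials. For this
`modOp` has to map polynomials to polynomials (`IsCutoff.modOp_eval_mem`), and here `0 ∉ (a, b)`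
enters. The function `χ(t)(1 - χ(t/ε))`, with `t = (ξ - a)/ℓ`, is smooth, compactly supported and
zero near the origin, so its multiplier kills polynomials. Its kernel is the difference of the
kernels for `ℓ` and `εℓ`, and the operator for `εℓ` tends to zero with `ε`. The same functions are
the required approximations `Ψ`. Choosing `ε` depending on the segment makes the error square
summable, so that modulo polynomials the smooth multipliers converge to `g = modOp` taken with one
fixed base interval. -/

noncomputable section

/-! ### Plancherel, Bessel and the large sieve for disjoint segments -/

/-- The character `t ↦ e^{2πit}`. -/
def cis (t : ℝ) : ℂ := Complex.exp (2 * Real.pi * Complex.I * t)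

lemma cis_add (s t : ℝ) : cis (s + t) = cis s * cis t := by
  simp only [cis, ← Complex.exp_add]; push_cast; ring_nf

@[simp] lemma cis_zero : cis 0 = 1 := by simp [cis]

@[simp] lemma norm_cis (t : ℝ) : ‖cis t‖ = 1 := by
  rw [cis, show 2 * Real.pi * Complex.I * t = ((2 * Real.pi * t : ℝ) : ℂ) * Complex.I by
    push_cast; ring]
  exact Complex.norm_exp_ofReal_mul_I _

@[simp] lemma enorm_cis (t : ℝ) : ‖cis t‖ₑ = 1 := by
  rw [← ofReal_norm]; simp

@[fun_prop] lemma continuous_cis : Continuous cis := by unfold cis; fun_prop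

/-- The Fourier transform as an integral. -/
def ft (u : ℝ → ℂ) (ξ : ℝ) : ℂ := ∫ y, cis (-(ξ * y)) * u y

open FourierTransform in
lemma ft_eq_fourier (u : ℝ → ℂ) : ft u = 𝓕 u := by
  ext ξ
  rw [Real.fourier_real_eq_integral_exp_smul, ft]
  congr 1; ext y
  simp only [cis, smul_eq_mul]
  congr 2; push_cast; ring

-- The transform on `L²` is compared with the integral by testing both against smooth compactly
-- supported functions: in each pairing the transform can be moved to the test function.
open FourierTransform in
lemma fourier_toLp_ae_eq {u : ℝ → ℂ} (hu : Integrable u) (hu2 : MemLp u 2) :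
    (𝓕 (hu2.toLp u) : Lp ℂ 2 (volume : Measure ℝ)) =ᵐ[volume] 𝓕 u := by
  have hc : Continuous (𝓕 u) := by
    rw [← ft_eq_fourier]
    exact continuous_of_dominated (F := fun ξ y => cis (-(ξ * y)) * u y) (bound := fun y => ‖u y‖)
      (fun ξ => (by fun_prop : Continuous fun y => cis (-(ξ * y))).aestronglyMeasurable.mul hu.1)
      (fun ξ => by simp) hu.norm (by filter_upwards with y; fun_prop)
  have hl1 := (Lp.memLp (𝓕 (hu2.toLp u) : Lp ℂ 2 (volume : Measure ℝ))).locallyIntegrable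
    (by norm_num)
  have hl2 : LocallyIntegrable (𝓕 u) volume := hc.locallyIntegrable
  have key : ∀ᵐ x, (𝓕 (hu2.toLp u) : Lp ℂ 2 (volume : Measure ℝ)) x - 𝓕 u x = 0 := by
    apply ae_eq_zero_of_integral_contDiff_smul_eq_zero (hl1.sub hl2)
    intro g hg hgc
    have hg₁ : HasCompactSupport (Complex.ofRealCLM ∘ g) := hgc.comp_left rfl
    have hg₂ : ContDiff ℝ ∞ (Complex.ofRealCLM ∘ g) := by fun_prop
    set φ : 𝓢(ℝ, ℂ) := hg₁.toSchwartzMap hg₂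
    have hφ : ∀ x, φ x = (g x : ℂ) := fun x => rfl
    have h1 := congrArg (fun T : 𝓢'(ℝ, ℂ) => T φ)
      (Lp.fourier_toTemperedDistribution_eq (hu2.toLp u))
    simp only [TemperedDistribution.fourier_apply, Lp.toTemperedDistribution_apply] at h1
    have h2 : ∫ x, (𝓕 φ : 𝓢(ℝ, ℂ)) x • (hu2.toLp u : ℝ → ℂ) x = ∫ x, φ x • 𝓕 u x := by
      have h3 : ∫ x, (𝓕 φ : 𝓢(ℝ, ℂ)) x • (hu2.toLp u : ℝ → ℂ) x = ∫ x, 𝓕 (φ : ℝ → ℂ) x • u x := by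
        apply integral_congr_ae
        filter_upwards [hu2.coeFn_toLp] with x hx
        rw [hx]; rfl
      rw [h3]
      simpa using! VectorFourier.integral_bilin_fourierIntegral_eq_flip
        (ContinuousLinearMap.lsmul ℂ ℂ) (L := innerₗ ℝ)
        Real.continuous_fourierChar continuous_inner φ.integrable hu
    have h4 : ∀ x, g x • ((𝓕 (hu2.toLp u) : Lp ℂ 2 (volume : Measure ℝ)) x - 𝓕 u x)
        = φ x • (𝓕 (hu2.toLp u) : Lp ℂ 2 (volume : Measure ℝ)) x - φ x • 𝓕 u x := by
      intro x; rw [hφ]; simp [mul_sub]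
    have hi1 : Integrable (fun x => φ x • (𝓕 (hu2.toLp u) : Lp ℂ 2 (volume : Measure ℝ)) x) :=
      hl1.integrable_smul_left_of_hasCompactSupport (g := fun x => φ x) φ.continuous hg₁
    have hi2 : Integrable (fun x => φ x • 𝓕 u x) :=
      hl2.integrable_smul_left_of_hasCompactSupport φ.continuous hg₁
    calc _ = ∫ x, (φ x • (𝓕 (hu2.toLp u) : Lp ℂ 2 (volume : Measure ℝ)) x - φ x • 𝓕 u x) := by
            congr 1; ext x; exact h4 x
      _ = 0 := by rw [integral_sub hi1 hi2, ← h1, h2, sub_self]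
  filter_upwards [key] with x hx
  exact sub_eq_zero.mp hx

lemma eLpNorm_two_sq (u : ℝ → ℂ) : eLpNorm u 2 volume ^ 2 = ∫⁻ x, ‖u x‖ₑ ^ 2 := by
  rw [eLpNorm_eq_lintegral_rpow_enorm_toReal (by norm_num) (by norm_num), ← ENNReal.rpow_natCast,
    ← ENNReal.rpow_mul]
  simp

/-- Plancherel's theorem for functions in `L¹ ∩ L²`. -/
lemma lintegral_ft_sq {u : ℝ → ℂ} (hu : Integrable u) (hu2 : MemLp u 2) :
    ∫⁻ ξ, ‖ft u ξ‖ₑ ^ 2 = ∫⁻ y, ‖u y‖ₑ ^ 2 := by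
  open FourierTransform in
  rw [← eLpNorm_two_sq, ← eLpNorm_two_sq, ft_eq_fourier,
    ← eLpNorm_congr_ae (fourier_toLp_ae_eq hu hu2), ← eLpNorm_congr_ae hu2.coeFn_toLp]
  have := Lp.norm_fourier_eq (hu2.toLp u)
  rw [Lp.norm_def, Lp.norm_def, ENNReal.toReal_eq_toReal_iff' (Lp.eLpNorm_ne_top _)
    (Lp.eLpNorm_ne_top _)] at this
  rw [this]

lemma continuous_ft {u : ℝ → ℂ} (hu : Integrable u) : Continuous (ft u) :=
  continuous_of_dominated (F := fun ξ y => cis (-(ξ * y)) * u y) (bound := fun y => ‖u y‖)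
    (fun ξ => (by fun_prop : Continuous fun y => cis (-(ξ * y))).aestronglyMeasurable.mul hu.1)
    (fun ξ => by simp) hu.norm (by filter_upwards with y; fun_prop)

lemma lintegral_segment (a ℓ : ℝ) (hℓ : ℓ ≠ 0) (F : ℝ → ℝ≥0∞) :
    ENNReal.ofReal |ℓ| * ∫⁻ t in Icc (0 : ℝ) 1, F (a + t * ℓ) = ∫⁻ x in uIcc a (a + ℓ), F x := by
  have him : (fun t => a + t * ℓ) '' Icc (0 : ℝ) 1 = uIcc a (a + ℓ) := by
    rw [← segment_eq_uIcc, segment_eq_image']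
    simp
  rw [← him, lintegral_image_eq_lintegral_abs_deriv_mul (f' := fun _ => ℓ) measurableSet_Icc
    (fun t _ => by simpa using (((hasDerivAt_id t).mul_const ℓ).const_add a).hasDerivWithinAt)
    (fun s _ t _ h => by simpa [hℓ] using h)]
  rw [lintegral_const_mul' _ _ (by simp)]

lemma sq_lintegral_le {α : Type*} [MeasurableSpace α] {μ : Measure α} {f : α → ℝ≥0∞}
    (hf : AEMeasurable f μ) : (∫⁻ x, f x ∂μ) ^ 2 ≤ μ univ * ∫⁻ x, f x ^ 2 ∂μ := by
  have := ENNReal.lintegral_mul_le_Lp_mul_Lq μ Real.HolderConjugate.two_two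
    (f := fun _ => 1) aemeasurable_const hf
  simp only [Pi.mul_apply, one_mul, ENNReal.one_rpow, lintegral_one] at this
  calc _ ≤ (μ univ ^ (1 / 2 : ℝ) * (∫⁻ x, f x ^ (2 : ℝ) ∂μ) ^ (1 / 2 : ℝ)) ^ 2 := by gcongr
    _ = _ := by
      rw [mul_pow, ← ENNReal.rpow_natCast, ← ENNReal.rpow_mul, ← ENNReal.rpow_natCast,
        ← ENNReal.rpow_mul]
      simp

lemma ENNReal.add_sq_le (a b : ℝ≥0∞) : (a + b) ^ 2 ≤ 2 * (a ^ 2 + b ^ 2) := by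
  have := ENNReal.rpow_add_le_mul_rpow_add_rpow a b (p := 2) (by norm_num)
  simpa [show (2 : ℝ) - 1 = 1 by norm_num] using this

lemma enorm_integral_sq_le {α : Type*} [MeasurableSpace α] {μ : Measure α} {f : α → ℂ}
    (hf : AEStronglyMeasurable f μ) : ‖∫ x, f x ∂μ‖ₑ ^ 2 ≤ μ univ * ∫⁻ x, ‖f x‖ₑ ^ 2 ∂μ :=
  (pow_le_pow_left' (enorm_integral_le_lintegral_enorm f) 2).trans (sq_lintegral_le hf.enorm)

variable {ι : Type*} [Countable ι]

/-- Pairwise disjoint segments `[a_m, a_m + ℓ_m]`; the lengths `ℓ_m ≠ 0` may be negative. -/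
structure DisjointSegments (a ℓ : ι → ℝ) : Prop where
  ne : ∀ m, ℓ m ≠ 0
  disj : Pairwise fun m n => Disjoint (uIcc (a m) (a m + ℓ m)) (uIcc (a n) (a n + ℓ n))

lemma DisjointSegments.tsum_le {a ℓ : ι → ℝ} (h : DisjointSegments a ℓ) (F : ℝ → ℝ≥0∞) :
    ∑' m, ENNReal.ofReal |ℓ m| * ∫⁻ t in Icc (0 : ℝ) 1, F (a m + t * ℓ m) ≤ ∫⁻ x, F x := by
  simp_rw [lintegral_segment _ _ (h.ne _)]
  rw [← lintegral_iUnion (fun _ => measurableSet_uIcc) h.disj]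
  exact setLIntegral_le_lintegral _ _

/-- Bessel's inequality for the pieces of a function with spectrum in disjoint segments. -/
lemma DisjointSegments.bessel {a ℓ : ι → ℝ} (h : DisjointSegments a ℓ) {u : ℝ → ℂ}
    (hu : Integrable u) (hu2 : MemLp u 2) :
    ∑' m, ENNReal.ofReal |ℓ m| * ∫⁻ t in Icc (0 : ℝ) 1, ‖ft u (a m + t * ℓ m)‖ₑ ^ 2
      ≤ ∫⁻ y, ‖u y‖ₑ ^ 2 := by
  rw [← lintegral_ft_sq hu hu2]
  exact h.tsum_le _

lemma ft_comp_add (u : ℝ → ℂ) (c ξ : ℝ) : ft (fun y => u (y + c)) ξ = cis (ξ * c) * ft u ξ := by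
  unfold ft
  rw [← integral_add_right_eq_self (fun y => cis (-(ξ * y)) * u y) c, ← integral_const_mul]
  congr 1; ext y
  rw [← mul_assoc, ← cis_add]; ring_nf

lemma hasDerivAt_ft {u : ℝ → ℂ} (hu : Integrable u) (hu' : Integrable fun y : ℝ => (y : ℂ) * u y)
    (ξ : ℝ) : HasDerivAt (ft u) (-2 * Real.pi * Complex.I * ft (fun y => y * u y) ξ) ξ := by
  have := Real.hasDerivAt_fourier hu (by simpa using hu') ξ
  rw [← ft_eq_fourier, ← ft_eq_fourier] at this
  convert! this using 1
  unfold ft; rw [← integral_const_mul]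
  congr 1; ext y
  simp only [smul_eq_mul]; ring

/-- Gallagher's argument: a value at the end is at most a nearby value plus the integral of the
derivative between them, and the derivative of the transform is the transform of `y u`. Dividing `y`
by `R` makes the second function no larger than `u` when `u` lives on `|y| ≤ R`. -/
lemma sieve_pointwise_zero {u : ℝ → ℂ} (hu : Integrable u) (hu' : Integrable fun y : ℝ => (y : ℂ) * u y)
    {R a ℓ : ℝ} (hR : 0 < R) (h : 1 ≤ R * |ℓ|) :
    ‖ft u a‖ₑ ^ 2 ≤ ENNReal.ofReal (80 * (R * |ℓ|)) *
      ((∫⁻ t in Icc (0 : ℝ) 1, ‖ft u (a + t * ℓ)‖ₑ ^ 2) +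
        ∫⁻ t in Icc (0 : ℝ) 1, ‖ft (fun y => (y / R : ℝ) * u y) (a + t * ℓ)‖ₑ ^ 2) := by
  -- The initial part of the segment of length `1 / R` in frequency: on this scale the factor `Rℓ`
  -- in the derivative costs only a constant.
  set δ : ℝ := 1 / (R * |ℓ|) with hδ
  have hp : 0 < R * |ℓ| := by linarith
  have hδ0 : 0 < δ := by positivity
  have hδ1 : δ ≤ 1 := by rw [hδ, div_le_one hp]; exact h
  set v : ℝ → ℂ := fun y => (y / R : ℝ) * u y with hv
  have hvi : Integrable v := by
    have := hu'.const_mul ((1 / R : ℝ) : ℂ)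
    refine this.congr (Eventually.of_forall fun y => ?_)
    simp only [hv]; push_cast; ring
  set G : ℝ → ℂ := fun t => ft u (a + t * ℓ) with hG
  set G' : ℝ → ℂ := fun t => (-2 * Real.pi * Complex.I * (R * ℓ)) * ft v (a + t * ℓ) with hG'
  have hvR : ∀ ξ, ft (fun y : ℝ => (y : ℂ) * u y) ξ = R * ft v ξ := by
    intro ξ
    unfold ft; rw [← integral_const_mul]
    congr 1; ext y
    have : (R : ℂ) ≠ 0 := by exact_mod_cast hR.ne'
    simp only [hv]; push_cast; field_simp
  have hder : ∀ t, HasDerivAt G (G' t) t := by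
    intro t
    have h1 : HasDerivAt (fun t : ℝ => a + t * ℓ) ℓ t := by
      simpa using ((hasDerivAt_id t).mul_const ℓ).const_add a
    have := (hasDerivAt_ft hu hu' (a + t * ℓ)).scomp t h1
    rw [hvR, Complex.real_smul] at this
    convert! this using 1
    simp only [hG']; ring
  have hcv : Continuous fun t : ℝ => ft v (a + t * ℓ) :=
    (continuous_ft hvi).comp (by fun_prop)
  have hcG' : Continuous G' := by fun_prop
  have hcG : Continuous G := (continuous_ft hu).comp (by fun_prop)
  set A := ∫⁻ t in Icc (0 : ℝ) 1, ‖ft u (a + t * ℓ)‖ₑ ^ 2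
  set B := ∫⁻ t in Icc (0 : ℝ) 1, ‖ft v (a + t * ℓ)‖ₑ ^ 2
  have hsub : Icc (0 : ℝ) δ ⊆ Icc 0 1 := Icc_subset_Icc_right hδ1
  set D := ∫⁻ t in Icc (0 : ℝ) δ, ‖G' t‖ₑ with hD
  have hDsq : D ^ 2 ≤ ENNReal.ofReal δ * (ENNReal.ofReal (40 * (R * |ℓ|) ^ 2) * B) := by
    refine (sq_lintegral_le hcG'.enorm.aemeasurable).trans ?_
    rw [Measure.restrict_apply_univ, Real.volume_Icc, sub_zero]
    gcongr
    refine (lintegral_mono_set hsub).trans ?_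
    rw [← lintegral_const_mul' _ _ ENNReal.ofReal_ne_top]
    refine lintegral_mono fun t => ?_
    simp only [hG', enorm_mul, mul_pow]
    refine mul_le_mul_left ?_ _
    rw [← mul_pow, ← mul_pow,  ← mul_pow, ← mul_pow, ← enorm_mul, ← enorm_mul, ← enorm_mul,← enorm_mul, ← ofReal_norm, ← ENNReal.ofReal_pow (norm_nonneg _)]
    apply ENNReal.ofReal_le_ofReal
    have : ‖(-2 * Real.pi * Complex.I * (R * ℓ) : ℂ)‖ = 2 * Real.pi * (R * |ℓ|) := by
      simp [abs_of_pos hR, abs_of_pos Real.pi_pos]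
    rw [this, mul_pow (2 * Real.pi), mul_pow R]
    -- The 40 here, doubled by `(a + b)² ≤ 2(a² + b²)`, becomes the 80 of the statement.
    have hpi : (2 * Real.pi) ^ 2 ≤ 40 := by nlinarith [Real.pi_lt_d2, Real.pi_pos]
    exact mul_le_mul_of_nonneg_right hpi (by positivity)
  have hpt : ∀ t ∈ Icc (0 : ℝ) δ, ‖G 0‖ₑ ^ 2 ≤ 2 * (‖G t‖ₑ ^ 2 + D ^ 2) := by
    intro t ht
    have h1 : G t - G 0 = ∫ s in (0 : ℝ)..t, G' s :=
      (intervalIntegral.integral_eq_sub_of_hasDerivAt (fun s _ => hder s)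
        (hcG'.intervalIntegrable _ _)).symm
    have h2 : ‖G t - G 0‖ₑ ≤ D := by
      rw [h1, intervalIntegral.integral_of_le ht.1]
      refine (enorm_integral_le_lintegral_enorm _).trans (lintegral_mono_set ?_)
      exact fun s hs => ⟨hs.1.le, hs.2.trans ht.2⟩
    have h3 : ‖G 0‖ₑ ≤ ‖G t‖ₑ + D := by
      calc ‖G 0‖ₑ = ‖G t - (G t - G 0)‖ₑ := by rw [sub_sub_cancel]
        _ ≤ ‖G t‖ₑ + ‖G t - G 0‖ₑ := enorm_sub_le
        _ ≤ _ := by gcongr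
    exact (pow_le_pow_left' h3 2).trans (ENNReal.add_sq_le _ _)
  have hint : ENNReal.ofReal δ * ‖G 0‖ₑ ^ 2 ≤ 2 * (A + ENNReal.ofReal δ * D ^ 2) := by
    calc ENNReal.ofReal δ * ‖G 0‖ₑ ^ 2 = ∫⁻ t in Icc (0 : ℝ) δ, ‖G 0‖ₑ ^ 2 := by
          simp [mul_comm]
      _ ≤ ∫⁻ t in Icc (0 : ℝ) δ, 2 * (‖G t‖ₑ ^ 2 + D ^ 2) :=
          setLIntegral_mono (by fun_prop) hpt
      _ = 2 * ((∫⁻ t in Icc (0 : ℝ) δ, ‖G t‖ₑ ^ 2) + ENNReal.ofReal δ * D ^ 2) := by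
          rw [lintegral_const_mul' _ _ (by simp), lintegral_add_right _ measurable_const]
          simp [mul_comm]
      _ ≤ _ := by gcongr; exact lintegral_mono_set hsub
  have hG0 : ft u a = G 0 := by simp [hG]
  have hfin : ENNReal.ofReal (R * |ℓ|) * ENNReal.ofReal δ = 1 := by
    rw [← ENNReal.ofReal_mul hp.le, hδ, mul_one_div_cancel hp.ne', ENNReal.ofReal_one]
  rw [hG0]
  calc ‖G 0‖ₑ ^ 2 = ENNReal.ofReal (R * |ℓ|) * (ENNReal.ofReal δ * ‖G 0‖ₑ ^ 2) := by
        rw [← mul_assoc, hfin, one_mul]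
    _ ≤ ENNReal.ofReal (R * |ℓ|) * (2 * (A + ENNReal.ofReal δ *
          (ENNReal.ofReal δ * (ENNReal.ofReal (40 * (R * |ℓ|) ^ 2) * B)))) := by
        exact mul_le_mul_right (hint.trans (by gcongr)) _
    _ = ENNReal.ofReal (R * |ℓ|) * (2 * (A + 40 * B)) := by
        congr 3
        rw [← mul_assoc, ← mul_assoc, ← ENNReal.ofReal_mul hδ0.le,
          ← ENNReal.ofReal_mul (by positivity),
          show δ * δ * (40 * (R * |ℓ|) ^ 2) = 40 by
            rw [hδ]
            have := hp.ne'
            generalize R * |ℓ| = w at this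
            field_simp]
        norm_num
    _ ≤ ENNReal.ofReal (R * |ℓ|) * (80 * (A + B)) := by
        rw [mul_add 2, mul_add 80, ← mul_assoc 2]
        refine mul_le_mul_right (add_le_add ?_ ?_) _
        · exact mul_le_mul_left (by norm_num) _
        · exact mul_le_mul_left (by norm_num) _
    _ = _ := by
        rw [ENNReal.ofReal_mul (by norm_num : (0 : ℝ) ≤ 80)]
        norm_num; ring

/-- The value of the Fourier transform at an end of a segment, of a function with support in an
interval of half-length `R`, is controlled by means over the segment if `|ℓ| ≥ 1 / R`. -/
lemma sieve_pointwise {u : ℝ → ℂ} (hu : Integrable u) {R a ℓ : ℝ} (c : ℝ)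
    (hR : 0 < R) (hsupp : ∀ y, R < |y - c| → u y = 0) (h : 1 ≤ R * |ℓ|) :
    ‖ft u a‖ₑ ^ 2 ≤ ENNReal.ofReal (80 * (R * |ℓ|)) *
      ((∫⁻ t in Icc (0 : ℝ) 1, ‖ft u (a + t * ℓ)‖ₑ ^ 2) +
        ∫⁻ t in Icc (0 : ℝ) 1, ‖ft (fun y => ((y - c) / R : ℝ) * u y) (a + t * ℓ)‖ₑ ^ 2) := by
  -- Moving the centre of the support to the origin changes the transforms only by unimodular
  -- factors.
  have hU : Integrable fun y => u (y + c) := hu.comp_add_right c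
  have hU' : Integrable fun y : ℝ => (y : ℂ) * u (y + c) := by
    refine (hU.norm.const_mul R).mono'
      (Complex.continuous_ofReal.aestronglyMeasurable.mul hU.1) (Eventually.of_forall fun y => ?_)
    rw [norm_mul, Complex.norm_real, Real.norm_eq_abs]
    by_cases hy : R < |y|
    · simp [hsupp (y + c) (by simpa using hy)]
    · push Not at hy; gcongr
  have h0 := sieve_pointwise_zero hU hU' (a := a) hR h
  have h1 : (fun y : ℝ => ((y / R : ℝ) : ℂ) * u (y + c)) =
      fun y => (fun z : ℝ => (((z - c) / R : ℝ) : ℂ) * u z) (y + c) := by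
    ext y; simp
  rw [h1] at h0
  simp_rw [ft_comp_add (fun z : ℝ => (((z - c) / R : ℝ) : ℂ) * u z)] at h0
  simp_rw [ft_comp_add, enorm_mul, enorm_cis, one_mul] at h0
  exact h0

/-- The pointwise bound replaces each value by `80 R` times integrals of two squared transforms over
the segment. Bessel's inequality sums both, and `|(y - c)/R| ≤ 1` on the support, whence `160 = 80 +
80`. -/
lemma DisjointSegments.sieve {a ℓ : ι → ℝ} (h : DisjointSegments a ℓ) {u : ℝ → ℂ}
    (hu : Integrable u) (hu2 : MemLp u 2) {R : ℝ} (c : ℝ) (hR : 0 < R)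
    (hsupp : ∀ y, R < |y - c| → u y = 0) :
    ∑' m, (if 1 ≤ R * |ℓ m| then ‖ft u (a m)‖ₑ ^ 2 else 0) ≤
      ENNReal.ofReal (160 * R) * ∫⁻ y, ‖u y‖ₑ ^ 2 := by
  set v : ℝ → ℂ := fun y => ((y - c) / R : ℝ) * u y with hv
  have hvu : ∀ y, ‖v y‖ ≤ ‖u y‖ := by
    intro y
    by_cases hy : R < |y - c|
    · simp [hv, hsupp y hy]
    · push Not at hy
      rw [hv]; simp only [norm_mul, Complex.norm_real, Real.norm_eq_abs, abs_div, abs_of_pos hR]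
      exact mul_le_of_le_one_left (norm_nonneg _) ((div_le_one hR).2 hy)
  have hvm : AEStronglyMeasurable v := by
    have := hu.1; fun_prop
  have hvi : Integrable v := hu.mono hvm (Eventually.of_forall hvu)
  have hv2 : MemLp v 2 := hu2.mono hvm (Eventually.of_forall hvu)
  calc _ ≤ ∑' m, (ENNReal.ofReal (80 * R) *
        (ENNReal.ofReal |ℓ m| * ∫⁻ t in Icc (0 : ℝ) 1, ‖ft u (a m + t * ℓ m)‖ₑ ^ 2) +
        ENNReal.ofReal (80 * R) *
        (ENNReal.ofReal |ℓ m| * ∫⁻ t in Icc (0 : ℝ) 1, ‖ft v (a m + t * ℓ m)‖ₑ ^ 2)) := by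
        refine ENNReal.tsum_le_tsum fun m => ?_
        split_ifs with hm
        · refine (sieve_pointwise hu c hR hsupp hm).trans_eq ?_
          rw [← mul_assoc, ENNReal.ofReal_mul (by positivity), mul_add]
          simp only [hv, mul_assoc]
        · exact zero_le
    _ ≤ ENNReal.ofReal (80 * R) * (∫⁻ y, ‖u y‖ₑ ^ 2) +
        ENNReal.ofReal (80 * R) * (∫⁻ y, ‖u y‖ₑ ^ 2) := by
        rw [ENNReal.tsum_add, ENNReal.tsum_mul_left, ENNReal.tsum_mul_left]
        gcongr
        · exact h.bessel hu hu2
        · refine (h.bessel hvi hv2).trans (lintegral_mono fun y => ?_)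
          gcongr
          exact enorm_le_iff_norm_le.2 (hvu y)
    _ = _ := by
        rw [← two_mul, ← mul_assoc, show (160 * R) = 2 * (80 * R) by ring,
          ENNReal.ofReal_mul (by norm_num : (0 : ℝ) ≤ 2)]
        norm_num

end

/-! ### The kernel of a one-sided cut-off and its decay -/

noncomputable section

lemma hasDerivAt_cis_mul (a t : ℝ) :
    HasDerivAt (fun t : ℝ => cis (t * a)) (2 * Real.pi * Complex.I * a * cis (t * a)) t := by
  have h1 : HasDerivAt (fun t : ℝ => 2 * Real.pi * Complex.I * ((t * a : ℝ) : ℂ))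
      (2 * Real.pi * Complex.I * a) t := by
    have h2 : HasDerivAt (fun t : ℝ => t * a) a t := by
      simpa using (hasDerivAt_id t).mul_const a
    exact h2.ofReal_comp.const_mul _
  simpa [cis, mul_comm] using h1.cexp

/-- A smooth function on the line which is `1` on the left of `1/3` and `0` on the right of
`2/3`. -/
structure IsCutoff (χ : ℝ → ℂ) : Prop where
  smooth : ContDiff ℝ ∞ χ
  one : ∀ t < 1 / 3, χ t = 1
  zero : ∀ t > 2 / 3, χ t = 0

/-- The `n`-th derivative of the Fourier integral of `χ` over `[0, 1]`. -/
def osc (χ : ℝ → ℂ) (n : ℕ) (z : ℝ) : ℂ :=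
  ∫ t in (0 : ℝ)..1, χ t * (2 * Real.pi * Complex.I * t) ^ n * cis (t * z)

/-- The `n`-th derivative of the kernel with the cut-off `χ` carried to a segment of signed
length `ℓ`. -/
def osKer (χ : ℝ → ℂ) (ℓ : ℝ) (n : ℕ) (z : ℝ) : ℂ :=
  |ℓ| * ℓ ^ n * osc χ n (ℓ * z)

lemma osc_integrand_continuous {χ : ℝ → ℂ} (hχ : Continuous χ) (n : ℕ) (z : ℝ) :
    Continuous fun t : ℝ => χ t * (2 * Real.pi * Complex.I * t) ^ n * cis (t * z) := by
  fun_prop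

lemma exists_norm_osc_le {χ : ℝ → ℂ} (hχ : Continuous χ) (n : ℕ) :
    ∃ C, 0 < C ∧ ∀ t ∈ Icc (0 : ℝ) 1, ‖χ t * (2 * Real.pi * Complex.I * t) ^ n‖ ≤ C := by
  have hc : Continuous fun t : ℝ => χ t * (2 * Real.pi * Complex.I * t) ^ n := by fun_prop
  obtain ⟨C, hC⟩ := isCompact_Icc.exists_bound_of_continuousOn (s := Icc (0 : ℝ) 1) hc.continuousOn
  exact ⟨max C 1, by positivity, fun t ht => (hC t ht).trans (le_max_left _ _)⟩

lemma hasDerivAt_osc {χ : ℝ → ℂ} (hχ : Continuous χ) (n : ℕ) (z : ℝ) :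
    HasDerivAt (osc χ n) (osc χ (n + 1) z) z := by
  obtain ⟨C, hC0, hC⟩ := exists_norm_osc_le hχ (n + 1)
  have hd : ∀ t x : ℝ, HasDerivAt (fun x : ℝ => χ t * (2 * Real.pi * Complex.I * t) ^ n * cis (t * x))
      (χ t * (2 * Real.pi * Complex.I * t) ^ (n + 1) * cis (t * x)) x := by
    intro t x
    have := (hasDerivAt_cis_mul t x).const_mul (χ t * (2 * Real.pi * Complex.I * t) ^ n)
    simp only [mul_comm _ t] at this
    convert! this using 1
    ring
  refine (intervalIntegral.hasDerivAt_integral_of_dominated_loc_of_deriv_le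
    (F := fun x t => χ t * (2 * Real.pi * Complex.I * t) ^ n * cis (t * x))
    (F' := fun x t => χ t * (2 * Real.pi * Complex.I * t) ^ (n + 1) * cis (t * x))
    (bound := fun _ => C) (s := univ) univ_mem ?_ ?_ ?_ ?_ ?_ ?_).2
  · exact Eventually.of_forall fun x => (osc_integrand_continuous hχ n x).aestronglyMeasurable
  · exact (osc_integrand_continuous hχ n z).intervalIntegrable _ _
  · exact (osc_integrand_continuous hχ (n + 1) z).aestronglyMeasurable
  · refine Eventually.of_forall fun t ht x _ => ?_
    rw [uIoc_of_le zero_le_one] at ht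
    rw [norm_mul, norm_cis, mul_one]
    exact hC t ⟨ht.1.le, ht.2⟩
  · exact intervalIntegrable_const
  · exact Eventually.of_forall fun t _ x _ => hd t x

lemma hasDerivAt_osKer {χ : ℝ → ℂ} (hχ : Continuous χ) (ℓ : ℝ) (n : ℕ) (z : ℝ) :
    HasDerivAt (osKer χ ℓ n) (osKer χ ℓ (n + 1) z) z := by
  have h1 : HasDerivAt (fun z : ℝ => ℓ * z) ℓ z := by
    simpa using (hasDerivAt_id z).const_mul ℓ
  have := ((hasDerivAt_osc hχ n (ℓ * z)).scomp z h1).const_mul (((|ℓ| : ℝ) : ℂ) * ℓ ^ n)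
  convert! this using 1
  simp only [osKer, Complex.real_smul]; ring

lemma continuous_osKer {χ : ℝ → ℂ} (hχ : Continuous χ) (ℓ : ℝ) (n : ℕ) :
    Continuous (osKer χ ℓ n) :=
  continuous_iff_continuousAt.2 fun z => (hasDerivAt_osKer hχ ℓ n z).continuousAt

lemma exists_norm_osKer_le {χ : ℝ → ℂ} (hχ : Continuous χ) (n : ℕ) :
    ∃ C, 0 < C ∧ ∀ ℓ z, ‖osKer χ ℓ n z‖ ≤ C * |ℓ| ^ (n + 1) := by
  obtain ⟨C, hC0, hC⟩ := exists_norm_osc_le hχ n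
  refine ⟨C, hC0, fun ℓ z => ?_⟩
  have h : ‖osc χ n (ℓ * z)‖ ≤ C := by
    have := intervalIntegral.norm_integral_le_of_norm_le_const (a := (0 : ℝ)) (b := 1) (C := C)
      (f := fun t : ℝ => χ t * (2 * Real.pi * Complex.I * t) ^ n * cis (t * (ℓ * z))) ?_
    · simpa [osc] using this
    · intro t ht
      rw [uIoc_of_le zero_le_one] at ht
      rw [norm_mul, norm_cis, mul_one]
      exact hC t ⟨ht.1.le, ht.2⟩
  rw [osKer, norm_mul, norm_mul, norm_pow, Complex.norm_real, Complex.norm_real,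
    Real.norm_eq_abs, Real.norm_eq_abs, abs_abs, pow_succ]
  calc |ℓ| * |ℓ| ^ n * ‖osc χ n (ℓ * z)‖ ≤ |ℓ| * |ℓ| ^ n * C := by gcongr
    _ = _ := by ring

lemma integral_mul_cis_by_parts {φ : ℝ → ℂ} (hφ : ContDiff ℝ ∞ φ) (w : ℝ) :
    2 * Real.pi * Complex.I * w * (∫ t in (0 : ℝ)..1, φ t * cis (t * w)) =
      φ 1 * cis w - φ 0 - ∫ t in (0 : ℝ)..1, deriv φ t * cis (t * w) := by
  have h1 := intervalIntegral.integral_mul_deriv_eq_deriv_mul (a := 0) (b := 1)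
    (u := φ) (u' := deriv φ) (v := fun t => cis (t * w))
    (v' := fun t => 2 * Real.pi * Complex.I * w * cis (t * w))
    (fun t _ => (hφ.differentiable (by simp) t).hasDerivAt)
    (fun t _ => hasDerivAt_cis_mul w t)
    ((hφ.continuous_deriv (by simp)).intervalIntegrable _ _)
    ((by fun_prop : Continuous fun t : ℝ => 2 * Real.pi * Complex.I * w * cis (t * w)).intervalIntegrable _ _)
  simp only [one_mul, zero_mul, cis_zero, mul_one] at h1
  rw [← h1, ← intervalIntegral.integral_const_mul]
  congr 1; ext t; ring

/-- With these vanishing orders at the ends, `n + 1` integrations by parts leave a single boundary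
value, the n-th derivative at 0. -/
lemma integral_mul_cis_by_parts_iterate (n : ℕ) : ∀ {φ : ℝ → ℂ} (_ : ContDiff ℝ ∞ φ)
    (_ : ∀ k ≤ n, iteratedDeriv k φ 1 = 0) (_ : ∀ k < n, iteratedDeriv k φ 0 = 0) (w : ℝ),
    (2 * Real.pi * Complex.I * w) ^ (n + 1) * (∫ t in (0 : ℝ)..1, φ t * cis (t * w)) =
      (-1) ^ (n + 1) * (iteratedDeriv n φ 0 +
        ∫ t in (0 : ℝ)..1, iteratedDeriv (n + 1) φ t * cis (t * w)) := by
  induction n with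
  | zero =>
    intro φ hφ h1 h0 w
    have := h1 0 le_rfl
    simp only [iteratedDeriv_zero] at this
    rw [zero_add, pow_one, integral_mul_cis_by_parts hφ, this]
    simp [iteratedDeriv_one]; ring
  | succ n ih =>
    intro φ hφ h1 h0 w
    have hd : ContDiff ℝ ∞ (deriv φ) := (contDiff_infty_iff_deriv.1 hφ).2
    have h10 := h1 0 (by omega)
    have h00 := h0 0 (by omega)
    simp only [iteratedDeriv_zero] at h10 h00
    have := ih hd (fun k hk => by rw [← iteratedDeriv_succ']; exact h1 _ (by omega))
      (fun k hk => by rw [← iteratedDeriv_succ']; exact h0 _ (by omega)) w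
    rw [pow_succ, mul_assoc, integral_mul_cis_by_parts hφ, h10, h00, zero_mul, sub_zero, zero_sub,
      mul_neg, this, ← iteratedDeriv_succ', ← iteratedDeriv_succ']
    ring

lemma iteratedDeriv_const_mul_pow_zero (c : ℂ) (n k : ℕ) (hk : k < n) :
    iteratedDeriv k (fun t : ℝ => (c * t) ^ n) 0 = 0 := by
  have h : ∀ k ≤ n, ∃ d : ℂ, iteratedDeriv k (fun t : ℝ => (c * t) ^ n)
      = fun t : ℝ => d * (t : ℂ) ^ (n - k) := by
    intro k
    induction k with
    | zero => exact fun _ => ⟨c ^ n, by ext t; simp [mul_pow]⟩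
    | succ k ih =>
      intro hk
      obtain ⟨d, hd⟩ := ih (by omega)
      refine ⟨d * (n - k : ℕ), ?_⟩
      rw [iteratedDeriv_succ, hd]
      ext t
      have := ((hasDerivAt_id t).ofReal_comp.pow (n - k)).const_mul d
      simp only [id, Complex.ofReal_one, mul_one] at this
      rw [show n - (k + 1) = n - k - 1 by omega, mul_assoc]
      exact this.deriv
  obtain ⟨d, hd⟩ := h k hk.le
  rw [hd]
  simp [Nat.sub_ne_zero_of_lt hk]

/-- Integration by parts in the kernel: apart from the sign of `ℓ` and a power of `z`, it is a
superposition of characters with frequencies in the segment, with weights independent of `ℓ`. -/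
lemma IsCutoff.exists_osKer_eq {χ : ℝ → ℂ} (hχ : IsCutoff χ) (n : ℕ) :
    ∃ (κ : ℂ) (W : ℝ → ℂ), Continuous W ∧ ∀ ℓ z : ℝ, ℓ ≠ 0 → z ≠ 0 →
      osKer χ ℓ n z = (|ℓ| / ℓ : ℝ) * (((z ^ (n + 1))⁻¹ : ℝ) *
        (κ + ∫ t in (0 : ℝ)..1, W t * cis (t * (ℓ * z)))) := by
  set φ : ℝ → ℂ := fun t => χ t * (2 * Real.pi * Complex.I * t) ^ n with hφdef
  have hφ : ContDiff ℝ ∞ φ := by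
    refine hχ.smooth.mul (ContDiff.pow (contDiff_const.mul Complex.ofRealCLM.contDiff) n)
  -- Near 1 the cut-off is zero; near 0 it is one, so there `φ` is exactly a multiple of `t^n`. The
  -- boundary term that survives is the trace of the jump of the symbol.
  have h1 : ∀ k ≤ n, iteratedDeriv k φ 1 = 0 := by
    intro k _
    have : φ =ᶠ[𝓝 1] fun _ => 0 := by
      filter_upwards [lt_mem_nhds (show (2 / 3 : ℝ) < 1 by norm_num)] with t ht
      simp [hφdef, hχ.zero t ht]
    rw [this.iteratedDeriv_eq]; simp
  have h0 : ∀ k < n, iteratedDeriv k φ 0 = 0 := by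
    intro k hk
    have : φ =ᶠ[𝓝 0] fun t : ℝ => (2 * Real.pi * Complex.I * t) ^ n := by
      filter_upwards [gt_mem_nhds (show (0 : ℝ) < 1 / 3 by norm_num)] with t ht
      simp [hφdef, hχ.one t ht]
    rw [this.iteratedDeriv_eq]
    exact iteratedDeriv_const_mul_pow_zero _ _ _ hk
  set β : ℂ := (-1) ^ (n + 1) / (2 * Real.pi * Complex.I) ^ (n + 1) with hβ
  refine ⟨β * iteratedDeriv n φ 0, fun t => β * iteratedDeriv (n + 1) φ t,
    continuous_const.mul (hφ.continuous_iteratedDeriv _ (by exact_mod_cast le_top)), ?_⟩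
  intro ℓ z hℓ hz
  have key := integral_mul_cis_by_parts_iterate n hφ h1 h0 (ℓ * z)
  have hℓ' : (ℓ : ℂ) ≠ 0 := by exact_mod_cast hℓ
  have hz' : (z : ℂ) ≠ 0 := by exact_mod_cast hz
  have hI := Complex.two_pi_I_ne_zero
  have h2 : osc χ n (ℓ * z) = β * (iteratedDeriv n φ 0 +
      ∫ t in (0 : ℝ)..1, iteratedDeriv (n + 1) φ t * cis (t * (ℓ * z))) / (ℓ * z) ^ (n + 1) := by
    rw [eq_div_iff (by positivity), hβ, div_mul_eq_mul_div, ← key, mul_pow _ ((ℓ * z : ℝ) : ℂ)]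
    rw [eq_div_iff (by positivity)]
    simp only [osc, hφdef]
    push_cast
    ring
  rw [osKer, h2]
  simp_rw [mul_assoc β]
  rw [intervalIntegral.integral_const_mul]
  generalize (∫ t in (0 : ℝ)..1, iteratedDeriv (n + 1) φ t * cis (t * (ℓ * z))) = J
  push_cast
  field_simp
  ring

/-- After integration by parts the bracket is bounded uniformly in `ℓ`, so only the power of `z`
remains. -/
lemma IsCutoff.exists_norm_osKer_le_inv {χ : ℝ → ℂ} (hχ : IsCutoff χ) (n : ℕ) :
    ∃ C, 0 < C ∧ ∀ ℓ z, ℓ ≠ 0 → z ≠ 0 → ‖osKer χ ℓ n z‖ ≤ C * (|z| ^ (n + 1))⁻¹ := by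
  obtain ⟨κ, W, hW, h⟩ := hχ.exists_osKer_eq n
  obtain ⟨C, hC⟩ := isCompact_Icc.exists_bound_of_continuousOn (s := Icc (0 : ℝ) 1) hW.continuousOn
  have hC0 : 0 ≤ C := (norm_nonneg _).trans (hC 0 (by simp))
  refine ⟨‖κ‖ + C + 1, by positivity, fun ℓ z hℓ hz => ?_⟩
  have hI : ‖∫ t in (0 : ℝ)..1, W t * cis (t * (ℓ * z))‖ ≤ C := by
    have := intervalIntegral.norm_integral_le_of_norm_le_const (a := (0 : ℝ)) (b := 1) (C := C)
      (f := fun t : ℝ => W t * cis (t * (ℓ * z))) ?_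
    · simpa using this
    · intro t ht
      rw [uIoc_of_le zero_le_one] at ht
      rw [norm_mul, norm_cis, mul_one]
      exact hC t ⟨ht.1.le, ht.2⟩
  rw [h ℓ z hℓ hz, norm_mul, norm_mul, Complex.norm_real, Complex.norm_real]
  have h1 : ‖|ℓ| / ℓ‖ = 1 := by
    rw [norm_div, Real.norm_eq_abs, Real.norm_eq_abs, abs_abs, div_self (abs_ne_zero.2 hℓ)]
  rw [h1, one_mul, norm_inv, norm_pow, Real.norm_eq_abs, mul_comm]
  gcongr
  linarith [norm_add_le κ (∫ t in (0 : ℝ)..1, W t * cis (t * (ℓ * z)))]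

/-- Interpolation between the bound by the length and the bound by the distance, according to which
of `|ℓ|` and `1/|z|` is smaller. Giving up a power `α` of decay buys `|ℓ|^α`, which makes the
operators of short segments small. -/
lemma IsCutoff.exists_norm_osKer_le_rpow {χ : ℝ → ℂ} (hχ : IsCutoff χ) (n : ℕ) {α : ℝ}
    (h0 : 0 ≤ α) (h1 : α ≤ n + 1) :
    ∃ C, 0 < C ∧ ∀ ℓ z, ℓ ≠ 0 → z ≠ 0 →
      ‖osKer χ ℓ n z‖ ≤ C * (|ℓ| ^ α * |z| ^ (-(n + 1 - α))) := by
  obtain ⟨C₁, hC₁, h₁⟩ := exists_norm_osKer_le hχ.smooth.continuous n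
  obtain ⟨C₂, hC₂, h₂⟩ := hχ.exists_norm_osKer_le_inv n
  refine ⟨max C₁ C₂, by positivity, fun ℓ z hℓ hz => ?_⟩
  have hℓ' : 0 < |ℓ| := abs_pos.2 hℓ
  have hz' : 0 < |z| := abs_pos.2 hz
  rcases le_total |ℓ| |z|⁻¹ with h | h
  · refine (h₁ ℓ z).trans ?_
    gcongr
    · exact le_max_left _ _
    · rw [← Real.rpow_natCast, show ((n + 1 : ℕ) : ℝ) = α + (n + 1 - α) by push_cast; ring,
        Real.rpow_add hℓ']
      gcongr
      rw [Real.rpow_neg hz'.le, ← Real.inv_rpow hz'.le]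
      exact Real.rpow_le_rpow hℓ'.le h (by linarith)
  · refine (h₂ ℓ z hℓ hz).trans ?_
    gcongr
    · exact le_max_right _ _
    · rw [← Real.rpow_natCast, ← Real.rpow_neg hz'.le,
        show -((n + 1 : ℕ) : ℝ) = -α + -(n + 1 - α) by push_cast; ring, Real.rpow_add hz']
      gcongr
      rw [Real.rpow_neg hz'.le, ← Real.inv_rpow hz'.le]
      exact Real.rpow_le_rpow (by positivity) h h0

/-- Taylor's formula with the remainder in integral form. -/
lemma taylor_of_hasDerivAt {F : ℕ → ℝ → ℂ} (hF : ∀ n z, HasDerivAt (F n) (F (n + 1) z) z)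
    (c h : ℝ) (k : ℕ) :
    F 0 (c + h) - ∑ j ∈ Finset.range (k + 1), F j c * h ^ j / j.factorial =
      h ^ (k + 1) / k.factorial * ∫ θ in (0 : ℝ)..1, ((1 - θ) ^ k : ℝ) * F (k + 1) (c + θ * h) := by
  have hc : ∀ n, Continuous (F n) := fun n =>
    continuous_iff_continuousAt.2 fun z => (hF n z).continuousAt
  have hd : ∀ n θ, HasDerivAt (fun θ : ℝ => F n (c + θ * h)) (h * F (n + 1) (c + θ * h)) θ := by
    intro n θ
    have h1 : HasDerivAt (fun θ : ℝ => c + θ * h) h θ := by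
      simpa using ((hasDerivAt_id θ).mul_const h).const_add c
    have := (hF n (c + θ * h)).scomp θ h1
    rw [Complex.real_smul] at this
    exact this
  induction k with
  | zero =>
    have := intervalIntegral.integral_eq_sub_of_hasDerivAt (a := 0) (b := 1)
      (fun θ _ => hd 0 θ) ((by have := hc 1; fun_prop :
        Continuous fun θ : ℝ => h * F 1 (c + θ * h)).intervalIntegrable _ _)
    rw [intervalIntegral.integral_const_mul] at this
    simp only [one_mul, zero_mul, add_zero] at this
    simp [this]
  | succ k ih =>
    rw [Finset.sum_range_succ, ← sub_sub, ih]
    -- This primitive of `(1 - θ)^k` vanishes at `θ = 1`; the boundary term at `θ = 0` is the next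
    -- Taylor term.
    have hv : ∀ θ : ℝ, HasDerivAt (fun θ : ℝ => ((-(1 - θ) ^ (k + 1) / (k + 1) : ℝ) : ℂ))
        (((1 - θ) ^ k : ℝ) : ℂ) θ := by
      intro θ
      have h1 : HasDerivAt (fun θ : ℝ => -(1 - θ) ^ (k + 1) / (k + 1)) ((1 - θ) ^ k) θ := by
        have := ((((hasDerivAt_id θ).const_sub 1).pow (k + 1)).neg).div_const ((k : ℝ) + 1)
        convert! this using 1
        push_cast
        have : (k : ℝ) + 1 ≠ 0 := by positivity
        field_simp
        simp
      exact h1.ofReal_comp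
    have := intervalIntegral.integral_mul_deriv_eq_deriv_mul (a := 0) (b := 1)
      (fun θ _ => hd (k + 1) θ) (fun θ _ => hv θ)
      ((by have := hc (k + 2); fun_prop :
        Continuous fun θ : ℝ => h * F (k + 2) (c + θ * h)).intervalIntegrable _ _)
      ((by fun_prop : Continuous fun θ : ℝ => (((1 - θ) ^ k : ℝ) : ℂ)).intervalIntegrable _ _)
    have h2 : ∫ θ in (0 : ℝ)..1, ((1 - θ) ^ k : ℝ) * F (k + 1) (c + θ * h) =
        ∫ θ in (0 : ℝ)..1, F (k + 1) (c + θ * h) * ((1 - θ) ^ k : ℝ) := by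
      congr 1; ext θ; ring
    have h3 : ∫ θ in (0 : ℝ)..1, h * F (k + 1 + 1) (c + θ * h) * ((-(1 - θ) ^ (k + 1) / (k + 1) : ℝ) : ℂ)
        = (-h / (k + 1)) * ∫ θ in (0 : ℝ)..1, ((1 - θ) ^ (k + 1) : ℝ) * F (k + 1 + 1) (c + θ * h) := by
      rw [← intervalIntegral.integral_const_mul]
      congr 1; ext θ; push_cast; ring
    rw [h2, this, h3]
    have h4 : (k : ℂ) + 1 ≠ 0 := by exact_mod_cast Nat.succ_ne_zero k
    have h5 : (k.factorial : ℂ) ≠ 0 := by exact_mod_cast k.factorial_ne_zero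
    rw [Nat.factorial_succ]
    push_cast
    simp only [sub_self, zero_mul, add_zero, sub_zero, one_pow]
    generalize (∫ θ in (0 : ℝ)..1, (1 - (θ : ℂ)) ^ (k + 1) * F (k + 1 + 1) (c + θ * h)) = J
    field_simp
    ring

end

/-! ### The modified operator: the near part and one annulus -/

noncomputable section

/-- The Taylor polynomial in `x`, of degree `< r` and with centre `c`, of the kernel at `x - y`. -/
def osTaylor (χ : ℝ → ℂ) (ℓ : ℝ) (r : ℕ) (c x y : ℝ) : ℂ :=
  ∑ j ∈ Finset.range r, osKer χ ℓ j (c - y) * ((x - c : ℝ) : ℂ) ^ j / j.factorial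

/-- The kernel modified by its Taylor polynomial for `y` outside the double of the interval with
centre `c` and half-length `ρ`. -/
def modKer (χ : ℝ → ℂ) (ℓ : ℝ) (r : ℕ) (c ρ x y : ℝ) : ℂ :=
  osKer χ ℓ 0 (x - y) - if 2 * ρ ≤ |y - c| then osTaylor χ ℓ r c x y else 0

/-- The integral operator with the modified kernel, after a shift of the frequencies by `a`. -/
def modOp (χ : ℝ → ℂ) (a ℓ : ℝ) (r : ℕ) (c ρ : ℝ) (u : ℝ → ℂ) (x : ℝ) : ℂ :=
  ∫ y, modKer χ ℓ r c ρ x y * (cis (-(a * y)) * u y)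

lemma osKer_sub_osTaylor {χ : ℝ → ℂ} (hχ : Continuous χ) (ℓ : ℝ) (k : ℕ) (c x y : ℝ) :
    osKer χ ℓ 0 (x - y) - osTaylor χ ℓ (k + 1) c x y =
      ((x - c : ℝ) : ℂ) ^ (k + 1) / k.factorial *
        ∫ θ in (0 : ℝ)..1, ((1 - θ) ^ k : ℝ) * osKer χ ℓ (k + 1) (c + θ * (x - c) - y) := by
  have h := taylor_of_hasDerivAt (F := fun n z => osKer χ ℓ n (z - y))
    (fun n z => by
      have h1 : HasDerivAt (fun z : ℝ => z - y) 1 z := (hasDerivAt_id z).sub_const y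
      have := (hasDerivAt_osKer hχ ℓ n (z - y)).scomp z h1
      rw [one_smul] at this
      exact this) c (x - c) k
  rw [← h, osTaylor]
  simp

/-- Fubini turns a kernel that is a superposition of characters into a weighted average of the
transform of `v` over the segment, the quantity that Bessel's inequality controls. -/
lemma integral_integral_cis_mul {W : ℝ → ℂ} (hW : Continuous W) {v : ℝ → ℂ} (hv : Integrable v)
    (a ℓ z : ℝ) :
    ∫ y, (∫ t in (0 : ℝ)..1, W t * cis (t * (ℓ * (z - y)))) * (cis (-(a * y)) * v y) =
      ∫ t in (0 : ℝ)..1, W t * cis (t * (ℓ * z)) * ft v (a + t * ℓ) := by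
  obtain ⟨K, hK⟩ := isCompact_Icc.exists_bound_of_continuousOn (s := Icc (0 : ℝ) 1) hW.continuousOn
  have hint : Integrable (Function.uncurry fun (y t : ℝ) =>
      W t * cis (t * (ℓ * (z - y))) * (cis (-(a * y)) * v y))
      (volume.prod (volume.restrict (Ioc (0 : ℝ) 1))) := by
    have h1 := (hv.norm).mul_prod (integrable_const (μ := volume.restrict (Ioc (0 : ℝ) 1)) K)
    refine h1.mono' ?_ ?_
    · have h2 : AEStronglyMeasurable (fun p : ℝ × ℝ => v p.1)
          (volume.prod (volume.restrict (Ioc (0 : ℝ) 1))) := hv.1.comp_fst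
      have h3 : Continuous fun p : ℝ × ℝ => W p.2 * cis (p.2 * (ℓ * (z - p.1))) := by fun_prop
      have h4 : Continuous fun p : ℝ × ℝ => cis (-(a * p.1)) := by fun_prop
      exact h3.aestronglyMeasurable.mul (h4.aestronglyMeasurable.mul h2)
    · have : ∀ᵐ p : ℝ × ℝ ∂(volume.prod (volume.restrict (Ioc (0 : ℝ) 1))), p.2 ∈ Ioc (0 : ℝ) 1 := by
        have h5 : ∀ᵐ t ∂(volume.restrict (Ioc (0 : ℝ) 1)), t ∈ Ioc (0 : ℝ) 1 :=
          ae_restrict_mem measurableSet_Ioc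
        exact Measure.quasiMeasurePreserving_snd.ae h5
      filter_upwards [this] with p hp
      simp only [Function.uncurry, norm_mul, norm_cis, mul_one, one_mul]
      rw [mul_comm]
      gcongr
      exact hK _ ⟨hp.1.le, hp.2⟩
  simp_rw [intervalIntegral.integral_of_le zero_le_one, ← integral_mul_const]
  rw [integral_integral_swap hint]
  congr 1; ext t
  rw [ft, ← integral_const_mul]
  congr 1; ext y
  rw [show t * (ℓ * (z - y)) = t * (ℓ * z) + -(t * ℓ * y) by ring, cis_add,
    show -((a + t * ℓ) * y) = -(t * ℓ * y) + -(a * y) by ring, cis_add]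
  ring

lemma integral_osKer_mul {χ : ℝ → ℂ} (hχ : Continuous χ) {v : ℝ → ℂ} (hv : Integrable v)
    (a ℓ z : ℝ) (n : ℕ) :
    ∫ y, osKer χ ℓ n (z - y) * (cis (-(a * y)) * v y) =
      (|ℓ| * ℓ ^ n : ℝ) * ∫ t in (0 : ℝ)..1,
        χ t * (2 * Real.pi * Complex.I * t) ^ n * cis (t * (ℓ * z)) * ft v (a + t * ℓ) := by
  rw [← integral_integral_cis_mul (W := fun t : ℝ => χ t * (2 * Real.pi * Complex.I * t) ^ n)
    (by fun_prop) hv, ← integral_const_mul]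
  congr 1; ext y
  simp only [osKer, osc]
  push_cast; ring

lemma enorm_intervalIntegral_mul_sq_le {W G : ℝ → ℂ} {K : ℝ} (hW : Continuous W) (hG : Continuous G)
    (hK : ∀ t ∈ Icc (0 : ℝ) 1, ‖W t‖ ≤ K) (w : ℝ) :
    ‖∫ t in (0 : ℝ)..1, W t * cis (t * w) * G t‖ₑ ^ 2 ≤
      ENNReal.ofReal (K ^ 2) * ∫⁻ t in Icc (0 : ℝ) 1, ‖G t‖ₑ ^ 2 := by
  have hK0 : 0 ≤ K := (norm_nonneg _).trans (hK 0 (by simp))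
  rw [intervalIntegral.integral_of_le zero_le_one, ← integral_Icc_eq_integral_Ioc]
  refine (enorm_integral_sq_le
    (by fun_prop : Continuous fun t : ℝ => W t * cis (t * w) * G t).aestronglyMeasurable).trans ?_
  rw [Measure.restrict_apply_univ, Real.volume_Icc, sub_zero, ENNReal.ofReal_one, one_mul,
    ← lintegral_const_mul' _ _ ENNReal.ofReal_ne_top]
  refine setLIntegral_mono (by fun_prop) fun t ht => ?_
  rw [enorm_mul, enorm_mul, enorm_cis, mul_one, mul_pow, ← ofReal_norm (W t),
    ← ENNReal.ofReal_pow (norm_nonneg _)]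
  gcongr
  exact hK t ht

lemma lintegral_comp_mul {F : ℝ → ℝ≥0∞} (ℓ : ℝ) (hℓ : ℓ ≠ 0) :
    ENNReal.ofReal |ℓ| * ∫⁻ x, F (ℓ * x) = ∫⁻ x, F x := by
  have him : (fun x => ℓ * x) '' univ = univ := by
    rw [image_univ]; exact (mul_left_surjective₀ hℓ).range_eq
  rw [← setLIntegral_univ F, ← him, lintegral_image_eq_lintegral_abs_deriv_mul (f' := fun _ => ℓ)
    MeasurableSet.univ (fun t _ => (by simpa using (hasDerivAt_id t).const_mul ℓ :
      HasDerivAt (fun x => ℓ * x) ℓ t).hasDerivWithinAt)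
    (fun s _ t _ h => by simpa [hℓ] using h), lintegral_const_mul' _ _ (by simp), setLIntegral_univ]

variable {ι : Type*} [Countable ι]

/-- Each piece is the Fourier transform, in the variable `-ℓx`, of the transform of `u` on the
segment multiplied by the bounded cut-off. Plancherel on each segment followed by Bessel gives the
bound. -/
lemma DisjointSegments.tsum_lintegral_near_le {a ℓ : ι → ℝ} (h : DisjointSegments a ℓ) {χ : ℝ → ℂ}
    (hχ : Continuous χ) {K : ℝ} (hK : ∀ t ∈ Icc (0 : ℝ) 1, ‖χ t‖ ≤ K) {u : ℝ → ℂ}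
    (hu : Integrable u) (hu2 : MemLp u 2) :
    ∑' m, ∫⁻ x, ‖∫ y, osKer χ (ℓ m) 0 (x - y) * (cis (-(a m * y)) * u y)‖ₑ ^ 2 ≤
      ENNReal.ofReal (K ^ 2) * ∫⁻ y, ‖u y‖ₑ ^ 2 := by
  have hK0 : 0 ≤ K := (norm_nonneg _).trans (hK 0 (by simp))
  refine le_trans ?_ (mul_le_mul_right (h.bessel hu hu2) _)
  rw [← ENNReal.tsum_mul_left]
  refine ENNReal.tsum_le_tsum fun m => ?_
  set G : ℝ → ℂ := fun t => ft u (a m + t * ℓ m) with hG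
  have hGc : Continuous G := (continuous_ft hu).comp (by fun_prop)
  set v : ℝ → ℂ := indicator (Ioc 0 1) fun t => χ t * G t with hv
  have hc : Continuous fun t => χ t * G t := by fun_prop
  have hvm : AEStronglyMeasurable v := hc.aestronglyMeasurable.indicator measurableSet_Ioc
  have hfin : volume (Ioc (0 : ℝ) 1) ≠ ⊤ := by simp
  have hv2 : MemLp v 2 := by
    rw [hv, memLp_indicator_iff_restrict measurableSet_Ioc]
    obtain ⟨D, hD⟩ := isCompact_Icc.exists_bound_of_continuousOn (s := Icc (0 : ℝ) 1) hc.continuousOn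
    refine MemLp.of_bound hc.aestronglyMeasurable D ?_
    filter_upwards [ae_restrict_mem measurableSet_Ioc] with t ht using hD t ⟨ht.1.le, ht.2⟩
  have hvi : Integrable v := by
    rw [hv, integrable_indicator_iff measurableSet_Ioc]
    exact (hc.integrableOn_Icc (a := 0) (b := 1)).mono_set Ioc_subset_Icc_self
  have hval : ∀ x, ∫ y, osKer χ (ℓ m) 0 (x - y) * (cis (-(a m * y)) * u y) =
      (|ℓ m| : ℝ) * ft v ((-ℓ m) * x) := by
    intro x
    rw [integral_osKer_mul hχ hu, ft, intervalIntegral.integral_of_le zero_le_one,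
      ← integral_indicator measurableSet_Ioc]
    simp only [pow_zero, mul_one]
    congr 2; ext t
    by_cases ht : t ∈ Ioc (0 : ℝ) 1
    · simp only [hv, indicator_of_mem ht, hG]
      rw [show -(-ℓ m * x * t) = t * (ℓ m * x) by ring]; ring
    · simp [hv, indicator_of_notMem ht]
  have hl : ENNReal.ofReal |ℓ m| ≠ 0 := by simpa using h.ne m
  simp_rw [hval, enorm_mul, mul_pow]
  rw [lintegral_const_mul' _ _ (by simp)]
  have hs := lintegral_comp_mul (F := fun ξ => ‖ft v ξ‖ₑ ^ 2) (-ℓ m) (neg_ne_zero.2 (h.ne m))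
  rw [lintegral_ft_sq hvi hv2, abs_neg] at hs
  have he : ‖((|ℓ m| : ℝ) : ℂ)‖ₑ = ENNReal.ofReal |ℓ m| := by
    rw [← ofReal_norm, Complex.norm_real, Real.norm_eq_abs, abs_abs]
  rw [he, pow_two, mul_assoc, hs, ← mul_assoc, mul_comm (ENNReal.ofReal (K ^ 2)), mul_assoc]
  gcongr
  rw [← lintegral_const_mul' _ _ ENNReal.ofReal_ne_top, ← lintegral_indicator measurableSet_Icc]
  refine lintegral_mono fun t => ?_
  by_cases ht : t ∈ Ioc (0 : ℝ) 1
  · have ht' : t ∈ Icc (0 : ℝ) 1 := ⟨ht.1.le, ht.2⟩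
    simp only [hv, indicator_of_mem ht, indicator_of_mem ht', enorm_mul, mul_pow]
    rw [← ofReal_norm (χ t), ← ENNReal.ofReal_pow (norm_nonneg _)]
    gcongr
    exact hK t ht'
  · simp [hv, indicator_of_notMem ht]

/-- The estimate for a function which lives at distance about `R` from the point `z`. -/
lemma IsCutoff.exists_tsum_annulus_le {χ : ℝ → ℂ} (hχ : IsCutoff χ) (r : ℕ) :
    ∃ C : ℝ, 0 < C ∧ ∀ {ι : Type} [Countable ι] {a ℓ : ι → ℝ}, DisjointSegments a ℓ →
      ∀ {v : ℝ → ℂ}, Integrable v → MemLp v 2 → ∀ {R c z : ℝ}, 0 < R →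
      (∀ y, R < |y - c| → v y = 0) → (∀ y, |z - y| < R / 4 → v y = 0) →
      ∑' m, ‖∫ y, osKer χ (ℓ m) r (z - y) * (cis (-(a m * y)) * v y)‖ₑ ^ 2 ≤
        ENNReal.ofReal (C * (R ^ (2 * r + 1))⁻¹) * ∫⁻ y, ‖v y‖ₑ ^ 2 := by
  obtain ⟨K, hK0, hK⟩ := exists_norm_osc_le hχ.smooth.continuous r
  obtain ⟨κ, W, hW, hker⟩ := hχ.exists_osKer_eq r
  obtain ⟨D, hD⟩ := isCompact_Icc.exists_bound_of_continuousOn (s := Icc (0 : ℝ) 1) hW.continuousOn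
  refine ⟨K ^ 2 + (320 * ‖κ‖ ^ 2 + 2 * D ^ 2) * 4 ^ (2 * r + 2), by positivity, ?_⟩
  intro ι _ a ℓ hd v hv hv2 R c z hR hsupp hsupp'
  -- The power of `z - y` produced by integration by parts is absorbed into the function; since `v`
  -- vanishes near `z`, this costs only `(4/R)^(r+1)`.
  set v₁ : ℝ → ℂ := fun y => (((z - y) ^ (r + 1))⁻¹ : ℝ) * v y with hv₁
  have hv₁le : ∀ y, ‖v₁ y‖ ≤ (4 / R) ^ (r + 1) * ‖v y‖ := by
    intro y
    by_cases hy : |z - y| < R / 4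
    · simp [hv₁, hsupp' y hy]
    · push Not at hy
      have hp : 0 < |z - y| := by linarith
      rw [hv₁, norm_mul, Complex.norm_real, norm_inv, norm_pow, Real.norm_eq_abs, ← inv_pow]
      gcongr
      rw [inv_le_comm₀ hp (by positivity), inv_div]
      exact hy
  have hm₁ : AEStronglyMeasurable v₁ := by
    have hmeas : Measurable fun y : ℝ => ((((z - y) ^ (r + 1))⁻¹ : ℝ) : ℂ) := by fun_prop
    exact hmeas.aestronglyMeasurable.mul hv.1
  have hv₁i : Integrable v₁ := (hv.norm.const_mul _).mono' hm₁ (Eventually.of_forall hv₁le)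
  have hv₁2 : MemLp v₁ 2 := hv2.of_le_mul hm₁ (Eventually.of_forall hv₁le)
  have hv₁L : ∫⁻ y, ‖v₁ y‖ₑ ^ 2 ≤ ENNReal.ofReal ((4 / R) ^ (2 * r + 2)) * ∫⁻ y, ‖v y‖ₑ ^ 2 := by
    rw [← lintegral_const_mul' _ _ ENNReal.ofReal_ne_top]
    refine lintegral_mono fun y => ?_
    rw [← ofReal_norm, ← ofReal_norm, ← ENNReal.ofReal_pow (norm_nonneg _),
      ← ENNReal.ofReal_pow (norm_nonneg _), ← ENNReal.ofReal_mul (by positivity)]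
    apply ENNReal.ofReal_le_ofReal
    refine (pow_le_pow_left₀ (norm_nonneg _) (hv₁le y) 2).trans_eq ?_
    rw [mul_pow, ← pow_mul]; ring_nf
  have hpt : ∀ m, ‖∫ y, osKer χ (ℓ m) r (z - y) * (cis (-(a m * y)) * v y)‖ₑ ^ 2 ≤
      ENNReal.ofReal (K ^ 2 * (R ^ (2 * r + 1))⁻¹) *
        (ENNReal.ofReal |ℓ m| * ∫⁻ t in Icc (0 : ℝ) 1, ‖ft v (a m + t * ℓ m)‖ₑ ^ 2) +
      (ENNReal.ofReal (2 * ‖κ‖ ^ 2) * (if 1 ≤ R * |ℓ m| then ‖ft v₁ (a m)‖ₑ ^ 2 else 0) +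
      ENNReal.ofReal (2 * D ^ 2 * R) *
        (ENNReal.ofReal |ℓ m| * ∫⁻ t in Icc (0 : ℝ) 1, ‖ft v₁ (a m + t * ℓ m)‖ₑ ^ 2)) := by
    intro m
    have hℓ := hd.ne m
    -- For a short segment the definition of the kernel suffices: of the `2r + 2` factors `|ℓ|`, all
    -- but one are at most `1/R`, and the last is the weight in Bessel's inequality. For a long
    -- segment the kernel is integrated by parts, and `1 ≤ R|ℓ|` supplies that weight.
    rcases lt_or_ge (R * |ℓ m|) 1 with hs | hs
    · refine le_trans ?_ le_self_add
      rw [integral_osKer_mul hχ.smooth.continuous hv, enorm_mul, mul_pow]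
      have h1 := enorm_intervalIntegral_mul_sq_le (G := fun t => ft v (a m + t * ℓ m))
        (W := fun t : ℝ => χ t * (2 * Real.pi * Complex.I * t) ^ r)
        (by have := hχ.smooth.continuous; fun_prop) ((continuous_ft hv).comp (by fun_prop)) hK
        (ℓ m * z)
      refine (mul_le_mul_right h1 _).trans ?_
      rw [← ofReal_norm, Complex.norm_real, ← ENNReal.ofReal_pow (norm_nonneg _), ← mul_assoc,
        ← mul_assoc, ← ENNReal.ofReal_mul (by positivity), ← ENNReal.ofReal_mul (by positivity)]
      refine mul_le_mul_left (ENNReal.ofReal_le_ofReal ?_) _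
      rw [norm_mul, norm_pow, Real.norm_eq_abs, Real.norm_eq_abs, abs_abs]
      have h2 : |ℓ m| ≤ R⁻¹ := by
        rw [le_inv_comm₀ (abs_pos.2 hℓ) hR, le_inv_comm₀ hR (abs_pos.2 hℓ)]
        rw [← one_div, le_div_iff₀ hR]; linarith
      calc (|ℓ m| * |ℓ m| ^ r) ^ 2 * K ^ 2 = K ^ 2 * |ℓ m| ^ (2 * r + 1) * |ℓ m| := by ring
        _ ≤ K ^ 2 * (R⁻¹) ^ (2 * r + 1) * |ℓ m| := by gcongr
        _ = _ := by rw [inv_pow]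
    · refine le_trans ?_ le_add_self
      rw [if_pos hs]
      have h1 : ∫ y, osKer χ (ℓ m) r (z - y) * (cis (-(a m * y)) * v y) =
          (|ℓ m| / ℓ m : ℝ) * (κ * ft v₁ (a m) +
            ∫ t in (0 : ℝ)..1, W t * cis (t * (ℓ m * z)) * ft v₁ (a m + t * ℓ m)) := by
        rw [← integral_integral_cis_mul hW hv₁i, ft, ← integral_const_mul, ← integral_add,
          ← integral_const_mul]
        · congr 1; ext y
          by_cases hy : |z - y| < R / 4
          · simp [hv₁, hsupp' y hy]
          · have hz : z - y ≠ 0 := by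
              intro h0; rw [h0, abs_zero] at hy; exact hy (by positivity)
            rw [hker _ _ hℓ hz]
            simp only [hv₁]; ring
        · refine Integrable.const_mul ?_ _
          exact hv₁i.bdd_mul (c := 1) (by fun_prop) (Eventually.of_forall fun y => by simp)
        · have hc : Continuous fun y : ℝ => ∫ t in (0 : ℝ)..1, W t * cis (t * (ℓ m * (z - y))) :=
            intervalIntegral.continuous_parametric_intervalIntegral_of_continuous' (by fun_prop) _ _
          refine Integrable.bdd_mul (c := D) ?_ hc.aestronglyMeasurable (Eventually.of_forall fun y => ?_)
          · exact hv₁i.bdd_mul (c := 1) (by fun_prop) (Eventually.of_forall fun y => by simp)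
          · have := intervalIntegral.norm_integral_le_of_norm_le_const (a := (0 : ℝ)) (b := 1) (C := D)
              (f := fun t : ℝ => W t * cis (t * (ℓ m * (z - y)))) ?_
            · simpa using this
            · intro t ht
              rw [uIoc_of_le zero_le_one] at ht
              rw [norm_mul, norm_cis, mul_one]
              exact hD t ⟨ht.1.le, ht.2⟩
      have h2 : ‖((|ℓ m| / ℓ m : ℝ) : ℂ)‖ₑ = 1 := by
        rw [← ofReal_norm, Complex.norm_real, norm_div, Real.norm_eq_abs, Real.norm_eq_abs, abs_abs,
          div_self (abs_ne_zero.2 hℓ), ENNReal.ofReal_one]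
      have h3 := enorm_intervalIntegral_mul_sq_le (G := fun t => ft v₁ (a m + t * ℓ m)) hW
        ((continuous_ft hv₁i).comp (by fun_prop)) hD (ℓ m * z)
      have h4 : (1 : ℝ≥0∞) ≤ ENNReal.ofReal R * ENNReal.ofReal |ℓ m| := by
        rw [← ENNReal.ofReal_mul hR.le, ← ENNReal.ofReal_one]
        exact ENNReal.ofReal_le_ofReal hs
      rw [h1, enorm_mul, h2, one_mul]
      calc _ ≤ 2 * (‖κ * ft v₁ (a m)‖ₑ ^ 2 +
            ‖∫ t in (0 : ℝ)..1, W t * cis (t * (ℓ m * z)) * ft v₁ (a m + t * ℓ m)‖ₑ ^ 2) :=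
            (pow_le_pow_left' (enorm_add_le _ _) 2).trans (ENNReal.add_sq_le _ _)
        _ ≤ 2 * (‖κ‖ₑ ^ 2 * ‖ft v₁ (a m)‖ₑ ^ 2 + ENNReal.ofReal (D ^ 2) *
            (1 * ∫⁻ t in Icc (0 : ℝ) 1, ‖ft v₁ (a m + t * ℓ m)‖ₑ ^ 2)) := by
            rw [enorm_mul, mul_pow, one_mul]; gcongr
        _ ≤ 2 * (‖κ‖ₑ ^ 2 * ‖ft v₁ (a m)‖ₑ ^ 2 + ENNReal.ofReal (D ^ 2) *
            (ENNReal.ofReal R * ENNReal.ofReal |ℓ m| *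
              ∫⁻ t in Icc (0 : ℝ) 1, ‖ft v₁ (a m + t * ℓ m)‖ₑ ^ 2)) := by gcongr
        _ = _ := by
            rw [← ofReal_norm κ, ← ENNReal.ofReal_pow (norm_nonneg _), mul_add,
              ENNReal.ofReal_mul (by norm_num : (0 : ℝ) ≤ 2), mul_assoc 2 (D ^ 2) R,
              ENNReal.ofReal_mul (by norm_num : (0 : ℝ) ≤ 2), ENNReal.ofReal_mul (by positivity),
              show ENNReal.ofReal 2 = 2 by norm_num]
            ring
  refine (ENNReal.tsum_le_tsum hpt).trans ?_
  rw [ENNReal.tsum_add, ENNReal.tsum_add, ENNReal.tsum_mul_left, ENNReal.tsum_mul_left,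
    ENNReal.tsum_mul_left]
  set L := ∫⁻ y, ‖v y‖ₑ ^ 2 with hL
  calc _ ≤ ENNReal.ofReal (K ^ 2 * (R ^ (2 * r + 1))⁻¹) * L +
        (ENNReal.ofReal (2 * ‖κ‖ ^ 2) * (ENNReal.ofReal (160 * R) *
            (ENNReal.ofReal ((4 / R) ^ (2 * r + 2)) * L)) +
          ENNReal.ofReal (2 * D ^ 2 * R) * (ENNReal.ofReal ((4 / R) ^ (2 * r + 2)) * L)) := by
        gcongr
        · exact hd.bessel hv hv2
        · refine (hd.sieve hv₁i hv₁2 c hR ?_).trans (mul_le_mul_right hv₁L _)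
          intro y hy
          simp [hv₁, hsupp y hy]
        · exact (hd.bessel hv₁i hv₁2).trans hv₁L
    _ = ENNReal.ofReal (K ^ 2 * (R ^ (2 * r + 1))⁻¹ + (2 * ‖κ‖ ^ 2 * (160 * R) *
          (4 / R) ^ (2 * r + 2) + 2 * D ^ 2 * R * (4 / R) ^ (2 * r + 2))) * L := by
        rw [ENNReal.ofReal_add (by positivity) (by positivity),
          ENNReal.ofReal_add (by positivity) (by positivity),
          ENNReal.ofReal_mul (p := 2 * ‖κ‖ ^ 2 * (160 * R)) (by positivity),
          ENNReal.ofReal_mul (p := 2 * ‖κ‖ ^ 2) (by positivity),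
          ENNReal.ofReal_mul (p := 2 * D ^ 2 * R) (by positivity)]
        ring
    _ = _ := by
        congr 2
        rw [div_pow]
        field_simp
        ring

end

/-! ### Summation over dyadic shells: the estimate on one interval -/

noncomputable section

lemma ENNReal.tsum_mul_sq_le (a b : ℕ → ℝ≥0∞) :
    (∑' j, a j * b j) ^ 2 ≤ (∑' j, a j ^ 2) * ∑' j, b j ^ 2 := by
  have := ENNReal.lintegral_mul_le_Lp_mul_Lq Measure.count Real.HolderConjugate.two_two
    (f := a) (g := b) (measurable_of_countable _).aemeasurable
    (measurable_of_countable _).aemeasurable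
  simp only [Pi.mul_apply, lintegral_count] at this
  calc _ ≤ ((∑' j, a j ^ (2 : ℝ)) ^ (1 / 2 : ℝ) * (∑' j, b j ^ (2 : ℝ)) ^ (1 / 2 : ℝ)) ^ 2 := by
        gcongr
    _ = _ := by
      rw [mul_pow, ← ENNReal.rpow_natCast, ← ENNReal.rpow_mul, ← ENNReal.rpow_natCast,
        ← ENNReal.rpow_mul]
      simp

lemma continuous_integral_osKer_mul {χ : ℝ → ℂ} (hχ : Continuous χ) {v : ℝ → ℂ} (hv : Integrable v)
    (a ℓ : ℝ) (n : ℕ) : Continuous fun z => ∫ y, osKer χ ℓ n (z - y) * (cis (-(a * y)) * v y) := by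
  obtain ⟨C, hC0, hC⟩ := exists_norm_osKer_le hχ n
  refine continuous_of_dominated (bound := fun y => C * |ℓ| ^ (n + 1) * ‖v y‖) ?_ ?_
    (hv.norm.const_mul _) ?_
  · intro z
    have h1 : Continuous fun y => osKer χ ℓ n (z - y) :=
      (continuous_osKer hχ ℓ n).comp (by fun_prop)
    have h2 : Continuous fun y => cis (-(a * y)) := by fun_prop
    exact h1.aestronglyMeasurable.mul (h2.aestronglyMeasurable.mul hv.1)
  · intro z
    filter_upwards with y
    rw [norm_mul, norm_mul, norm_cis, one_mul]
    gcongr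
    exact hC _ _
  · filter_upwards with y
    have := continuous_osKer hχ ℓ n
    fun_prop

lemma integral_remainder_mul {χ : ℝ → ℂ} (hχ : Continuous χ) {v : ℝ → ℂ} (hv : Integrable v)
    (a ℓ c x : ℝ) (k : ℕ) :
    ∫ y, (osKer χ ℓ 0 (x - y) - osTaylor χ ℓ (k + 1) c x y) * (cis (-(a * y)) * v y) =
      ((x - c : ℝ) : ℂ) ^ (k + 1) / k.factorial * ∫ θ in (0 : ℝ)..1, ((1 - θ) ^ k : ℝ) *
        ∫ y, osKer χ ℓ (k + 1) (c + θ * (x - c) - y) * (cis (-(a * y)) * v y) := by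
  obtain ⟨C, hC0, hC⟩ := exists_norm_osKer_le hχ (k + 1)
  have hck := continuous_osKer hχ ℓ (k + 1)
  have hint : Integrable (Function.uncurry fun (y θ : ℝ) => ((1 - θ) ^ k : ℝ) *
      osKer χ ℓ (k + 1) (c + θ * (x - c) - y) * (cis (-(a * y)) * v y))
      (volume.prod (volume.restrict (Ioc (0 : ℝ) 1))) := by
    have h1 := (hv.norm).mul_prod
      (integrable_const (μ := volume.restrict (Ioc (0 : ℝ) 1)) (C * |ℓ| ^ (k + 2)))
    refine h1.mono' ?_ ?_
    · have h2 : AEStronglyMeasurable (fun p : ℝ × ℝ => v p.1)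
          (volume.prod (volume.restrict (Ioc (0 : ℝ) 1))) := hv.1.comp_fst
      have h3 : Continuous fun p : ℝ × ℝ => ((1 - p.2) ^ k : ℝ) *
        osKer χ ℓ (k + 1) (c + p.2 * (x - c) - p.1) := by fun_prop
      have h4 : Continuous fun p : ℝ × ℝ => cis (-(a * p.1)) := by fun_prop
      exact h3.aestronglyMeasurable.mul (h4.aestronglyMeasurable.mul h2)
    · have : ∀ᵐ p : ℝ × ℝ ∂(volume.prod (volume.restrict (Ioc (0 : ℝ) 1))), p.2 ∈ Ioc (0 : ℝ) 1 :=
        Measure.quasiMeasurePreserving_snd.ae (ae_restrict_mem measurableSet_Ioc)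
      filter_upwards [this] with p hp
      simp only [Function.uncurry, norm_mul, norm_cis, one_mul]
      rw [mul_comm]
      refine mul_le_mul_of_nonneg_left ?_ (norm_nonneg _)
      have h5 : ‖(((1 - p.2) ^ k : ℝ) : ℂ)‖ ≤ 1 := by
        rw [Complex.norm_real, norm_pow, Real.norm_eq_abs, abs_of_nonneg (by linarith [hp.2])]
        exact pow_le_one₀ (by linarith [hp.2]) (by linarith [hp.1])
      calc _ ≤ 1 * (C * |ℓ| ^ (k + 2)) := mul_le_mul h5 (hC _ _) (norm_nonneg _) zero_le_one
        _ = _ := one_mul _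
  simp_rw [osKer_sub_osTaylor hχ, mul_assoc (((x - c : ℝ) : ℂ) ^ (k + 1) / k.factorial)]
  rw [integral_const_mul]
  congr 1
  simp_rw [intervalIntegral.integral_of_le zero_le_one, ← integral_mul_const]
  rw [integral_integral_swap hint]
  congr 1; ext θ
  rw [← integral_const_mul]
  congr 1; ext y; ring

/-- Cauchy–Schwarz in the parameter of Taylor's remainder. The square stays inside the mean over the
intermediate points, so that the sum over the segments can later be taken at each of these points
separately. -/
lemma enorm_integral_remainder_sq_le {χ : ℝ → ℂ} (hχ : Continuous χ) {v : ℝ → ℂ}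
    (hv : Integrable v) (a ℓ c : ℝ) {x ρ : ℝ} (hx : |x - c| ≤ ρ) (k : ℕ) :
    ‖∫ y, (osKer χ ℓ 0 (x - y) - osTaylor χ ℓ (k + 1) c x y) * (cis (-(a * y)) * v y)‖ₑ ^ 2 ≤
      ENNReal.ofReal (ρ ^ (2 * (k + 1))) * ∫⁻ θ in Icc (0 : ℝ) 1,
        ‖∫ y, osKer χ ℓ (k + 1) (c + θ * (x - c) - y) * (cis (-(a * y)) * v y)‖ₑ ^ 2 := by
  have hc : Continuous fun θ : ℝ =>
      ∫ y, osKer χ ℓ (k + 1) (c + θ * (x - c) - y) * (cis (-(a * y)) * v y) :=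
    (continuous_integral_osKer_mul hχ hv a ℓ (k + 1)).comp
      (by fun_prop : Continuous fun θ : ℝ => c + θ * (x - c))
  have hρ : 0 ≤ ρ := (abs_nonneg _).trans hx
  rw [integral_remainder_mul hχ hv, enorm_mul, mul_pow]
  gcongr
  · rw [← ofReal_norm, ← ENNReal.ofReal_pow (norm_nonneg _)]
    apply ENNReal.ofReal_le_ofReal
    rw [norm_div, norm_pow, Complex.norm_real, Real.norm_eq_abs, Complex.norm_natCast,
      mul_comm 2, pow_mul]
    gcongr
    calc |x - c| ^ (k + 1) / k.factorial ≤ |x - c| ^ (k + 1) :=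
          div_le_self (by positivity) (by exact_mod_cast k.factorial_pos)
      _ ≤ _ := by gcongr
  · rw [intervalIntegral.integral_of_le zero_le_one, ← integral_Icc_eq_integral_Ioc]
    refine (enorm_integral_sq_le
      (by fun_prop : Continuous fun θ : ℝ => (((1 - θ) ^ k : ℝ) : ℂ) *
        ∫ y, osKer χ ℓ (k + 1) (c + θ * (x - c) - y) *
          (cis (-(a * y)) * v y)).aestronglyMeasurable).trans ?_
    rw [Measure.restrict_apply_univ, Real.volume_Icc, sub_zero, ENNReal.ofReal_one, one_mul]
    refine setLIntegral_mono (hc.enorm.measurable.pow_const 2) fun θ hθ => ?_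
    rw [enorm_mul, mul_pow]
    refine mul_le_of_le_one_left' ?_
    refine pow_le_one₀ zero_le ?_
    rw [← ofReal_norm, Complex.norm_real, norm_pow, Real.norm_eq_abs,
      abs_of_nonneg (by linarith [hθ.2])]
    exact ENNReal.ofReal_le_one.2 (pow_le_one₀ (by linarith [hθ.2]) (by linarith [hθ.1]))

/-- The dyadic annuli around `c`. -/
def dyadicShell (c ρ : ℝ) (j : ℕ) : Set ℝ :=
  {y | 2 ^ (j + 1) * ρ ≤ |y - c| ∧ |y - c| < 2 ^ (j + 2) * ρ}

lemma measurableSet_dyadicShell (c ρ : ℝ) (j : ℕ) : MeasurableSet (dyadicShell c ρ j) :=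
  (measurableSet_le (f := fun _ => 2 ^ (j + 1) * ρ) (g := fun y => |y - c|) measurable_const
    (by fun_prop)).inter (measurableSet_lt (f := fun y => |y - c|) (by fun_prop) measurable_const)

lemma iUnion_dyadicShell (c : ℝ) {ρ : ℝ} (hρ : 0 < ρ) :
    ⋃ j, dyadicShell c ρ j = {y | 2 * ρ ≤ |y - c|} := by
  ext y
  simp only [mem_iUnion, dyadicShell, mem_ofPred_eq]
  constructor
  · rintro ⟨j, hj, -⟩
    refine le_trans ?_ hj
    have : (1 : ℝ) ≤ 2 ^ j := one_le_pow₀ (by norm_num)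
    rw [pow_succ]; nlinarith
  · intro hy
    have h1 : 1 ≤ |y - c| / (2 * ρ) := by rw [one_le_div (by positivity)]; exact hy
    obtain ⟨j, h2, h3⟩ := exists_nat_pow_near h1 (by norm_num : (1 : ℝ) < 2)
    rw [le_div_iff₀ (by positivity)] at h2
    rw [div_lt_iff₀ (by positivity)] at h3
    exact ⟨j, by rw [pow_succ]; linarith, by rw [pow_succ]; linarith⟩

lemma pairwise_disjoint_dyadicShell (c : ℝ) {ρ : ℝ} (hρ : 0 < ρ) :
    Pairwise (Function.onFun Disjoint (dyadicShell c ρ)) := by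
  have key : ∀ i j, i < j → Disjoint (dyadicShell c ρ i) (dyadicShell c ρ j) := by
    intro i j hij
    rw [Set.disjoint_left]
    rintro y ⟨-, h1⟩ ⟨h2, -⟩
    have : (2 : ℝ) ^ (i + 2) ≤ 2 ^ (j + 1) := pow_le_pow_right₀ (by norm_num) (by omega)
    have := mul_le_mul_of_nonneg_right this hρ.le
    linarith
  intro i j hij
  rcases lt_or_gt_of_ne hij with h | h
  · exact key i j h
  · exact (key j i h).symm

lemma Icc_eq_abs_sub_le (c ρ : ℝ) : Icc (c - ρ) (c + ρ) = {y | |y - c| ≤ ρ} := by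
  ext y; simp only [mem_Icc, mem_ofPred_eq, abs_le]; constructor <;> rintro ⟨h1, h2⟩ <;>
    constructor <;> linarith

variable {ι : Type*}

lemma integrableOn_of_lintegral_sq {h : ℝ → ℂ} (hm : AEStronglyMeasurable h) {s : Set ℝ}
    (hs : volume s ≠ ⊤) (hfin : ∫⁻ y in s, ‖h y‖ₑ ^ 2 ≠ ⊤) :
    IntegrableOn h s ∧ MemLp h 2 (volume.restrict s) := by
  have h2 : MemLp h 2 (volume.restrict s) := by
    refine ⟨hm.restrict, ?_⟩
    rw [eLpNorm_lt_top_iff_lintegral_rpow_enorm_lt_top (by norm_num) (by norm_num)]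
    simpa using hfin.lt_top
  have : IsFiniteMeasure (volume.restrict s) := ⟨by simpa using hs.lt_top⟩
  exact ⟨h2.integrable (by norm_num), h2⟩

/-- The Taylor correction is absent on the near part and present on every shell, so the integral
splits accordingly. If the integrand is not integrable, the left side is zero by convention. -/
lemma enorm_modOp_le {χ : ℝ → ℂ} (a ℓ : ℝ) (r : ℕ) (c x : ℝ) {ρ : ℝ} (hρ : 0 < ρ) (h : ℝ → ℂ) :
    ‖modOp χ a ℓ r c ρ h x‖ₑ ≤
      ‖∫ y, osKer χ ℓ 0 (x - y) * (cis (-(a * y)) * indicator {y | |y - c| < 2 * ρ} h y)‖ₑ +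
      ∑' j, ‖∫ y, (osKer χ ℓ 0 (x - y) - osTaylor χ ℓ r c x y) *
        (cis (-(a * y)) * indicator (dyadicShell c ρ j) h y)‖ₑ := by
  by_cases hi : Integrable fun y => modKer χ ℓ r c ρ x y * (cis (-(a * y)) * h y)
  · have hE : MeasurableSet {y : ℝ | |y - c| < 2 * ρ} :=
      measurableSet_lt (by fun_prop) measurable_const
    have hEc : {y : ℝ | |y - c| < 2 * ρ}ᶜ = ⋃ j, dyadicShell c ρ j := by
      rw [iUnion_dyadicShell c hρ]; ext y; simp
    rw [modOp, ← integral_add_compl hE hi, hEc]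
    have hsum := hasSum_integral_iUnion (fun j => measurableSet_dyadicShell c ρ j)
      (pairwise_disjoint_dyadicShell c hρ) (f := fun y => modKer χ ℓ r c ρ x y *
        (cis (-(a * y)) * h y)) (μ := volume) hi.integrableOn
    have h1 : ∫ y in {y | |y - c| < 2 * ρ}, modKer χ ℓ r c ρ x y * (cis (-(a * y)) * h y) =
        ∫ y, osKer χ ℓ 0 (x - y) *
          (cis (-(a * y)) * indicator {y | |y - c| < 2 * ρ} h y) := by
      rw [← integral_indicator hE]
      congr 1; ext y
      by_cases hy : |y - c| < 2 * ρ
      · simp [indicator, hy, modKer, not_le.2 hy]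
      · simp [indicator, hy]
    have h2 : ∀ j, ∫ y in dyadicShell c ρ j, modKer χ ℓ r c ρ x y * (cis (-(a * y)) * h y) =
        ∫ y, (osKer χ ℓ 0 (x - y) - osTaylor χ ℓ r c x y) *
        (cis (-(a * y)) * indicator (dyadicShell c ρ j) h y) := by
      intro j
      rw [← integral_indicator (measurableSet_dyadicShell c ρ j)]
      congr 1; ext y
      by_cases hy : y ∈ dyadicShell c ρ j
      · have hy' : y ∈ ⋃ j, dyadicShell c ρ j := mem_iUnion.2 ⟨j, hy⟩
        rw [iUnion_dyadicShell c hρ] at hy'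
        simp [indicator_of_mem hy, modKer, if_pos (show 2 * ρ ≤ |y - c| from hy')]
      · simp [indicator_of_notMem hy]
    refine (enorm_add_le _ _).trans ?_
    rw [h1, ← hsum.tsum_eq]
    simp_rw [h2]
    gcongr
    exact enorm_tsum_le_tsum_enorm
  · rw [modOp, integral_undef hi]; simp

/-- The main estimate: if the means of `|h|²` over the dilations of an interval grow with an
exponent less than `r`, then the square function of the modified operators has, over the interval,
the expected mean. -/
lemma IsCutoff.exists_lintegral_modOp_le {χ : ℝ → ℂ} (hχ : IsCutoff χ) (k : ℕ) {γ : ℝ}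
    (hγ : γ < k + 1) :
    ∃ C : ℝ, 0 < C ∧ ∀ {ι : Type} [Countable ι] {a ℓ : ι → ℝ}, DisjointSegments a ℓ →
      ∀ {c ρ B : ℝ} {h : ℝ → ℂ}, 0 < ρ → AEStronglyMeasurable h →
      (∀ j : ℕ, ∫⁻ y in Icc (c - 2 ^ (j + 1) * ρ) (c + 2 ^ (j + 1) * ρ), ‖h y‖ₑ ^ 2 ≤
        ENNReal.ofReal (B ^ 2 * (2 ^ j * ρ) * ((2 : ℝ) ^ γ) ^ (2 * j))) →
      ∫⁻ x in Icc (c - ρ) (c + ρ), ∑' m, ‖modOp χ (a m) (ℓ m) (k + 1) c ρ h x‖ₑ ^ 2 ≤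
        ENNReal.ofReal (C * B ^ 2 * ρ) := by
  have hχc := hχ.smooth.continuous
  obtain ⟨K, hK0, hK'⟩ := exists_norm_osc_le hχc 0
  have hK : ∀ t ∈ Icc (0 : ℝ) 1, ‖χ t‖ ≤ K := fun t ht => by simpa using hK' t ht
  obtain ⟨D, hD0, hD⟩ := hχ.exists_tsum_annulus_le (k + 1)
  set g : ℝ := 2 ^ γ with hg
  have hg0 : 0 < g := by positivity
  set q : ℝ := g / 2 ^ (k + 1) with hq
  have hq0 : 0 < q := by positivity
  -- This is where the growth exponent below `k + 1` is used: the Taylor gain `2^(-(k+1))` per shell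
  -- beats the growth `2^γ`.
  have hq1 : q < 1 := by
    rw [hq, div_lt_one (by positivity), hg, ← Real.rpow_natCast]
    exact Real.rpow_lt_rpow_of_exponent_lt (by norm_num) (by push_cast; exact hγ)
  set s : ℝ := Real.sqrt q with hs
  have hs0 : 0 < s := Real.sqrt_pos.2 hq0
  have hs2 : s ^ 2 = q := Real.sq_sqrt hq0.le
  set S : ℝ := (1 - q)⁻¹ with hS
  have hS0 : 0 < S := by rw [hS]; exact inv_pos.2 (by linarith)
  have hSsum : ∑' j : ℕ, (ENNReal.ofReal s ^ j) ^ 2 = ENNReal.ofReal S := by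
    have h1 : ∀ j : ℕ, (ENNReal.ofReal s ^ j) ^ 2 = ENNReal.ofReal q ^ j := by
      intro j
      rw [← pow_mul, mul_comm, pow_mul, ← ENNReal.ofReal_pow hs0.le, hs2]
    simp_rw [h1]
    rw [ENNReal.tsum_geometric, hS, ENNReal.ofReal_inv_of_pos (by linarith),
      ENNReal.ofReal_sub _ hq0.le, ENNReal.ofReal_one]
  refine ⟨2 * K ^ 2 + 4 * (2 * g ^ 2 * D * S ^ 2), by positivity, ?_⟩
  intro ι _ a ℓ hd c ρ B h hρ hm hB
  have hfin : ∀ j : ℕ, ∫⁻ y in Icc (c - 2 ^ (j + 1) * ρ) (c + 2 ^ (j + 1) * ρ), ‖h y‖ₑ ^ 2 ≠ ⊤ :=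
    fun j => ((hB j).trans_lt ENNReal.ofReal_lt_top).ne
  have hind : ∀ {E : Set ℝ} (j : ℕ), MeasurableSet E →
      E ⊆ Icc (c - 2 ^ (j + 1) * ρ) (c + 2 ^ (j + 1) * ρ) →
      Integrable (indicator E h) ∧ MemLp (indicator E h) 2 ∧ ∫⁻ y, ‖indicator E h y‖ₑ ^ 2 ≤
        ENNReal.ofReal (B ^ 2 * (2 ^ j * ρ) * g ^ (2 * j)) := by
    intro E j hE hsub
    obtain ⟨h1, h2⟩ := integrableOn_of_lintegral_sq hm (by simp) (hfin j)
    refine ⟨(integrable_indicator_iff hE).2 (h1.mono_set hsub),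
      (memLp_indicator_iff_restrict hE).2 (h2.mono_measure (Measure.restrict_mono hsub le_rfl)), ?_⟩
    have h3 : ∀ y, ‖indicator E h y‖ₑ ^ 2 = indicator E (fun y => ‖h y‖ₑ ^ 2) y := by
      intro y; by_cases hy : y ∈ E <;> simp [hy]
    simp_rw [h3]
    rw [lintegral_indicator hE]
    exact (lintegral_mono_set hsub).trans (hB j)
  set u : ℝ → ℂ := indicator {y | |y - c| < 2 * ρ} h with hu
  obtain ⟨hu1, hu2, hu3⟩ := hind (E := {y | |y - c| < 2 * ρ}) 0
    (measurableSet_lt (by fun_prop) measurable_const) (by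
      rw [Icc_eq_abs_sub_le]; intro y hy
      simp only [mem_ofPred_eq] at hy ⊢; rw [zero_add, pow_one]; exact hy.le)
  set v : ℕ → ℝ → ℂ := fun j => indicator (dyadicShell c ρ j) h with hv
  -- The shell with index `j` reaches up to `2^(j+2) ρ`, hence it lies in the dilation with index `j
  -- + 1`.
  have hvj := fun j => hind (E := dyadicShell c ρ j) (j + 1) (measurableSet_dyadicShell c ρ j) (by
      rw [Icc_eq_abs_sub_le]; rintro y ⟨-, hy⟩; exact hy.le)
  set N : ι → ℝ → ℂ := fun m x => ∫ y, osKer χ (ℓ m) 0 (x - y) * (cis (-(a m * y)) * u y) with hN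
  set I : ι → ℕ → ℝ → ℂ := fun m j x =>
    ∫ y, (osKer χ (ℓ m) 0 (x - y) - osTaylor χ (ℓ m) (k + 1) c x y) *
        (cis (-(a m * y)) * v j y) with hI
  have hIsum : ∀ j, ∀ x ∈ Icc (c - ρ) (c + ρ), ∑' m, ‖I m j x‖ₑ ^ 2 ≤
      ENNReal.ofReal (2 * g ^ 2 * D * B ^ 2 * q ^ (2 * j)) := by
    intro j x hx
    rw [Icc_eq_abs_sub_le] at hx
    have hR : 0 < 2 ^ (j + 2) * ρ := by positivity
    calc ∑' m, ‖I m j x‖ₑ ^ 2 ≤ ∑' m, ENNReal.ofReal (ρ ^ (2 * (k + 1))) * ∫⁻ θ in Icc (0 : ℝ) 1,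
          ‖∫ y, osKer χ (ℓ m) (k + 1) (c + θ * (x - c) - y) * (cis (-(a m * y)) * v j y)‖ₑ ^ 2 :=
          ENNReal.tsum_le_tsum fun m =>
            enorm_integral_remainder_sq_le hχc (hvj j).1 (a m) (ℓ m) c hx k
      _ = ENNReal.ofReal (ρ ^ (2 * (k + 1))) * ∫⁻ θ in Icc (0 : ℝ) 1, ∑' m,
          ‖∫ y, osKer χ (ℓ m) (k + 1) (c + θ * (x - c) - y) * (cis (-(a m * y)) * v j y)‖ₑ ^ 2 := by
          rw [ENNReal.tsum_mul_left, lintegral_tsum]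
          intro m
          have : Continuous fun θ : ℝ => ∫ y, osKer χ (ℓ m) (k + 1) (c + θ * (x - c) - y) *
              (cis (-(a m * y)) * v j y) :=
            (continuous_integral_osKer_mul hχc (hvj j).1 (a m) (ℓ m) (k + 1)).comp
              (by fun_prop : Continuous fun θ : ℝ => c + θ * (x - c))
          exact (this.enorm.measurable.pow_const 2).aemeasurable
      _ ≤ ENNReal.ofReal (ρ ^ (2 * (k + 1))) * ∫⁻ θ in Icc (0 : ℝ) 1,
          ENNReal.ofReal (D * ((2 ^ (j + 2) * ρ) ^ (2 * (k + 1) + 1))⁻¹) *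
            ENNReal.ofReal (B ^ 2 * (2 ^ (j + 1) * ρ) * g ^ (2 * (j + 1))) := by
          refine mul_le_mul_right (setLIntegral_mono measurable_const fun θ hθ => ?_) _
          refine (hD hd (hvj j).1 (hvj j).2.1 (R := 2 ^ (j + 2) * ρ) (c := c) hR ?_ ?_).trans
            (mul_le_mul_right (hvj j).2.2 _)
          · intro y hy
            refine indicator_of_notMem (fun hy' => ?_) _
            exact absurd hy'.2 (not_lt.2 hy.le)
          · intro y hy
            refine indicator_of_notMem (fun hy' => ?_) _
            -- The intermediate point is within `ρ ≤ 2^j ρ` of `c` and the shell begins at `2 · 2^j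
            -- ρ`, so their distance is at least `2^j ρ`, a quarter of the radius.
            have h1 : |θ * (x - c)| ≤ ρ := by
              rw [abs_mul, abs_of_nonneg hθ.1]
              exact (mul_le_of_le_one_left (abs_nonneg _) hθ.2).trans hx
            have h2 : |y - c| ≤ |c + θ * (x - c) - y| + |θ * (x - c)| := by
              rw [abs_sub_comm (c + θ * (x - c)) y]
              calc |y - c| = |(y - (c + θ * (x - c))) + θ * (x - c)| := by ring_nf
                _ ≤ _ := abs_add_le _ _
            have h3 := hy'.1
            have h4 : (1 : ℝ) ≤ 2 ^ j := one_le_pow₀ (by norm_num)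
            have h5 : ρ ≤ 2 ^ j * ρ := le_mul_of_one_le_left hρ.le h4
            have h6 : (2 : ℝ) ^ (j + 2) * ρ / 4 = 2 ^ j * ρ := by rw [pow_add]; ring
            have h7 : (2 : ℝ) ^ (j + 1) * ρ = 2 * (2 ^ j * ρ) := by rw [pow_succ]; ring
            linarith
      _ = ENNReal.ofReal (ρ ^ (2 * (k + 1)) * (D * ((2 ^ (j + 2) * ρ) ^ (2 * (k + 1) + 1))⁻¹ *
            (B ^ 2 * (2 ^ (j + 1) * ρ) * g ^ (2 * (j + 1))))) := by
          rw [setLIntegral_const, Real.volume_Icc, sub_zero, ENNReal.ofReal_one, mul_one,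
            ← ENNReal.ofReal_mul (by positivity), ← ENNReal.ofReal_mul (by positivity)]
      _ ≤ _ := by
          apply ENNReal.ofReal_le_ofReal
          have h1 : ρ ^ (2 * (k + 1)) * (D * ((2 ^ (j + 2) * ρ) ^ (2 * (k + 1) + 1))⁻¹ *
            (B ^ 2 * (2 ^ (j + 1) * ρ) * g ^ (2 * (j + 1)))) =
              (1 / 2 * (1 / 2 ^ (4 * (k + 1)))) * (g ^ 2 * D * B ^ 2 * q ^ (2 * j)) := by
            rw [hq, div_pow]
            have e1 : ((2 : ℝ) ^ (k + 1)) ^ (2 * j) = (2 ^ j) ^ (2 * (k + 1)) := by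
              rw [← pow_mul, ← pow_mul]; ring_nf
            have e2 : (2 : ℝ) ^ (4 * (k + 1)) = 4 ^ (2 * (k + 1)) := by
              rw [show (4 : ℝ) = 2 ^ 2 by norm_num, ← pow_mul]; ring_nf
            have e3 : (2 : ℝ) ^ (j + 2) = 2 ^ j * 4 := by rw [pow_add]; norm_num
            rw [e1, e2, e3, pow_succ (2 ^ j * 4 * ρ), pow_succ (2 : ℝ) j, mul_pow, mul_pow,
              mul_add 2 j 1, pow_add g]
            have := hρ.ne'
            generalize hX : (2 : ℝ) ^ j = X
            have hX0 : X ≠ 0 := by rw [← hX]; positivity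
            field_simp
            ring
          rw [h1, show 2 * g ^ 2 * D * B ^ 2 * q ^ (2 * j) = 2 * (g ^ 2 * D * B ^ 2 * q ^ (2 * j)) by
            ring]
          refine mul_le_mul_of_nonneg_right ?_ (by positivity)
          have : 1 / (2 : ℝ) ^ (4 * (k + 1)) ≤ 1 := by
            rw [div_le_one (by positivity)]; exact one_le_pow₀ (by norm_num)
          linarith
  have hIsum' : ∀ x ∈ Icc (c - ρ) (c + ρ), ∑' m, (∑' j, ‖I m j x‖ₑ) ^ 2 ≤
      ENNReal.ofReal (2 * g ^ 2 * D * S ^ 2 * B ^ 2) := by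
    intro x hx
    have hse : ENNReal.ofReal s ≠ 0 := by simpa using hs0
    -- Cauchy–Schwarz with weights `q^j`. The inverse weight spends half of the decay `q^(2j)` and
    -- the remaining `q^j` still sums to `S`, which gives `S²` in the end.
    have h1 : ∀ m, (∑' j, ‖I m j x‖ₑ) ^ 2 ≤ ENNReal.ofReal S *
        ∑' j : ℕ, (ENNReal.ofReal q ^ j)⁻¹ * ‖I m j x‖ₑ ^ 2 := by
      intro m
      have h2 := ENNReal.tsum_mul_sq_le (fun j => ENNReal.ofReal s ^ j)
        (fun j => (ENNReal.ofReal s ^ j)⁻¹ * ‖I m j x‖ₑ)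
      have h3 : ∀ j : ℕ, ENNReal.ofReal s ^ j * ((ENNReal.ofReal s ^ j)⁻¹ * ‖I m j x‖ₑ) =
          ‖I m j x‖ₑ := fun j => by
        rw [← mul_assoc, ENNReal.mul_inv_cancel (pow_ne_zero _ hse) (by simp), one_mul]
      simp_rw [h3] at h2
      refine h2.trans_eq ?_
      rw [← hSsum]
      congr 2; ext j
      rw [mul_pow, ← ENNReal.inv_pow, ← pow_mul, mul_comm j 2, pow_mul, ← hs2,
        ENNReal.ofReal_pow hs0.le]
    calc _ ≤ ∑' m, ENNReal.ofReal S * ∑' j : ℕ, (ENNReal.ofReal q ^ j)⁻¹ * ‖I m j x‖ₑ ^ 2 :=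
          ENNReal.tsum_le_tsum h1
      _ = ENNReal.ofReal S * ∑' j : ℕ, (ENNReal.ofReal q ^ j)⁻¹ * ∑' m, ‖I m j x‖ₑ ^ 2 := by
          rw [ENNReal.tsum_mul_left, ENNReal.tsum_comm]
          simp_rw [ENNReal.tsum_mul_left]
      _ ≤ ENNReal.ofReal S * ∑' j : ℕ, (ENNReal.ofReal q ^ j)⁻¹ *
            ENNReal.ofReal (2 * g ^ 2 * D * B ^ 2 * q ^ (2 * j)) := by
          gcongr with j
          exact hIsum j x hx
      _ = ENNReal.ofReal S * ∑' j : ℕ, ENNReal.ofReal (2 * g ^ 2 * D * B ^ 2) *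
            ENNReal.ofReal q ^ j := by
          congr 2; ext j
          rw [ENNReal.ofReal_mul (by positivity), ENNReal.ofReal_pow hq0.le, two_mul j, pow_add,
            mul_left_comm, ← mul_assoc _ (ENNReal.ofReal q ^ j),
            ENNReal.inv_mul_cancel (pow_ne_zero _ (by simpa using hq0)) (by simp), one_mul]
      _ = _ := by
          rw [ENNReal.tsum_mul_left, ENNReal.tsum_geometric, ← ENNReal.ofReal_one,
            ← ENNReal.ofReal_sub _ hq0.le, ← ENNReal.ofReal_inv_of_pos (by linarith), ← hS,
            ← ENNReal.ofReal_mul (by positivity), ← ENNReal.ofReal_mul (by positivity)]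
          congr 1; ring
  have hNc : ∀ m, Continuous (N m) := fun m => continuous_integral_osKer_mul hχc hu1 (a m) (ℓ m) 0
  calc ∫⁻ x in Icc (c - ρ) (c + ρ), ∑' m, ‖modOp χ (a m) (ℓ m) (k + 1) c ρ h x‖ₑ ^ 2
      ≤ ∫⁻ x in Icc (c - ρ) (c + ρ), (2 * (∑' m, ‖N m x‖ₑ ^ 2) +
          2 * ENNReal.ofReal (2 * g ^ 2 * D * S ^ 2 * B ^ 2)) := by
        refine lintegral_mono_ae ?_
        filter_upwards [ae_restrict_mem measurableSet_Icc] with x hx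
        rw [← mul_add]
        refine le_trans ?_ (mul_le_mul_right (add_le_add_right (hIsum' x hx) _) _)
        rw [← ENNReal.tsum_add, ← ENNReal.tsum_mul_left]
        refine ENNReal.tsum_le_tsum fun m => ?_
        exact (pow_le_pow_left' (enorm_modOp_le (a m) (ℓ m) (k + 1) c x hρ h) 2).trans
          (ENNReal.add_sq_le _ _)
    _ = 2 * (∑' m, ∫⁻ x in Icc (c - ρ) (c + ρ), ‖N m x‖ₑ ^ 2) +
          2 * ENNReal.ofReal (2 * g ^ 2 * D * S ^ 2 * B ^ 2) * ENNReal.ofReal (2 * ρ) := by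
        rw [lintegral_add_right _ measurable_const, setLIntegral_const, Real.volume_Icc,
          lintegral_const_mul' _ _ (by simp), lintegral_tsum]
        · congr 3; ring
        · exact fun m => ((hNc m).enorm.measurable.pow_const 2).aemeasurable
    _ ≤ 2 * (ENNReal.ofReal (K ^ 2) * ENNReal.ofReal (B ^ 2 * (2 ^ 0 * ρ) * g ^ (2 * 0))) +
          2 * ENNReal.ofReal (2 * g ^ 2 * D * S ^ 2 * B ^ 2) * ENNReal.ofReal (2 * ρ) := by
        gcongr
        calc _ ≤ ∑' m, ∫⁻ x, ‖N m x‖ₑ ^ 2 :=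
              ENNReal.tsum_le_tsum fun m => setLIntegral_le_lintegral _ _
          _ ≤ _ := (hd.tsum_lintegral_near_le hχc hK hu1 hu2).trans (mul_le_mul_right hu3 _)
    _ = _ := by
        rw [show (2 : ℝ≥0∞) = ENNReal.ofReal 2 by norm_num, ← ENNReal.ofReal_mul (by positivity),
          ← ENNReal.ofReal_mul (by positivity), ← ENNReal.ofReal_mul (by positivity),
          ← ENNReal.ofReal_mul (by positivity), ← ENNReal.ofReal_add (by positivity) (by positivity)]
        congr 1
        ring

end

/-! ### Functions of moderate growth, spaces of polynomials, bounds for the modified kernel -/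

noncomputable section

/-- Functions on the line integrable against the weight `(1 + |y|)^{-q}`. -/
def Tame (q : ℝ) (u : ℝ → ℂ) : Prop :=
  AEStronglyMeasurable u ∧ Integrable fun y => (1 + |y|) ^ (-q) * ‖u y‖

lemma Tame.add {q : ℝ} {u v : ℝ → ℂ} (hu : Tame q u) (hv : Tame q v) :
    Tame q fun y => u y + v y := by
  have hm : AEStronglyMeasurable fun y => u y + v y := hu.1.add hv.1
  refine ⟨hm, (hu.2.add hv.2).mono' ?_ (Eventually.of_forall fun y => ?_)⟩
  · exact ((by fun_prop : Measurable fun y : ℝ => (1 + |y|) ^ (-q)).aestronglyMeasurable).mul hm.norm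
  · have h0 : 0 ≤ (1 + |y|) ^ (-q) := by positivity
    rw [Real.norm_of_nonneg (by positivity), Pi.add_apply, ← mul_add]
    exact mul_le_mul_of_nonneg_left (norm_add_le _ _) h0

lemma Tame.integrable_mul {q : ℝ} {u : ℝ → ℂ} (hu : Tame q u) (a : ℝ) {k : ℝ → ℂ}
    (hk : AEStronglyMeasurable k) {C : ℝ} (hC : ∀ y, ‖k y‖ ≤ C * (1 + |y|) ^ (-q)) :
    (Integrable fun y => k y * (cis (-(a * y)) * u y)) ∧
      ‖∫ y, k y * (cis (-(a * y)) * u y)‖ ≤ C * ∫ y, (1 + |y|) ^ (-q) * ‖u y‖ := by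
  have hb : ∀ y, ‖k y * (cis (-(a * y)) * u y)‖ ≤ C * ((1 + |y|) ^ (-q) * ‖u y‖) := by
    intro y
    rw [norm_mul, norm_mul, norm_cis, one_mul, ← mul_assoc]
    exact mul_le_mul_of_nonneg_right (hC y) (norm_nonneg _)
  have hcis : Continuous fun y => cis (-(a * y)) := by fun_prop
  refine ⟨(hu.2.const_mul C).mono' (hk.mul (hcis.aestronglyMeasurable.mul hu.1))
    (Eventually.of_forall hb), ?_⟩
  rw [← integral_const_mul]
  exact norm_integral_le_of_norm_le (hu.2.const_mul C) (Eventually.of_forall hb)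

lemma exists_norm_eval_le (k : ℕ) {P : ℂ[X]} (hP : P ∈ Polynomial.degreeLT ℂ (k + 1)) :
    ∃ C, 0 ≤ C ∧ ∀ y : ℝ, ‖P.eval (y : ℂ)‖ ≤ C * (1 + |y|) ^ k := by
  refine ⟨∑ j ∈ Finset.range (k + 1), ‖P.coeff j‖, by positivity, fun y => ?_⟩
  have hdeg : P.natDegree < k + 1 := by
    rw [Polynomial.mem_degreeLT] at hP
    by_cases h0 : P = 0
    · simp [h0]
    · exact (Polynomial.natDegree_lt_iff_degree_lt h0).2 hP
  rw [Polynomial.eval_eq_sum_range' hdeg, Finset.sum_mul]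
  refine (norm_sum_le _ _).trans (Finset.sum_le_sum fun j hj => ?_)
  rw [norm_mul, norm_pow, Complex.norm_real, Real.norm_eq_abs]
  gcongr
  calc |y| ^ j ≤ (1 + |y|) ^ j := by gcongr; linarith
    _ ≤ (1 + |y|) ^ k := pow_le_pow_right₀ (by linarith [abs_nonneg y])
        (by have := Finset.mem_range.1 hj; omega)

lemma tame_eval {k : ℕ} {q : ℝ} (hq : k + 1 < q) {P : ℂ[X]}
    (hP : P ∈ Polynomial.degreeLT ℂ (k + 1)) : Tame q fun y => P.eval (y : ℂ) := by
  obtain ⟨C, hC0, hC⟩ := exists_norm_eval_le k hP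
  have hc : Continuous fun y : ℝ => P.eval (y : ℂ) := by fun_prop
  refine ⟨hc.aestronglyMeasurable, ?_⟩
  have hI : Integrable fun y : ℝ => (1 + ‖y‖) ^ (-(q - k)) :=
    integrable_one_add_norm (by simp; linarith)
  refine (hI.const_mul C).mono' ?_ (Eventually.of_forall fun y => ?_)
  · exact ((by fun_prop : Measurable fun y : ℝ => (1 + |y|) ^ (-q)).aestronglyMeasurable).mul
      hc.aestronglyMeasurable.norm
  · have h1 : 0 < 1 + |y| := by positivity
    rw [Real.norm_of_nonneg (by positivity), Real.norm_eq_abs,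
      show -(q - k) = -q + (k : ℕ) by ring, Real.rpow_add h1, Real.rpow_natCast, mul_left_comm]
    gcongr
    exact hC y

/-- The functions on the line given by polynomials of degree `< r`. -/
def polyFun (r : ℕ) : Submodule ℂ (ℝ → ℂ) :=
  (Polynomial.degreeLT ℂ r).map
    (LinearMap.pi fun x : ℝ => Polynomial.leval (x : ℂ) : ℂ[X] →ₗ[ℂ] ℝ → ℂ)

lemma mem_polyFun {r : ℕ} {p : ℝ → ℂ} :
    p ∈ polyFun r ↔ ∃ P ∈ Polynomial.degreeLT ℂ r, ∀ x, p x = P.eval (x : ℂ) := by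
  rw [polyFun, Submodule.mem_map]
  refine exists_congr fun P => and_congr_right fun _ => ?_
  rw [funext_iff]
  exact ⟨fun h x => (h x).symm, fun h x => (h x).symm⟩

/-- A finite-dimensional subspace is closed, here for pointwise convergence; hence pointwise limits
of polynomials of bounded degree need no further control. -/
lemma isClosed_polyFun (r : ℕ) : IsClosed (polyFun r : Set (ℝ → ℂ)) := by
  have : FiniteDimensional ℂ (Polynomial.degreeLT ℂ r) :=
    (Polynomial.degreeLTEquiv ℂ r).symm.finiteDimensional
  have : FiniteDimensional ℂ (polyFun r) := by unfold polyFun; infer_instance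
  exact Submodule.closed_of_finiteDimensional _

/-- Lagrange interpolation at the nodes `0, …, r - 1`. -/
lemma eq_sum_lagrange {r : ℕ} {p : ℝ → ℂ} (hp : p ∈ polyFun r) (x : ℝ) :
    p x = ∑ i ∈ Finset.range r, p i *
      (Lagrange.basis (Finset.range r) (fun i : ℕ => (i : ℂ)) i).eval (x : ℂ) := by
  obtain ⟨P, hP, hPp⟩ := mem_polyFun.1 hp
  have hinj : Set.InjOn (fun i : ℕ => (i : ℂ)) (Finset.range r) := fun i _ j _ h =>
    Nat.cast_injective h
  have := Lagrange.eq_interpolate (f := P) hinj (by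
    rw [Polynomial.mem_degreeLT] at hP; simpa using hP)
  nth_rw 1 [hPp, this]
  rw [Lagrange.interpolate_apply, Polynomial.eval_finsetSum]
  refine Finset.sum_congr rfl fun i _ => ?_
  rw [Polynomial.eval_mul, Polynomial.eval_C, hPp]
  simp

/-- Interpolation at fixed nodes reduces the integral to `r` numbers, so integrability at each point
is enough and no integrability of coefficients has to be known. -/
lemma integral_mem_polyFun {r : ℕ} {α : Type*} [MeasurableSpace α] {μ : Measure α}
    {p : α → ℝ → ℂ} (hp : ∀ y, p y ∈ polyFun r) (hi : ∀ x, Integrable (fun y => p y x) μ) :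
    (fun x => ∫ y, p y x ∂μ) ∈ polyFun r := by
  have h : (fun x => ∫ y, p y x ∂μ) = fun x : ℝ => ∑ i ∈ Finset.range r, (∫ y, p y i ∂μ) *
      (Lagrange.basis (Finset.range r) (fun i : ℕ => (i : ℂ)) i).eval (x : ℂ) := by
    ext x
    simp_rw [fun y => eq_sum_lagrange (hp y) x]
    rw [integral_finsetSum _ fun (i : ℕ) _ => (hi (i : ℝ)).mul_const _]
    simp_rw [integral_mul_const]
  rw [h]
  refine mem_polyFun.2 ⟨∑ i ∈ Finset.range r, Polynomial.C (∫ y, p y i ∂μ) *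
    Lagrange.basis (Finset.range r) (fun i : ℕ => (i : ℂ)) i, ?_, fun x => ?_⟩
  · refine Submodule.sum_mem _ fun i hi => ?_
    rw [← Polynomial.smul_eq_C_mul]
    refine Submodule.smul_mem _ _ ?_
    rw [Polynomial.mem_degreeLT, Lagrange.degree_basis (fun i _ j _ h => Nat.cast_injective h) hi]
    have := Finset.mem_range.1 hi
    rw [Finset.card_range]
    exact_mod_cast (by omega : r - 1 < r)
  · rw [Polynomial.eval_finsetSum]
    simp

lemma osTaylor_mem_polyFun (χ : ℝ → ℂ) (ℓ : ℝ) (r : ℕ) (c y : ℝ) :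
    (fun x => osTaylor χ ℓ r c x y) ∈ polyFun r := by
  refine mem_polyFun.2 ⟨∑ j ∈ Finset.range r, Polynomial.C (osKer χ ℓ j (c - y) / j.factorial) *
    (Polynomial.X - Polynomial.C (c : ℂ)) ^ j, ?_, fun x => ?_⟩
  · refine Submodule.sum_mem _ fun j hj => ?_
    rw [← Polynomial.smul_eq_C_mul]
    refine Submodule.smul_mem _ _ ?_
    rw [Polynomial.mem_degreeLT, Polynomial.degree_pow, Polynomial.degree_X_sub_C]
    simpa using Finset.mem_range.1 hj
  · rw [Polynomial.eval_finsetSum, osTaylor]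
    refine Finset.sum_congr rfl fun j _ => ?_
    simp only [Polynomial.eval_mul, Polynomial.eval_C, Polynomial.eval_pow, Polynomial.eval_sub,
      Polynomial.eval_X]
    push_cast; ring

lemma measurable_modKer {χ : ℝ → ℂ} (hχ : Continuous χ) (ℓ : ℝ) (r : ℕ) (c ρ x : ℝ) :
    Measurable fun y => modKer χ ℓ r c ρ x y := by
  unfold modKer
  have h0 : Continuous fun y => osKer χ ℓ 0 (x - y) := (continuous_osKer hχ ℓ 0).comp (by fun_prop)
  refine h0.measurable.sub (Measurable.ite ?_ ?_ measurable_const)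
  · exact measurableSet_le (f := fun _ => 2 * ρ) (g := fun y => |y - c|) measurable_const
      (by fun_prop)
  · unfold osTaylor
    have : ∀ j, Continuous fun y => osKer χ ℓ j (c - y) := fun j =>
      (continuous_osKer hχ ℓ j).comp (by fun_prop)
    exact Finset.measurable_fun_sum _ fun j _ =>
      ((this j).measurable.mul_const _).div_const _

/-- The dependence on `ℓ` in the bounds for the modified kernel. -/
def lenWeight (α : ℝ) (k : ℕ) (ℓ : ℝ) : ℝ := |ℓ| ^ α + |ℓ| * (1 + |ℓ|) ^ k

/-- Far away, Taylor's remainder and the interpolated bound for the derivative of order `k + 1` give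
the decay; for bounded `y` the trivial bounds by powers of `|ℓ|` suffice. Both bounds carry a factor
that tends to zero with `ℓ` if `α > 0`. -/
lemma IsCutoff.exists_norm_modKer_le {χ : ℝ → ℂ} (hχ : IsCutoff χ) (k : ℕ) {α : ℝ} (hα0 : 0 ≤ α)
    (hα1 : α ≤ 1) (c : ℝ) {ρ N : ℝ} (hρ : 0 ≤ ρ) (hN : 0 ≤ N) :
    ∃ C, 0 < C ∧ ∀ ℓ x y, ℓ ≠ 0 → |x| ≤ N →
      ‖modKer χ ℓ (k + 1) c ρ x y‖ ≤ C * lenWeight α k ℓ * (1 + |y|) ^ (-(k + 2 - α)) := by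
  have hχc := hχ.smooth.continuous
  obtain ⟨C₁, hC₁, h₁⟩ := hχ.exists_norm_osKer_le_rpow (k + 1) hα0 (by push_cast; linarith)
  choose D hD0 hD using fun n => exists_norm_osKer_le hχc n
  set M : ℝ := N + |c| with hM
  have hM0 : 0 ≤ M := by positivity
  -- For `|y| ≥ Y` the Taylor correction is active, and `y` is at distance at least `(1 + |y|)/4`
  -- from all points between `c` and `x`.
  set Y : ℝ := 2 * M + 2 * ρ + 1 with hY
  have hY0 : 0 < Y := by positivity
  set E : ℝ := D 0 + ∑ j ∈ Finset.range (k + 1), D j * M ^ j with hE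
  have hE0 : 0 < E := add_pos_of_pos_of_nonneg (hD0 0)
    (Finset.sum_nonneg fun j _ => mul_nonneg (hD0 j).le (by positivity))
  set q : ℝ := k + 2 - α with hq
  have hq0 : 0 < q := by rw [hq]; have : (0 : ℝ) ≤ k := by positivity
                         linarith
  refine ⟨M ^ (k + 1) * C₁ * 4 ^ q + E * (1 + Y) ^ q, by positivity, fun ℓ x y hℓ hx => ?_⟩
  have hxc : |x - c| ≤ M := (abs_sub _ _).trans (by rw [hM]; linarith)
  have hy1 : 0 < 1 + |y| := by positivity
  rcases le_or_gt Y |y| with hy | hy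
  · have hfar : 2 * ρ ≤ |y - c| := by
      have := abs_sub_abs_le_abs_sub y c
      have : |c| ≤ M := by rw [hM]; linarith
      linarith
    have hb : ‖modKer χ ℓ (k + 1) c ρ x y‖ ≤
        M ^ (k + 1) * (C₁ * (|ℓ| ^ α * (4 ^ q * (1 + |y|) ^ (-q)))) := by
      rw [modKer, if_pos hfar, osKer_sub_osTaylor hχc, norm_mul]
      have hint : ‖∫ θ in (0 : ℝ)..1, ((1 - θ) ^ k : ℝ) *
          osKer χ ℓ (k + 1) (c + θ * (x - c) - y)‖ ≤
          C₁ * (|ℓ| ^ α * (4 ^ q * (1 + |y|) ^ (-q))) := by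
        have := intervalIntegral.norm_integral_le_of_norm_le_const (a := (0 : ℝ)) (b := 1)
          (C := C₁ * (|ℓ| ^ α * (4 ^ q * (1 + |y|) ^ (-q))))
          (f := fun θ : ℝ => (((1 - θ) ^ k : ℝ) : ℂ) *
            osKer χ ℓ (k + 1) (c + θ * (x - c) - y)) ?_
        · simpa using this
        · intro θ hθ
          rw [uIoc_of_le zero_le_one] at hθ
          have h5 : ‖(((1 - θ) ^ k : ℝ) : ℂ)‖ ≤ 1 := by
            rw [Complex.norm_real, norm_pow, Real.norm_eq_abs, abs_of_nonneg (by linarith [hθ.2])]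
            exact pow_le_one₀ (by linarith [hθ.2]) (by linarith [hθ.1])
          have h6 : (1 + |y|) / 4 ≤ |c + θ * (x - c) - y| := by
            have e1 : |c + θ * (x - c)| ≤ M := by
              rw [show c + θ * (x - c) = (1 - θ) * c + θ * x by ring]
              refine (abs_add_le _ _).trans ?_
              rw [abs_mul, abs_mul, abs_of_nonneg (by linarith [hθ.2] : 0 ≤ 1 - θ),
                abs_of_nonneg hθ.1.le, hM]
              nlinarith [hθ.1, hθ.2, abs_nonneg c, abs_nonneg x]
            have e2 := abs_sub_abs_le_abs_sub y (c + θ * (x - c))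
            rw [abs_sub_comm] at e2
            linarith
          have h7 : 0 < |c + θ * (x - c) - y| := by linarith
          rw [norm_mul]
          refine (mul_le_mul h5 (h₁ ℓ _ hℓ (abs_pos.1 h7)) (norm_nonneg _) zero_le_one).trans ?_
          rw [one_mul]
          gcongr
          rw [show -(((k + 1 : ℕ) : ℝ) + 1 - α) = -q by rw [hq]; push_cast; ring]
          calc |c + θ * (x - c) - y| ^ (-q) ≤ ((1 + |y|) / 4) ^ (-q) :=
                Real.rpow_le_rpow_of_nonpos (by positivity) h6 (by linarith)
            _ = _ := by
                rw [Real.div_rpow hy1.le (by norm_num), Real.rpow_neg (by norm_num : (0 : ℝ) ≤ 4),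
                  div_inv_eq_mul, mul_comm]
      refine mul_le_mul ?_ hint (norm_nonneg _) (by positivity)
      rw [norm_div, norm_pow, Complex.norm_real, Real.norm_eq_abs, Complex.norm_natCast]
      calc |x - c| ^ (k + 1) / k.factorial ≤ |x - c| ^ (k + 1) :=
            div_le_self (by positivity) (by exact_mod_cast k.factorial_pos)
        _ ≤ _ := by gcongr
    refine hb.trans ?_
    calc M ^ (k + 1) * (C₁ * (|ℓ| ^ α * (4 ^ q * (1 + |y|) ^ (-q))))
        = (M ^ (k + 1) * C₁ * 4 ^ q) * |ℓ| ^ α * (1 + |y|) ^ (-q) := by ring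
      _ ≤ _ := by
        gcongr
        · exact le_add_of_nonneg_right (by positivity)
        · exact le_add_of_nonneg_right (by positivity)
  · set w : ℝ := |ℓ| * (1 + |ℓ|) ^ k with hw
    have hp : ∀ j ≤ k, |ℓ| ^ (j + 1) ≤ w := by
      intro j hj
      rw [pow_succ', hw]
      gcongr
      calc |ℓ| ^ j ≤ (1 + |ℓ|) ^ j := by gcongr; linarith
        _ ≤ _ := pow_le_pow_right₀ (by linarith [abs_nonneg ℓ]) hj
    have h0 : ‖osKer χ ℓ 0 (x - y)‖ ≤ D 0 * w :=
      (hD 0 ℓ _).trans (mul_le_mul_of_nonneg_left (hp 0 (by omega)) (hD0 0).le)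
    have ht : ‖osTaylor χ ℓ (k + 1) c x y‖ ≤ (∑ j ∈ Finset.range (k + 1), D j * M ^ j) * w := by
      rw [osTaylor, Finset.sum_mul]
      refine (norm_sum_le _ _).trans (Finset.sum_le_sum fun j hj => ?_)
      rw [norm_div, norm_mul, norm_pow, Complex.norm_real, Real.norm_eq_abs, Complex.norm_natCast]
      refine (div_le_self (by positivity) (by exact_mod_cast j.factorial_pos)).trans ?_
      rw [mul_right_comm]
      have := hD0 j
      have := Finset.mem_range.1 hj
      refine mul_le_mul ((hD j ℓ _).trans (mul_le_mul_of_nonneg_left (hp j (by omega)) (hD0 j).le))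
        (by gcongr) (by positivity) (by positivity)
    have hm : ‖modKer χ ℓ (k + 1) c ρ x y‖ ≤ E * w := by
      rw [modKer, hE, add_mul]
      refine (norm_sub_le _ _).trans (add_le_add h0 ?_)
      split_ifs
      · exact ht
      · rw [norm_zero]
        exact mul_nonneg (Finset.sum_nonneg fun j _ => mul_nonneg (hD0 j).le (by positivity))
          (by positivity)
    have h1 : 1 ≤ (1 + Y) ^ q * (1 + |y|) ^ (-q) := by
      rw [Real.rpow_neg hy1.le, ← div_eq_mul_inv, one_le_div (by positivity)]
      exact Real.rpow_le_rpow hy1.le (by linarith) hq0.le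
    refine hm.trans ?_
    calc E * w = E * w * 1 := (mul_one _).symm
      _ ≤ E * w * ((1 + Y) ^ q * (1 + |y|) ^ (-q)) := by gcongr
      _ = (E * (1 + Y) ^ q) * w * (1 + |y|) ^ (-q) := by ring
      _ ≤ _ := by
        gcongr
        · exact le_add_of_nonneg_left (by positivity)
        · exact le_add_of_nonneg_left (by positivity)

end

/-! ### Polynomials on dilated intervals and the growth of `f - P` -/

noncomputable section

lemma mem_degreeLT_succ_iff {k : ℕ} {P : ℂ[X]} :
    P ∈ Polynomial.degreeLT ℂ (k + 1) ↔ P.natDegree ≤ k := by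
  rw [Polynomial.mem_degreeLT, ← Nat.lt_succ_iff]
  by_cases h0 : P = 0
  · simp [h0]
  · exact (Polynomial.natDegree_lt_iff_degree_lt h0).symm

/-- A polynomial of degree `≤ k` on a dilation of an interval is controlled by its mean over the
interval. -/
lemma exists_enorm_eval_sq_le (k : ℕ) :
    ∃ C : ℝ, 0 < C ∧ ∀ P ∈ Polynomial.degreeLT ℂ (k + 1), ∀ {c ρ t : ℝ}, 0 < ρ → 1 ≤ t →
      ∀ y, |y - c| ≤ t * ρ → ‖P.eval (y : ℂ)‖ₑ ^ 2 ≤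
        ENNReal.ofReal (C * t ^ (2 * k) / ρ) *
          ∫⁻ x in Icc (c - ρ) (c + ρ), ‖P.eval (x : ℂ)‖ₑ ^ 2 := by
  set L : ℕ → ℂ[X] := Lagrange.basis (Finset.range (k + 1)) (fun i : ℕ => (i : ℂ)) with hL
  have hLmem : ∀ i ∈ Finset.range (k + 1), L i ∈ Polynomial.degreeLT ℂ (k + 1) := by
    intro i hi
    rw [Polynomial.mem_degreeLT, hL, Lagrange.degree_basis (fun i _ j _ h => Nat.cast_injective h) hi,
      Finset.card_range]
    exact_mod_cast (by omega : k + 1 - 1 < k + 1)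
  have hLb : ∃ D : ℝ, 0 < D ∧ ∀ i ∈ Finset.range (k + 1), ∀ y : ℝ,
      ‖(L i).eval (y : ℂ)‖ ≤ D * (1 + |y|) ^ k := by
    choose! D hD0 hD using fun i hi => exists_norm_eval_le k (hLmem i hi)
    refine ⟨1 + ∑ i ∈ Finset.range (k + 1), D i,
      add_pos_of_pos_of_nonneg one_pos (Finset.sum_nonneg hD0), fun i hi y => ?_⟩
    refine (hD i hi y).trans ?_
    gcongr
    have := Finset.single_le_sum (f := D) hD0 hi
    linarith
  obtain ⟨D, hD0, hD⟩ := hLb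
  set n : ℝ := k + 1 with hn
  have hn0 : 0 < n := by positivity
  refine ⟨2 * (D * (2 * n + 1) ^ k * (n * (n / 2))) ^ 2, by positivity, ?_⟩
  intro P hP c ρ t hρ ht y hy
  -- The interval is cut into `k + 1` pieces of length `w`. For each `θ` one interpolates at the
  -- points at proportion `θ` of the pieces; averaging over `θ` turns the values at the nodes into
  -- integrals over the pieces.
  set w : ℝ := 2 * ρ / n with hw
  have hw0 : 0 < w := by positivity
  set J := ∫⁻ x in Icc (c - ρ) (c + ρ), ‖P.eval (x : ℂ)‖ₑ with hJ
  have hpt : ∀ θ ∈ Icc (0 : ℝ) 1, ‖P.eval (y : ℂ)‖ₑ ≤ ENNReal.ofReal (D * (2 * n + 1) ^ k * t ^ k) *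
      ∑ i ∈ Finset.range (k + 1), ‖P.eval ((c - ρ + w * i + θ * w : ℝ) : ℂ)‖ₑ := by
    intro θ hθ
    have hp : (fun z : ℝ => P.eval ((c - ρ + w * z + θ * w : ℝ) : ℂ)) ∈ polyFun (k + 1) := by
      refine mem_polyFun.2 ⟨P.comp (Polynomial.C (w : ℂ) * Polynomial.X +
        Polynomial.C ((c - ρ + θ * w : ℝ) : ℂ)), ?_, fun z => ?_⟩
      · rw [mem_degreeLT_succ_iff] at hP ⊢
        refine Polynomial.natDegree_comp_le.trans ?_
        calc _ ≤ P.natDegree * 1 := Nat.mul_le_mul_left _ Polynomial.natDegree_linear_le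
          _ ≤ k := by omega
      · rw [Polynomial.eval_comp]
        congr 1
        simp only [Polynomial.eval_add, Polynomial.eval_mul, Polynomial.eval_C, Polynomial.eval_X]
        push_cast; ring
    set z : ℝ := (y - (c - ρ + θ * w)) / w with hz
    have hyz : c - ρ + w * z + θ * w = y := by rw [hz]; field_simp; ring
    have h1 := eq_sum_lagrange hp z
    simp only [hyz] at h1
    have hzb : 1 + |z| ≤ (2 * n + 1) * t := by
      have h2 : |z| ≤ n * t + n := by
        rw [hz, abs_div, abs_of_pos hw0, div_le_iff₀ hw0]
        have h3 : w * n = 2 * ρ := by rw [hw]; field_simp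
        have h4 : |y - (c - ρ + θ * w)| ≤ t * ρ + 2 * ρ := by
          have h5 : θ * w ≤ 2 * ρ := by
            have : w ≤ 2 * ρ := by
              rw [hw, div_le_iff₀ hn0]
              have : (1 : ℝ) ≤ n := by rw [hn]; have : (0 : ℝ) ≤ k := by positivity
                                       linarith
              nlinarith
            nlinarith [hθ.1, hθ.2]
          have h6 : 0 ≤ θ * w := mul_nonneg hθ.1 hw0.le
          rw [abs_le] at hy ⊢
          constructor <;> linarith [hy.1, hy.2]
        have : (n * t + n) * w = 2 * ρ * t + 2 * ρ := by rw [add_mul, mul_right_comm, mul_comm n w, h3]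
        rw [this]
        nlinarith
      nlinarith
    rw [h1]
    refine (enorm_sum_le _ _).trans ?_
    rw [Finset.mul_sum]
    refine Finset.sum_le_sum fun i hi => ?_
    rw [enorm_mul, mul_comm]
    gcongr
    rw [← ofReal_norm]
    apply ENNReal.ofReal_le_ofReal
    refine (hD i hi z).trans ?_
    rw [mul_assoc, ← mul_pow]
    gcongr
  have hcP : Continuous fun x : ℝ => P.eval (x : ℂ) := by fun_prop
  have hmP : ∀ i : ℕ, Measurable fun θ : ℝ => ‖P.eval ((c - ρ + w * i + θ * w : ℝ) : ℂ)‖ₑ :=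
    fun i => (hcP.comp (by fun_prop : Continuous fun θ : ℝ => c - ρ + w * i + θ * w)).enorm.measurable
  have hseg : ∀ i ∈ Finset.range (k + 1),
      ∫⁻ θ in Icc (0 : ℝ) 1, ‖P.eval ((c - ρ + w * i + θ * w : ℝ) : ℂ)‖ₑ ≤
        ENNReal.ofReal (n / 2 / ρ) * J := by
    intro i hi
    have h1 := lintegral_segment (c - ρ + w * i) w hw0.ne' fun x => ‖P.eval (x : ℂ)‖ₑ
    have h2 : ∫⁻ x in uIcc (c - ρ + w * i) (c - ρ + w * i + w), ‖P.eval (x : ℂ)‖ₑ ≤ J := by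
      refine lintegral_mono_set ?_
      rw [uIcc_of_le (by linarith)]
      have hi' : (i : ℝ) + 1 ≤ n := by
        rw [hn]; exact_mod_cast Finset.mem_range.1 hi
      refine Icc_subset_Icc (by have : 0 ≤ w * i := by positivity
                                linarith) ?_
      have h3 : w * n = 2 * ρ := by rw [hw]; field_simp
      nlinarith
    rw [← h1, abs_of_pos hw0] at h2
    have h4 : ENNReal.ofReal (n / 2 / ρ) * ENNReal.ofReal w = 1 := by
      rw [← ENNReal.ofReal_mul (by positivity), hw,
        show n / 2 / ρ * (2 * ρ / n) = 1 by field_simp, ENNReal.ofReal_one]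
    calc _ = ENNReal.ofReal (n / 2 / ρ) * (ENNReal.ofReal w *
          ∫⁻ θ in Icc (0 : ℝ) 1, ‖P.eval ((c - ρ + w * i + θ * w : ℝ) : ℂ)‖ₑ) := by
          rw [← mul_assoc, h4, one_mul]
      _ ≤ _ := by gcongr
  have hmain : ‖P.eval (y : ℂ)‖ₑ ≤
      ENNReal.ofReal (D * (2 * n + 1) ^ k * t ^ k * (n * (n / 2 / ρ))) * J := by
    calc ‖P.eval (y : ℂ)‖ₑ = ∫⁻ θ in Icc (0 : ℝ) 1, ‖P.eval (y : ℂ)‖ₑ := by simp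
      _ ≤ ∫⁻ θ in Icc (0 : ℝ) 1, ENNReal.ofReal (D * (2 * n + 1) ^ k * t ^ k) *
          ∑ i ∈ Finset.range (k + 1), ‖P.eval ((c - ρ + w * i + θ * w : ℝ) : ℂ)‖ₑ :=
          setLIntegral_mono ((Finset.measurable_fun_sum _ fun i _ => hmP i).const_mul _) hpt
      _ = ENNReal.ofReal (D * (2 * n + 1) ^ k * t ^ k) * ∑ i ∈ Finset.range (k + 1),
          ∫⁻ θ in Icc (0 : ℝ) 1, ‖P.eval ((c - ρ + w * i + θ * w : ℝ) : ℂ)‖ₑ := by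
          rw [lintegral_const_mul' _ _ ENNReal.ofReal_ne_top, lintegral_finsetSum _ fun i _ => hmP i]
      _ ≤ ENNReal.ofReal (D * (2 * n + 1) ^ k * t ^ k) * ∑ i ∈ Finset.range (k + 1),
          ENNReal.ofReal (n / 2 / ρ) * J := by
          gcongr with i hi
          exact hseg i hi
      _ = _ := by
          rw [Finset.sum_const, Finset.card_range, nsmul_eq_mul,
            ENNReal.ofReal_mul (p := D * (2 * n + 1) ^ k * t ^ k) (by positivity),
            ENNReal.ofReal_mul hn0.le, hn,
            show ENNReal.ofReal ((k : ℝ) + 1) = ((k + 1 : ℕ) : ℝ≥0∞) by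
              rw [← ENNReal.ofReal_natCast]; push_cast; rfl]
          ring
  have hJ2 : J ^ 2 ≤ ENNReal.ofReal (2 * ρ) * ∫⁻ x in Icc (c - ρ) (c + ρ), ‖P.eval (x : ℂ)‖ₑ ^ 2 := by
    refine (sq_lintegral_le hcP.enorm.aemeasurable).trans_eq ?_
    rw [Measure.restrict_apply_univ, Real.volume_Icc]
    congr 2; ring
  refine (pow_le_pow_left' hmain 2).trans ?_
  rw [mul_pow, ← ENNReal.ofReal_pow (by positivity)]
  refine (mul_le_mul_right hJ2 _).trans_eq ?_
  rw [← mul_assoc, ← ENNReal.ofReal_mul (by positivity)]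
  congr 2
  field_simp
  ring

lemma enorm_sub_sq_le (a b : ℂ) : ‖a - b‖ₑ ^ 2 ≤ 2 * (‖a‖ₑ ^ 2 + ‖b‖ₑ ^ 2) :=
  (pow_le_pow_left' enorm_sub_le 2).trans (ENNReal.add_sq_le _ _)

/-- Absorbs the factor `j`, which comes from adding `j` comparable increments, into a slightly
larger exponential rate. -/
lemma exists_sq_mul_pow_le {μ g : ℝ} (hμ : 0 < μ) (hg : μ < g) :
    ∃ C : ℝ, 0 < C ∧ ∀ j : ℕ, (1 + (j : ℝ) ^ 2) * μ ^ (2 * j) ≤ C * g ^ (2 * j) := by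
  have hg0 : 0 < g := hμ.trans hg
  have hq : |(μ / g) ^ 2| < 1 := by
    rw [abs_of_nonneg (by positivity)]
    exact pow_lt_one₀ (by positivity) ((div_lt_one hg0).2 hg) (by norm_num)
  have ht := (tendsto_pow_const_mul_const_pow_of_abs_lt_one 0 hq).add
    (tendsto_pow_const_mul_const_pow_of_abs_lt_one 2 hq)
  obtain ⟨C, hC⟩ := ht.bddAbove_range
  refine ⟨max C 1, by positivity, fun j => ?_⟩
  have h1 := hC (mem_range_self j)
  simp only [pow_zero, one_mul] at h1
  rw [← pow_mul, div_pow] at h1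
  have h2 : μ ^ (2 * j) / g ^ (2 * j) + (j : ℝ) ^ 2 * (μ ^ (2 * j) / g ^ (2 * j)) =
    (1 + (j : ℝ) ^ 2) * μ ^ (2 * j) / g ^ (2 * j) := by ring
  rw [h2, div_le_iff₀ (by positivity)] at h1
  exact h1.trans (by gcongr; exact le_max_left _ _)

/-- The growth of `f - P₀` over the dilations of an interval, if `f` is on each of them close to a
polynomial of degree `< i`. -/
lemma exists_growth_bound (i : ℕ) (s : ℝ) {γ : ℝ} (hγ : max s ((i : ℝ) - 1) < γ) :
    ∃ C : ℝ, 0 < C ∧ ∀ {f : ℝ → ℂ} {c ρ A : ℝ} {P : ℕ → ℂ[X]}, AEStronglyMeasurable f → 0 < ρ →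
      0 ≤ A → (∀ j, P j ∈ Polynomial.degreeLT ℂ i) →
      (∀ j : ℕ, ∫⁻ y in Icc (c - 2 ^ (j + 1) * ρ) (c + 2 ^ (j + 1) * ρ), ‖f y - (P j).eval (y : ℂ)‖ₑ ^ 2
        ≤ ENNReal.ofReal (A ^ 2 * (2 ^ (j + 2) * ρ) ^ (1 + 2 * s))) →
      ∀ j : ℕ, ∫⁻ y in Icc (c - 2 ^ (j + 1) * ρ) (c + 2 ^ (j + 1) * ρ),
        ‖f y - (P 0).eval (y : ℂ)‖ₑ ^ 2 ≤
        ENNReal.ofReal ((C * A * ρ ^ s) ^ 2 * (2 ^ j * ρ) * ((2 : ℝ) ^ γ) ^ (2 * j)) := by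
  set μ : ℝ := 2 ^ max s ((i : ℝ) - 1) with hμ
  have hμ0 : 0 < μ := by positivity
  have hμg : μ < 2 ^ γ := Real.rpow_lt_rpow_of_exponent_lt (by norm_num) hγ
  obtain ⟨C₁, hC₁, h₁⟩ := exists_sq_mul_pow_le hμ0 hμg
  obtain ⟨C₂, hC₂, h₂⟩ := exists_enorm_eval_sq_le (i - 1)
  set σ : ℝ := 2 ^ s with hσ
  set S : ℝ := 4 ^ (1 + 2 * s) with hS
  have hσ0 : 0 < σ := by positivity
  have hS0 : 0 < S := by positivity
  have hσμ : σ ≤ μ := Real.rpow_le_rpow_of_exponent_le (by norm_num) (le_max_left _ _)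
  have hscale : ∀ {ρ : ℝ}, 0 < ρ → ∀ j : ℕ, ((2 : ℝ) ^ (j + 2) * ρ) ^ (1 + 2 * s) =
      S * (ρ ^ s) ^ 2 * (2 ^ j * ρ) * σ ^ (2 * j) := by
    intro ρ hρ j
    rw [show (2 : ℝ) ^ (j + 2) * ρ = 4 * (2 ^ j * ρ) by rw [pow_add]; ring,
      Real.mul_rpow (by norm_num) (by positivity), ← hS,
      Real.rpow_add (x := 2 ^ j * ρ) (by positivity), Real.rpow_one, mul_comm 2 s,
      Real.rpow_mul (by positivity), Real.mul_rpow (by positivity) hρ.le,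
      ← Real.rpow_natCast 2 j, ← Real.rpow_mul (by norm_num), mul_comm (j : ℝ) s,
      Real.rpow_mul (by norm_num), ← hσ, Real.rpow_natCast, Real.rpow_natCast, Real.rpow_two,
      mul_pow, ← pow_mul, mul_comm j 2]
    ring
  set F : ℝ := Real.sqrt (C₂ * S * (1 + 2 * σ ^ 2)) with hF
  have hF0 : 0 ≤ F := Real.sqrt_nonneg _
  have hF2 : F ^ 2 = C₂ * S * (1 + 2 * σ ^ 2) := Real.sq_sqrt (by positivity)
  refine ⟨Real.sqrt (C₁ * (2 * S + 8 * F ^ 2)), Real.sqrt_pos.2 (by positivity), ?_⟩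
  intro f c ρ A P hf hρ hA hP hJ j
  have heval : ∀ Q : ℂ[X], Continuous fun y : ℝ => Q.eval (y : ℂ) := fun Q => by fun_prop
  have hem : ∀ l, AEMeasurable (fun y => ‖f y - (P l).eval (y : ℂ)‖ₑ ^ 2) volume := fun l =>
    (hf.sub (heval (P l)).aestronglyMeasurable).enorm.pow_const 2
  simp_rw [hscale hρ] at hJ
  -- Both polynomials are close to `f` at scale `2^l`, so their difference has size about `σ^l`
  -- there. Extrapolation to scale `2^j` costs `2^((j-l)(i-1))`. Each of the `j` steps between the
  -- two rates is at most `μ`, whence `μ^j`.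
  have hsup : ∀ l < j, ∀ y ∈ Icc (c - 2 ^ (j + 1) * ρ) (c + 2 ^ (j + 1) * ρ),
      ‖(P (l + 1) - P l).eval (y : ℂ)‖ ≤ F * A * ρ ^ s * μ ^ j := by
    intro l hl y hy
    -- For `i = 0` all the polynomials are zero; the truncated `i - 1` is a true degree bound only
    -- for `i > 0`.
    rcases Nat.eq_zero_or_pos i with hi | hi
    · have : P (l + 1) - P l = 0 := by
        have := Submodule.sub_mem _ (hP (l + 1)) (hP l)
        rw [hi, Polynomial.mem_degreeLT] at this
        simpa [Polynomial.degree_eq_bot] using this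
      rw [this, Polynomial.eval_zero, norm_zero]; positivity
    have hD : P (l + 1) - P l ∈ Polynomial.degreeLT ℂ (i - 1 + 1) := by
      rw [Nat.sub_add_cancel hi]; exact Submodule.sub_mem _ (hP (l + 1)) (hP l)
    rw [Icc_eq_abs_sub_le, mem_ofPred_eq] at hy
    have ht : (1 : ℝ) ≤ 2 ^ (j - l) := one_le_pow₀ (by norm_num)
    have h3 := h₂ _ hD (c := c) (ρ := 2 ^ (l + 1) * ρ) (by positivity) ht y (by
      rw [← mul_assoc, ← pow_add, show j - l + (l + 1) = j + 1 by omega]; exact hy)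
    have h4 : ∫⁻ x in Icc (c - 2 ^ (l + 1) * ρ) (c + 2 ^ (l + 1) * ρ),
        ‖(P (l + 1) - P l).eval (x : ℂ)‖ₑ ^ 2 ≤ ENNReal.ofReal
          (2 * (A ^ 2 * (S * (ρ ^ s) ^ 2 * (2 ^ l * ρ) * σ ^ (2 * l)) * (1 + 2 * σ ^ 2))) := by
      have hsub : Icc (c - 2 ^ (l + 1) * ρ) (c + 2 ^ (l + 1) * ρ) ⊆
          Icc (c - 2 ^ (l + 1 + 1) * ρ) (c + 2 ^ (l + 1 + 1) * ρ) := by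
        have : (2 : ℝ) ^ (l + 1) * ρ ≤ 2 ^ (l + 1 + 1) * ρ := by
          gcongr <;> norm_num
        exact Icc_subset_Icc (by linarith) (by linarith)
      calc _ ≤ ∫⁻ x in Icc (c - 2 ^ (l + 1) * ρ) (c + 2 ^ (l + 1) * ρ),
            2 * (‖f x - (P l).eval (x : ℂ)‖ₑ ^ 2 + ‖f x - (P (l + 1)).eval (x : ℂ)‖ₑ ^ 2) := by
            refine lintegral_mono fun x => ?_
            rw [Polynomial.eval_sub, show (P (l + 1)).eval (x : ℂ) - (P l).eval (x : ℂ) =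
              (f x - (P l).eval (x : ℂ)) - (f x - (P (l + 1)).eval (x : ℂ)) by ring]
            exact enorm_sub_sq_le _ _
        _ = 2 * ((∫⁻ x in Icc (c - 2 ^ (l + 1) * ρ) (c + 2 ^ (l + 1) * ρ),
            ‖f x - (P l).eval (x : ℂ)‖ₑ ^ 2) + ∫⁻ x in Icc (c - 2 ^ (l + 1) * ρ) (c + 2 ^ (l + 1) * ρ),
            ‖f x - (P (l + 1)).eval (x : ℂ)‖ₑ ^ 2) := by
            rw [lintegral_const_mul' _ _ (by simp), lintegral_add_left' (hem l).restrict]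
        _ ≤ 2 * (ENNReal.ofReal (A ^ 2 * (S * (ρ ^ s) ^ 2 * (2 ^ l * ρ) * σ ^ (2 * l))) +
            ENNReal.ofReal (A ^ 2 * (S * (ρ ^ s) ^ 2 * (2 ^ (l + 1) * ρ) * σ ^ (2 * (l + 1))))) := by
            gcongr
            · exact hJ l
            · exact (lintegral_mono_set hsub).trans (hJ (l + 1))
        _ = _ := by
            rw [← ENNReal.ofReal_add (by positivity) (by positivity),
              show (2 : ℝ≥0∞) = ENNReal.ofReal 2 by norm_num, ← ENNReal.ofReal_mul (by norm_num)]
            congr 1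
            rw [pow_succ 2 l, mul_add 2 l 1, pow_add σ]; ring
    have h5 : ‖(P (l + 1) - P l).eval (y : ℂ)‖ ^ 2 ≤ (F * A * ρ ^ s * μ ^ j) ^ 2 := by
      have h6 := h3.trans (mul_le_mul_right h4 _)
      rw [← ENNReal.ofReal_mul (by positivity), ← ofReal_norm,
        ← ENNReal.ofReal_pow (norm_nonneg _), ENNReal.ofReal_le_ofReal_iff (by positivity)] at h6
      refine h6.trans ?_
      have h7 : ((2 : ℝ) ^ (i - 1)) ≤ μ := by
        rw [← Real.rpow_natCast, hμ]
        refine Real.rpow_le_rpow_of_exponent_le (by norm_num) ?_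
        rw [Nat.cast_sub hi, Nat.cast_one]; exact le_max_right _ _
      have h8 : ((2 : ℝ) ^ (j - l)) ^ (2 * (i - 1)) * σ ^ (2 * l) ≤ μ ^ (2 * j) := by
        calc ((2 : ℝ) ^ (j - l)) ^ (2 * (i - 1)) * σ ^ (2 * l)
            = ((2 : ℝ) ^ (i - 1)) ^ (2 * (j - l)) * σ ^ (2 * l) := by
              rw [← pow_mul, ← pow_mul]; congr 2; ring
          _ ≤ μ ^ (2 * (j - l)) * μ ^ (2 * l) := by gcongr
          _ = _ := by rw [← pow_add]; congr 1; omega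
      calc _ = (C₂ * S * (1 + 2 * σ ^ 2)) * (A * ρ ^ s) ^ 2 *
            (((2 : ℝ) ^ (j - l)) ^ (2 * (i - 1)) * σ ^ (2 * l)) := by
            rw [pow_succ 2 l]
            have := hρ.ne'
            field_simp
        _ ≤ (C₂ * S * (1 + 2 * σ ^ 2)) * (A * ρ ^ s) ^ 2 * μ ^ (2 * j) := by gcongr
        _ = _ := by rw [← hF2]; ring
    exact le_of_sq_le_sq h5 (by positivity)
  have hpt : ∀ y ∈ Icc (c - 2 ^ (j + 1) * ρ) (c + 2 ^ (j + 1) * ρ),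
      ‖f y - (P 0).eval (y : ℂ)‖ₑ ^ 2 ≤ 2 * (‖f y - (P j).eval (y : ℂ)‖ₑ ^ 2 +
        ENNReal.ofReal ((j * (F * A * ρ ^ s * μ ^ j)) ^ 2)) := by
    intro y hy
    have h3 : f y - (P 0).eval (y : ℂ) = (f y - (P j).eval (y : ℂ)) +
        ∑ l ∈ Finset.range j, (P (l + 1) - P l).eval (y : ℂ) := by
      simp_rw [Polynomial.eval_sub]
      rw [Finset.sum_range_sub (fun l => (P l).eval (y : ℂ))]; ring
    have h4 : ‖∑ l ∈ Finset.range j, (P (l + 1) - P l).eval (y : ℂ)‖ ≤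
        j * (F * A * ρ ^ s * μ ^ j) := by
      refine (norm_sum_le _ _).trans ((Finset.sum_le_sum fun l hl =>
        hsup l (Finset.mem_range.1 hl) y hy).trans_eq ?_)
      simp
    rw [h3]
    refine (pow_le_pow_left' (enorm_add_le _ _) 2).trans ((ENNReal.add_sq_le _ _).trans ?_)
    gcongr
    rw [← ofReal_norm, ← ENNReal.ofReal_pow (norm_nonneg _)]
    gcongr
  calc _ ≤ ∫⁻ y in Icc (c - 2 ^ (j + 1) * ρ) (c + 2 ^ (j + 1) * ρ),
        2 * (‖f y - (P j).eval (y : ℂ)‖ₑ ^ 2 +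
        ENNReal.ofReal ((j * (F * A * ρ ^ s * μ ^ j)) ^ 2)) := by
        refine lintegral_mono_ae ?_
        filter_upwards [ae_restrict_mem measurableSet_Icc] with y hy using hpt y hy
    _ = 2 * ((∫⁻ y in Icc (c - 2 ^ (j + 1) * ρ) (c + 2 ^ (j + 1) * ρ),
        ‖f y - (P j).eval (y : ℂ)‖ₑ ^ 2) +
        ENNReal.ofReal ((j * (F * A * ρ ^ s * μ ^ j)) ^ 2) * ENNReal.ofReal (2 ^ (j + 2) * ρ)) := by
        rw [lintegral_const_mul' _ _ (by simp), lintegral_add_right _ measurable_const,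
          setLIntegral_const, Real.volume_Icc]
        congr 4; ring
    _ ≤ 2 * (ENNReal.ofReal (A ^ 2 * (S * (ρ ^ s) ^ 2 * (2 ^ j * ρ) * σ ^ (2 * j))) +
        ENNReal.ofReal ((j * (F * A * ρ ^ s * μ ^ j)) ^ 2) * ENNReal.ofReal (2 ^ (j + 2) * ρ)) := by
        gcongr
        exact hJ j
    _ = ENNReal.ofReal (2 * (A ^ 2 * (S * (ρ ^ s) ^ 2 * (2 ^ j * ρ) * σ ^ (2 * j)) +
        (j * (F * A * ρ ^ s * μ ^ j)) ^ 2 * (2 ^ (j + 2) * ρ))) := by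
        rw [← ENNReal.ofReal_mul (by positivity), ← ENNReal.ofReal_add (by positivity) (by positivity),
          show (2 : ℝ≥0∞) = ENNReal.ofReal 2 by norm_num, ← ENNReal.ofReal_mul (by norm_num)]
    _ ≤ _ := by
        apply ENNReal.ofReal_le_ofReal
        have h3 : σ ^ (2 * j) ≤ μ ^ (2 * j) := by gcongr
        have h4 := h₁ j
        have h5 : 0 ≤ (A * ρ ^ s) ^ 2 * (2 ^ j * ρ) := by positivity
        rw [show (Real.sqrt (C₁ * (2 * S + 8 * F ^ 2)) * A * ρ ^ s) ^ 2 * (2 ^ j * ρ) *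
          ((2 : ℝ) ^ γ) ^ (2 * j) = Real.sqrt (C₁ * (2 * S + 8 * F ^ 2)) ^ 2 *
          ((A * ρ ^ s) ^ 2 * (2 ^ j * ρ)) * ((2 : ℝ) ^ γ) ^ (2 * j) by ring,
          Real.sq_sqrt (by positivity)]
        calc _ = ((A * ρ ^ s) ^ 2 * (2 ^ j * ρ)) *
              (2 * S * σ ^ (2 * j) + 8 * F ^ 2 * ((j : ℝ) ^ 2 * μ ^ (2 * j))) := by
              rw [pow_add 2 j, show μ ^ (2 * j) = (μ ^ j) ^ 2 by rw [← pow_mul, mul_comm]]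
              ring
          _ ≤ ((A * ρ ^ s) ^ 2 * (2 ^ j * ρ)) * ((2 * S + 8 * F ^ 2) *
              (C₁ * ((2 : ℝ) ^ γ) ^ (2 * j))) := by
              refine mul_le_mul_of_nonneg_left ?_ h5
              have h6 : 0 ≤ (j : ℝ) ^ 2 * μ ^ (2 * j) := by positivity
              have h7 : 0 ≤ μ ^ (2 * j) := by positivity
              calc _ ≤ (2 * S + 8 * F ^ 2) * ((1 + (j : ℝ) ^ 2) * μ ^ (2 * j)) := by
                    have e1 : 2 * S * σ ^ (2 * j) ≤ 2 * S * μ ^ (2 * j) := by gcongr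
                    have e2 : 0 ≤ 2 * S * ((j : ℝ) ^ 2 * μ ^ (2 * j)) := by positivity
                    have e3 : 0 ≤ 8 * F ^ 2 * μ ^ (2 * j) := by positivity
                    nlinarith
                _ ≤ _ := by gcongr
          _ = _ := by ring

/-- A function with controlled growth is integrable against a negative power. -/
lemma tame_of_growth {h : ℝ → ℂ} (hm : AEStronglyMeasurable h) {c ρ B γ q : ℝ} (hρ : 0 < ρ)
    (hq : 1 + γ < q) (hq0 : 0 ≤ q)
    (hB : ∀ j : ℕ, ∫⁻ y in Icc (c - 2 ^ (j + 1) * ρ) (c + 2 ^ (j + 1) * ρ), ‖h y‖ₑ ^ 2 ≤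
        ENNReal.ofReal (B ^ 2 * (2 ^ j * ρ) * ((2 : ℝ) ^ γ) ^ (2 * j))) : Tame q h := by
  have hwm : Measurable fun y : ℝ => (1 + |y|) ^ (-q) := by fun_prop
  refine ⟨hm, hwm.aestronglyMeasurable.mul hm.norm, ?_⟩
  rw [hasFiniteIntegral_iff_enorm]
  set g : ℝ := 2 ^ γ with hg
  have hg0 : 0 < g := by positivity
  set w : ℝ → ℝ≥0∞ := fun y => ‖(1 + |y|) ^ (-q) * ‖h y‖‖ₑ with hw
  have hwle : ∀ {y X : ℝ}, (1 + |y|) ^ (-q) ≤ X → w y ≤ ENNReal.ofReal X * ‖h y‖ₑ := by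
    intro y X hX
    rw [hw]; simp only [enorm_mul, enorm_norm]
    gcongr
    rw [Real.enorm_eq_ofReal (by positivity)]
    exact ENNReal.ofReal_le_ofReal hX
  have hone : ∀ y : ℝ, (1 + |y|) ^ (-q) ≤ 1 := fun y =>
    Real.rpow_le_one_of_one_le_of_nonpos (by linarith [abs_nonneg y]) (by linarith)
  have hL1 : ∀ j : ℕ, ∫⁻ y in Icc (c - 2 ^ (j + 1) * ρ) (c + 2 ^ (j + 1) * ρ), ‖h y‖ₑ ≤
      ENNReal.ofReal (2 * |B| * (2 ^ j * ρ) * g ^ j) := by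
    intro j
    have h1 := (sq_lintegral_le (μ := volume.restrict (Icc (c - 2 ^ (j + 1) * ρ)
      (c + 2 ^ (j + 1) * ρ))) hm.enorm.restrict).trans (mul_le_mul_right (hB j) _)
    rw [Measure.restrict_apply_univ, Real.volume_Icc, ← ENNReal.ofReal_mul (by ring_nf; positivity)] at h1
    rw [← (ENNReal.pow_right_strictMono two_ne_zero).le_iff_le,
      ← ENNReal.ofReal_pow (by positivity)]
    refine h1.trans_eq ?_
    congr 1
    rw [show g ^ (2 * j) = (g ^ j) ^ 2 by rw [← pow_mul, mul_comm], mul_pow, mul_pow, mul_pow, sq_abs,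
      pow_succ 2 j]
    ring
  have hQ : ∀ j : ℕ, ∀ y ∈ dyadicShell c ρ j, (1 + |y|) ^ (-q) ≤
      ((1 + |c|) / ρ) ^ q * ((2 : ℝ) ^ (-q)) ^ j := by
    intro j y hy
    have h1 : |y - c| ≤ (1 + |c|) * (1 + |y|) := by
      have := abs_sub y c
      nlinarith [abs_nonneg y, abs_nonneg c]
    have h2 : 2 ^ j * ρ ≤ |y - c| := by
      refine le_trans ?_ hy.1
      gcongr
      · norm_num
      · omega
    have h3 : 2 ^ j * ρ / (1 + |c|) ≤ 1 + |y| := by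
      rw [div_le_iff₀ (by positivity)]; linarith
    refine (Real.rpow_le_rpow_of_nonpos (by positivity) h3 (by linarith)).trans_eq ?_
    rw [mul_div_assoc, Real.mul_rpow (by positivity) (by positivity), mul_comm,
      Real.rpow_neg (by positivity : 0 ≤ ρ / (1 + |c|)), ← Real.inv_rpow (by positivity), inv_div,
      ← Real.rpow_natCast, ← Real.rpow_natCast, ← Real.rpow_mul (by norm_num),
      ← Real.rpow_mul (by norm_num), mul_comm (j : ℝ)]
  have hcover : (univ : Set ℝ) ⊆ Icc (c - 2 ^ (0 + 1) * ρ) (c + 2 ^ (0 + 1) * ρ) ∪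
      ⋃ j, dyadicShell c ρ j := by
    intro y _
    rw [iUnion_dyadicShell c hρ, Icc_eq_abs_sub_le]
    rcases le_total |y - c| (2 * ρ) with h | h
    · left; simpa using h
    · right; exact h
  -- The ratio of the geometric series over the shells: the weight contributes `2^(-q)`, the length
  -- of the shell 2 and the growth of the root mean square `g`. It is below 1 because `1 + γ < q`.
  set t : ℝ := 2 ^ (-q) * (2 * g) with ht
  have ht0 : 0 < t := by positivity
  have ht1 : t < 1 := by
    rw [ht, hg, show (2 : ℝ) * 2 ^ γ = 2 ^ (1 + γ) by rw [Real.rpow_add (by norm_num), Real.rpow_one],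
      ← Real.rpow_add (by norm_num)]
    exact Real.rpow_lt_one_of_one_lt_of_neg (by norm_num) (by linarith)
  rw [← setLIntegral_univ]
  calc ∫⁻ y in univ, w y ≤ ∫⁻ y in (Icc (c - 2 ^ (0 + 1) * ρ) (c + 2 ^ (0 + 1) * ρ) ∪
        ⋃ j, dyadicShell c ρ j), w y := lintegral_mono_set hcover
    _ ≤ (∫⁻ y in Icc (c - 2 ^ (0 + 1) * ρ) (c + 2 ^ (0 + 1) * ρ), w y) +
        ∑' j, ∫⁻ y in dyadicShell c ρ j, w y :=
        (lintegral_union_le _ _ _).trans (add_le_add_right (lintegral_iUnion_le _ _) _)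
    _ ≤ ENNReal.ofReal (2 * |B| * (2 ^ 0 * ρ) * g ^ 0) + ∑' j : ℕ,
        ENNReal.ofReal (((1 + |c|) / ρ) ^ q * (2 * |B| * (2 * ρ) * g)) * ENNReal.ofReal t ^ j := by
        gcongr with j
        · refine le_trans (lintegral_mono fun y => ?_) (hL1 0)
          simpa using hwle (hone y)
        · calc ∫⁻ y in dyadicShell c ρ j, w y ≤ ∫⁻ y in dyadicShell c ρ j,
                ENNReal.ofReal (((1 + |c|) / ρ) ^ q * ((2 : ℝ) ^ (-q)) ^ j) * ‖h y‖ₑ := by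
                refine lintegral_mono_ae ?_
                filter_upwards [ae_restrict_mem (measurableSet_dyadicShell c ρ j)] with y hy
                exact hwle (hQ j y hy)
            _ ≤ ENNReal.ofReal (((1 + |c|) / ρ) ^ q * ((2 : ℝ) ^ (-q)) ^ j) *
                ENNReal.ofReal (2 * |B| * (2 ^ (j + 1) * ρ) * g ^ (j + 1)) := by
                rw [lintegral_const_mul' _ _ ENNReal.ofReal_ne_top]
                gcongr
                refine (lintegral_mono_set ?_).trans (hL1 (j + 1))
                rw [Icc_eq_abs_sub_le]; rintro y ⟨-, hy⟩; exact hy.le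
            _ = _ := by
                rw [← ENNReal.ofReal_pow ht0.le, ← ENNReal.ofReal_mul (by positivity),
                  ← ENNReal.ofReal_mul (by positivity), ht]
                congr 1
                ring
    _ < ⊤ := by
        rw [ENNReal.tsum_mul_left, ENNReal.tsum_geometric]
        refine ENNReal.add_lt_top.2 ⟨ENNReal.ofReal_lt_top,
          ENNReal.mul_lt_top ENNReal.ofReal_lt_top ?_⟩
        rw [ENNReal.inv_lt_top, tsub_pos_iff_lt]
        exact ENNReal.ofReal_lt_one.2 ht1

end

/-! ### The maximal function in terms of square integrals -/

noncomputable section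

lemma l2Norm_rpow_two {ι : Type*} (v : ι → ℂ) : l2Norm v ^ (2 : ℝ) = ∑' m, ‖v m‖ₑ ^ 2 := by
  rw [l2Norm, ← ENNReal.rpow_mul]
  norm_num

lemma normalized_mean_le_iff {δ s A : ℝ} (hδ : 0 < δ) (hA : 0 ≤ A) (J : ℝ≥0∞) :
    ENNReal.ofReal δ ^ (-s) * ((ENNReal.ofReal δ)⁻¹ * J) ^ (1 / 2 : ℝ) ≤ ENNReal.ofReal A ↔
      J ≤ ENNReal.ofReal (A ^ 2 * δ ^ (1 + 2 * s)) := by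
  have h0 : ENNReal.ofReal δ ≠ 0 := by simpa using hδ
  have ht : ENNReal.ofReal δ ≠ ⊤ := ENNReal.ofReal_ne_top
  have h1 : (ENNReal.ofReal δ ^ (-s) * ((ENNReal.ofReal δ)⁻¹ * J) ^ (1 / 2 : ℝ)) ^ 2 =
      J / ENNReal.ofReal (δ ^ (1 + 2 * s)) := by
    rw [← ENNReal.rpow_two, ENNReal.mul_rpow_of_nonneg _ _ (by norm_num), ← ENNReal.rpow_mul,
      ← ENNReal.rpow_mul, ← ENNReal.ofReal_rpow_of_pos hδ, ENNReal.div_eq_inv_mul,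
      ← ENNReal.rpow_neg, show (1 / 2 : ℝ) * 2 = 1 by norm_num, ENNReal.rpow_one, ← mul_assoc]
    congr 1
    rw [← ENNReal.rpow_neg_one (ENNReal.ofReal δ), ← ENNReal.rpow_add _ _ h0 ht]
    congr 1; ring
  rw [← ENNReal.pow_le_pow_left_iff two_ne_zero, h1, ← ENNReal.ofReal_pow hA,
    ENNReal.ofReal_mul (by positivity)]
  have h2 : 0 < δ ^ (1 + 2 * s) := by positivity
  exact ENNReal.div_le_iff (by simpa using h2) ENNReal.ofReal_ne_top

/-- The inequality is strict so that a competitor in the infimum can be chosen without knowing that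
the infimum is attained. -/
lemma exists_poly_of_maximalFn_lt {i : ℕ} {s : ℝ} {f : ℝ → ℂ} {x A : ℝ}
    (h : maximalFn i 2 s (fun _ : Unit => f) x < ENNReal.ofReal A) {c d : ℝ} (hcd : c < d)
    (hx : x ∈ Icc c d) :
    ∃ P ∈ Polynomial.degreeLT ℂ i, ∫⁻ y in Icc c d, ‖f y - P.eval (y : ℂ)‖ₑ ^ 2 ≤
      ENNReal.ofReal (A ^ 2 * (d - c) ^ (1 + 2 * s)) := by
  have hA : 0 < A := by
    by_contra h0
    rw [ENNReal.ofReal_of_nonpos (not_lt.1 h0)] at h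
    exact not_lt_zero h
  have h1 := (le_iSup₂_of_le (f := fun c d => ⨆ (_ : c < d) (_ : x ∈ Icc c d),
    ⨅ (P : Unit → ℂ[X]) (_ : ∀ m, P m ∈ Polynomial.degreeLT ℂ i),
      ENNReal.ofReal (d - c) ^ (-s) *
        ((ENNReal.ofReal (d - c))⁻¹ *
          ∫⁻ y in Icc c d, l2Norm (fun m => f y - (P m).eval (y : ℂ)) ^ (2 : ℝ)) ^ (1 / 2 : ℝ))
    c d (le_iSup₂_of_le hcd hx le_rfl)).trans_lt h
  obtain ⟨P, h2⟩ := iInf_lt_iff.1 h1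
  obtain ⟨hP, h3⟩ := iInf_lt_iff.1 h2
  refine ⟨P (), hP (), ?_⟩
  have h4 := (normalized_mean_le_iff (sub_pos.2 hcd) hA.le _).1 h3.le
  simpa only [l2Norm_rpow_two, tsum_fintype, Finset.univ_unique, Finset.sum_singleton] using h4

lemma maximalFn_le {ι : Type*} {r : ℕ} {s : ℝ} {g : ι → ℝ → ℂ} {x A : ℝ} (hA : 0 ≤ A)
    (h : ∀ c d, c < d → x ∈ Icc c d → ∃ P : ι → ℂ[X], (∀ m, P m ∈ Polynomial.degreeLT ℂ r) ∧
      ∫⁻ y in Icc c d, ∑' m, ‖g m y - (P m).eval (y : ℂ)‖ₑ ^ 2 ≤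
        ENNReal.ofReal (A ^ 2 * (d - c) ^ (1 + 2 * s))) :
    maximalFn r 2 s g x ≤ ENNReal.ofReal A := by
  refine iSup₂_le fun c d => iSup₂_le fun hcd hx => ?_
  obtain ⟨P, hP, hJ⟩ := h c d hcd hx
  refine iInf₂_le_of_le P hP ?_
  rw [normalized_mean_le_iff (sub_pos.2 hcd) hA]
  simpa only [l2Norm_rpow_two] using hJ

end

/-! ### Tempered distributions and convolution with Schwartz functions -/

noncomputable section

/-- The constant is kept as an explicit seminorm, because continuity of the functional defined by
`f` is read off from it. -/
lemma SchwartzMap.norm_le_one_add_rpow (u : 𝓢(ℝ, ℂ)) {q : ℝ} {n : ℕ} (hn : q ≤ n) (x : ℝ) :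
    ‖u x‖ ≤ 2 ^ n * (Finset.Iic (n, 0)).sup (schwartzSeminormFamily ℂ ℝ ℂ) u *
      (1 + |x|) ^ (-q) := by
  have h := SchwartzMap.one_add_le_sup_seminorm_apply (𝕜 := ℂ) (m := (n, 0)) le_rfl le_rfl u x
  rw [norm_iteratedFDeriv_zero, Real.norm_eq_abs] at h
  have h1 : 0 < 1 + |x| := by positivity
  have h2 : (1 + |x|) ^ q ≤ (1 + |x|) ^ n := by
    rw [← Real.rpow_natCast]
    exact Real.rpow_le_rpow_of_exponent_le (by linarith [abs_nonneg x]) hn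
  rw [Real.rpow_neg h1.le, ← div_eq_mul_inv, le_div_iff₀ (by positivity), mul_comm]
  exact (mul_le_mul_of_nonneg_right h2 (norm_nonneg _)).trans h

lemma SchwartzMap.exists_norm_le (u : 𝓢(ℝ, ℂ)) (q : ℝ) :
    ∃ C, 0 ≤ C ∧ ∀ x, ‖u x‖ ≤ C * (1 + |x|) ^ (-q) :=
  ⟨_, by positivity, u.norm_le_one_add_rpow (Nat.le_ceil q)⟩

lemma Tame.integrable_schwartz_mul {q : ℝ} {f : ℝ → ℂ} (hf : Tame q f) (u : 𝓢(ℝ, ℂ)) :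
    Integrable fun x => u x * f x := by
  obtain ⟨C, -, hC⟩ := u.exists_norm_le q
  simpa using (hf.integrable_mul 0 u.continuous.aestronglyMeasurable hC).1

lemma Tame.exists_isGivenBy {q : ℝ} {f : ℝ → ℂ} (hf : Tame q f) :
    ∃ T : 𝓢'(ℝ, ℂ), IsGivenBy T f := by
  refine ⟨ContinuousLinearMap.toPointwiseConvergenceCLM _ _ _ _
    (SchwartzMap.mkCLMtoNormedSpace (𝕜 := ℂ) (σ := RingHom.id ℂ)
      (fun u : 𝓢(ℝ, ℂ) => ∫ x, u x * f x) ?_ ?_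
      ⟨Finset.Iic (⌈q⌉₊, 0), 2 ^ ⌈q⌉₊ * ∫ y, (1 + |y|) ^ (-q) * ‖f y‖, ?_, ?_⟩), fun φ =>
      ⟨hf.integrable_schwartz_mul φ, rfl⟩⟩
  · intro u v
    rw [← integral_add (hf.integrable_schwartz_mul u) (hf.integrable_schwartz_mul v)]
    simp only [add_apply, add_mul]
  · intro a u
    simp only [smul_apply, smul_eq_mul, mul_assoc, integral_const_mul, RingHom.id_apply]
  · exact mul_nonneg (by positivity) (integral_nonneg fun y => by positivity)
  · intro u
    have h := (hf.integrable_mul 0 u.continuous.aestronglyMeasurable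
      (u.norm_le_one_add_rpow (Nat.le_ceil q))).2
    simp only [zero_mul, neg_zero, cis_zero, one_mul] at h
    refine h.trans_eq ?_
    ring

/-- Convolution on the line. -/
def conv (φ f : ℝ → ℂ) (x : ℝ) : ℂ := ∫ y, φ (x - y) * f y

/-- Peetre's inequality, a consequence of `1 + |y| ≤ (1 + |x|)(1 + |x - y|)`. -/
lemma one_add_abs_rpow_neg_sub_le {q : ℝ} (hq : 0 ≤ q) (x y : ℝ) :
    (1 + |x - y|) ^ (-q) ≤ (1 + |x|) ^ q * (1 + |y|) ^ (-q) := by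
  rw [Real.rpow_neg (by positivity), Real.rpow_neg (by positivity), ← div_eq_mul_inv,
    ← Real.div_rpow (by positivity) (by positivity), ← Real.inv_rpow (by positivity)]
  refine Real.rpow_le_rpow (by positivity) ?_ hq
  rw [inv_eq_one_div, div_le_div_iff₀ (by positivity) (by positivity)]
  have : |y| ≤ |x| + |x - y| := by
    have := abs_sub x (x - y)
    simpa using this
  nlinarith [abs_nonneg x, abs_nonneg (x - y)]

lemma SchwartzMap.exists_norm_sub_le (φ : 𝓢(ℝ, ℂ)) {q : ℝ} (hq : 0 ≤ q) :
    ∃ C, 0 ≤ C ∧ ∀ x y, ‖φ (x - y)‖ ≤ C * (1 + |x|) ^ q * (1 + |y|) ^ (-q) := by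
  obtain ⟨C, hC0, hC⟩ := φ.exists_norm_le q
  refine ⟨C, hC0, fun x y => (hC _).trans ?_⟩
  rw [mul_assoc]
  exact mul_le_mul_of_nonneg_left (one_add_abs_rpow_neg_sub_le hq x y) hC0

lemma Tame.integrable_conv {q : ℝ} (hq : 0 ≤ q) {f : ℝ → ℂ} (hf : Tame q f) (φ : 𝓢(ℝ, ℂ)) (x : ℝ) :
    Integrable fun y => φ (x - y) * f y := by
  obtain ⟨C, -, hC⟩ := φ.exists_norm_sub_le hq
  have hc : Continuous fun y => φ (x - y) := φ.continuous.comp (by fun_prop)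
  simpa using (hf.integrable_mul 0 hc.aestronglyMeasurable (hC x)).1

lemma Tame.continuous_conv {q : ℝ} (hq : 0 ≤ q) {f : ℝ → ℂ} (hf : Tame q f) (φ : 𝓢(ℝ, ℂ)) :
    Continuous (conv φ f) := by
  obtain ⟨C, hC0, hC⟩ := φ.exists_norm_sub_le hq
  refine continuous_iff_continuousAt.2 fun x₀ => ?_
  refine continuousAt_of_dominated (bound := fun y => C * (2 + |x₀|) ^ q * ((1 + |y|) ^ (-q) * ‖f y‖))
    (Eventually.of_forall fun x => (hf.integrable_conv hq φ x).1) ?_ (hf.2.const_mul _) ?_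
  · filter_upwards [Metric.ball_mem_nhds x₀ one_pos] with x hx
    filter_upwards with y
    rw [norm_mul, ← mul_assoc]
    refine mul_le_mul_of_nonneg_right ((hC x y).trans ?_) (norm_nonneg _)
    rw [Metric.mem_ball, Real.dist_eq] at hx
    have h1 : 1 + |x| ≤ 2 + |x₀| := by
      have := abs_sub_abs_le_abs_sub x x₀
      linarith
    have h2 := Real.rpow_le_rpow (by positivity) h1 hq
    gcongr
  · filter_upwards with y
    have : Continuous fun x => φ (x - y) * f y :=
      (φ.continuous.comp (by fun_prop : Continuous fun x => x - y)).mul continuous_const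
    exact this.continuousAt

open FourierTransform in
lemma fourierInv_apply_eq_integral (v : 𝓢(ℝ, ℂ)) (z : ℝ) :
    (𝓕⁻ v : 𝓢(ℝ, ℂ)) z = ∫ ξ, cis (ξ * z) * v ξ := by
  rw [SchwartzMap.fourierInv_coe, Real.fourierInv_eq']
  congr 1; ext x
  simp only [cis, smul_eq_mul]
  congr 2; simp; ring

open FourierTransform in
lemma fourier_mul_fourierInv_apply (Ψ u : 𝓢(ℝ, ℂ)) (y : ℝ) :
    (𝓕 (SchwartzMap.smulLeftCLM ℂ Ψ (𝓕⁻ u)) : 𝓢(ℝ, ℂ)) y =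
      ∫ x, u x * (𝓕⁻ Ψ : 𝓢(ℝ, ℂ)) (x - y) := by
  rw [SchwartzMap.fourier_coe, ← ft_eq_fourier, ft]
  simp_rw [SchwartzMap.smulLeftCLM_apply_apply Ψ.hasTemperateGrowth,
    fourierInv_apply_eq_integral, smul_eq_mul,
    ← integral_const_mul]
  rw [integral_integral_swap]
  · congr 1; ext x
    congr 1; ext ξ
    rw [show ξ * (x - y) = -(y * ξ) + x * ξ by ring, cis_add]; ring
  · have h1 : Integrable (fun p : ℝ × ℝ => ‖Ψ p.1‖ * ‖u p.2‖) (volume.prod volume) :=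
      Ψ.integrable.norm.mul_prod u.integrable.norm
    refine h1.mono' ?_ (Eventually.of_forall fun p => ?_)
    · have h2 : Continuous fun p : ℝ × ℝ => cis (-(y * p.1)) * (Ψ p.1 * (cis (p.2 * p.1) * u p.2)) := by
        have := Ψ.continuous
        have := u.continuous
        fun_prop
      exact h2.aestronglyMeasurable
    · simp [Function.uncurry]

open FourierTransform in
/-- A Fourier multiplier acts on a function of moderate growth as a convolution. -/
lemma Tame.isGivenBy_fourierMultiplier {q : ℝ} (hq : 0 ≤ q) {f : ℝ → ℂ} (hf : Tame q f)
    {T : 𝓢'(ℝ, ℂ)} (hT : IsGivenBy T f) (Ψ : 𝓢(ℝ, ℂ)) :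
    IsGivenBy (TemperedDistribution.fourierMultiplierCLM ℂ Ψ T)
      (conv (𝓕⁻ Ψ : 𝓢(ℝ, ℂ)) f) := by
  intro u
  set φ : 𝓢(ℝ, ℂ) := 𝓕⁻ Ψ with hφ
  obtain ⟨C, hC0, hC⟩ := φ.exists_norm_sub_le hq
  -- In the double integral, `q` powers pay for the translation of the convolution kernel and the
  -- other 2 for integrability in `x`.
  obtain ⟨D, hD0, hD⟩ := u.exists_norm_le (q + 2)
  have hint : Integrable (fun p : ℝ × ℝ => u p.1 * (φ (p.1 - p.2) * f p.2))
      (volume.prod volume) := by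
    have hI : Integrable fun y : ℝ => (1 + ‖y‖) ^ (-2 : ℝ) := integrable_one_add_norm (by simp)
    refine ((hI.mul_prod hf.2).const_mul (D * C)).mono' ?_ (Eventually.of_forall fun p => ?_)
    · have h1 : Continuous fun p : ℝ × ℝ => u p.1 := u.continuous.comp continuous_fst
      have h2 : Continuous fun p : ℝ × ℝ => φ (p.1 - p.2) := φ.continuous.comp (by fun_prop)
      exact h1.aestronglyMeasurable.mul (h2.aestronglyMeasurable.mul hf.1.comp_snd)
    · rw [norm_mul, norm_mul]
      calc ‖u p.1‖ * (‖φ (p.1 - p.2)‖ * ‖f p.2‖) ≤ (D * (1 + |p.1|) ^ (-(q + 2))) *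
            ((C * (1 + |p.1|) ^ q * (1 + |p.2|) ^ (-q)) * ‖f p.2‖) := by
            gcongr
            · exact hD _
            · exact hC _ _
        _ = D * C * (((1 + |p.1|) ^ (-(q + 2)) * (1 + |p.1|) ^ q) *
            ((1 + |p.2|) ^ (-q) * ‖f p.2‖)) := by ring
        _ = _ := by
            rw [← Real.rpow_add (by positivity), Real.norm_eq_abs]
            ring_nf
  refine ⟨?_, ?_⟩
  · have := hint.integral_prod_left
    simp only [integral_const_mul] at this
    exact this
  · rw [TemperedDistribution.fourierMultiplierCLM_apply_apply, (hT _).2]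
    simp_rw [fourier_mul_fourierInv_apply, conv, ← integral_const_mul, ← integral_mul_const]
    rw [integral_integral_swap]
    · congr 1; ext x; congr 1; ext y; ring
    · refine hint.swap.congr (Eventually.of_forall fun p => ?_)
      simp [Function.uncurry]; ring

end

/-! ### Smooth multipliers that vanish near the end of a segment -/

noncomputable section

lemma IsCutoff.exists_schwartz {χ : ℝ → ℂ} (hχ : IsCutoff χ) (a : ℝ) {ℓ ε : ℝ} (hℓ : ℓ ≠ 0)
    (hε : 0 < ε) :
    ∃ Ψ : 𝓢(ℝ, ℂ), ∀ ξ, Ψ ξ = χ ((ξ - a) / ℓ) * (1 - χ ((ξ - a) / ℓ / ε)) := by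
  have hs : ContDiff ℝ ∞ fun ξ => χ ((ξ - a) / ℓ) * (1 - χ ((ξ - a) / ℓ / ε)) := by
    have h1 : ContDiff ℝ ∞ fun ξ : ℝ => (ξ - a) / ℓ := by fun_prop
    have h2 : ContDiff ℝ ∞ fun ξ : ℝ => (ξ - a) / ℓ / ε := by fun_prop
    exact (hχ.smooth.comp h1).mul (contDiff_const.sub (hχ.smooth.comp h2))
  have hc : HasCompactSupport fun ξ => χ ((ξ - a) / ℓ) * (1 - χ ((ξ - a) / ℓ / ε)) := by
    refine HasCompactSupport.of_support_subset_isCompact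
      ((isCompact_Icc (a := (0 : ℝ)) (b := 1)).image (f := fun t => a + t * ℓ) (by fun_prop))
      fun ξ hξ => ⟨(ξ - a) / ℓ, ⟨?_, ?_⟩, by field_simp; ring⟩
    · by_contra! h
      refine hξ ?_
      have : (ξ - a) / ℓ / ε < 1 / 3 := (div_neg_of_neg_of_pos h hε).trans (by norm_num)
      simp only [hχ.one _ this, sub_self, mul_zero]
    · by_contra! h
      refine hξ ?_
      simp only [hχ.zero _ (lt_trans (by norm_num) h), zero_mul]
  exact ⟨hc.toSchwartzMap hs, fun ξ => rfl⟩

/-- For `ε ≤ 1/3` the dilated cut-off is supported where `χ = 1`. The product form shows the support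
and smoothness, the difference form gives the kernel. -/
lemma IsCutoff.mul_one_sub {χ : ℝ → ℂ} (hχ : IsCutoff χ) {ε : ℝ} (hε : 0 < ε) (hε' : ε ≤ 1 / 3)
    (t : ℝ) : χ t * (1 - χ (t / ε)) = χ t - χ (t / ε) := by
  rcases lt_or_ge t (1 / 3) with h | h
  · rw [hχ.one t h, one_mul]
  · have : t / ε > 2 / 3 := by
      rw [gt_iff_lt, lt_div_iff₀ hε]; linarith
    rw [hχ.zero _ this]; ring

-- The symbol is the cut-off of the segment of length `ℓ` minus that of the segment of length `εℓ`
-- with the same end; the two jumps cancel, and each term has an `osKer` as its kernel.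
open FourierTransform in
lemma IsCutoff.fourierInv_apply {χ : ℝ → ℂ} (hχ : IsCutoff χ) {a ℓ ε : ℝ} (hℓ : ℓ ≠ 0)
    (hε : 0 < ε) (hε' : ε ≤ 1 / 3) {Ψ : 𝓢(ℝ, ℂ)}
    (hΨ : ∀ ξ, Ψ ξ = χ ((ξ - a) / ℓ) * (1 - χ ((ξ - a) / ℓ / ε))) (z : ℝ) :
    (𝓕⁻ Ψ : 𝓢(ℝ, ℂ)) z = cis (a * z) * (osKer χ ℓ 0 z - osKer χ (ε * ℓ) 0 z) := by
  have hχc := hχ.smooth.continuous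
  set G : ℝ → ℂ := fun t => (χ t - χ (t / ε)) * cis (t * (ℓ * z)) with hG
  have hsub : ∫ ξ, cis (ξ * z) * Ψ ξ = |ℓ| * (cis (a * z) * ∫ t, G t) := by
    have h1 : ∫ ξ, cis (ξ * z) * Ψ ξ = ∫ t, cis ((t + a) * z) * Ψ (t + a) :=
      (integral_add_right_eq_self (fun ξ => cis (ξ * z) * Ψ ξ) a).symm
    have h2 := Measure.integral_comp_mul_left (fun t => cis ((t + a) * z) * Ψ (t + a)) ℓ
    have h3 : ∀ t, cis ((ℓ * t + a) * z) * Ψ (ℓ * t + a) = cis (a * z) * G t := by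
      intro t
      rw [hΨ, show (ℓ * t + a - a) / ℓ = t by field_simp; ring, hχ.mul_one_sub hε hε', hG,
        show (ℓ * t + a) * z = a * z + t * (ℓ * z) by ring, cis_add]
      ring
    simp_rw [h3] at h2
    rw [integral_const_mul] at h2
    rw [h1, h2, abs_inv, Complex.real_smul, ← mul_assoc, ← Complex.ofReal_mul,
      mul_inv_cancel₀ (abs_ne_zero.2 hℓ), Complex.ofReal_one, one_mul]
  have hGI : ∫ t, G t = ∫ t in (0 : ℝ)..1, G t := by
    rw [intervalIntegral.integral_of_le zero_le_one,
      setIntegral_eq_integral_of_forall_compl_eq_zero]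
    intro t ht
    rw [mem_Ioc, not_and_or, not_lt, not_le] at ht
    rcases ht with ht | ht
    · have h2 : t / ε < 1 / 3 := (div_nonpos_of_nonpos_of_nonneg ht hε.le).trans_lt (by norm_num)
      simp only [hG, hχ.one _ h2, hχ.one t (by linarith), sub_self, zero_mul]
    · have h2 : t / ε > 2 / 3 := by
        rw [gt_iff_lt, lt_div_iff₀ hε]; linarith
      simp only [hG, hχ.zero _ h2, hχ.zero t (by linarith), sub_self, zero_mul]
  have hε1 : (1 : ℝ) ≤ 1 / ε := by rw [le_div_iff₀ hε]; linarith
  have hscale : ∫ t in (0 : ℝ)..1, χ (t / ε) * cis (t * (ℓ * z)) = ε * osc χ 0 (ε * ℓ * z) := by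
    have h1 := intervalIntegral.integral_comp_div (a := 0) (b := 1)
      (fun u => χ u * cis (u * (ε * ℓ * z))) hε.ne'
    have h2 : ∀ t : ℝ, t / ε * (ε * ℓ * z) = t * (ℓ * z) := fun t => by field_simp
    simp_rw [h2] at h1
    rw [h1, zero_div, ← intervalIntegral.integral_add_adjacent_intervals (b := 1)
      ((by fun_prop : Continuous fun u => χ u * cis (u * (ε * ℓ * z))).intervalIntegrable _ _)
      ((by fun_prop : Continuous fun u => χ u * cis (u * (ε * ℓ * z))).intervalIntegrable _ _),
      intervalIntegral.integral_congr (a := 1) (g := fun _ => 0), intervalIntegral.integral_zero,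
      add_zero, osc, Complex.real_smul]
    · simp
    · intro u hu
      rw [uIcc_of_le hε1] at hu
      simp only [hχ.zero u (by linarith [hu.1]), zero_mul]
  rw [fourierInv_apply_eq_integral, hsub, hGI]
  simp only [hG, sub_mul]
  rw [intervalIntegral.integral_sub
    ((by fun_prop : Continuous fun u => χ u * cis (u * (ℓ * z))).intervalIntegrable _ _)
    ((by fun_prop : Continuous fun u => χ (u / ε) * cis (u * (ℓ * z))).intervalIntegrable _ _), hscale,
    show ∫ u in (0 : ℝ)..1, χ u * cis (u * (ℓ * z)) = osc χ 0 (ℓ * z) by simp [osc], osKer, osKer]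
  simp only [pow_zero, mul_one, abs_mul, abs_of_pos hε]
  push_cast
  ring

open FourierTransform in
/-- The Fourier inverse of a function that vanishes near the origin kills polynomials. -/
lemma conv_fourierInv_eval {Ψ : 𝓢(ℝ, ℂ)} (hΨ : ∀ᶠ ξ in 𝓝 0, Ψ ξ = 0) (P : ℂ[X]) (x : ℝ) :
    conv (𝓕⁻ Ψ : 𝓢(ℝ, ℂ)) (fun y => P.eval (y : ℂ)) x = 0 := by
  set φ : 𝓢(ℝ, ℂ) := 𝓕⁻ Ψ with hφ
  have hint : ∀ n : ℕ, Integrable fun z : ℝ => z ^ n • φ z := by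
    intro n
    have hc : Continuous fun z : ℝ => z ^ n • φ z := by
      have := φ.continuous
      fun_prop
    refine (φ.integrable_pow_mul volume n).mono' hc.aestronglyMeasurable
      (Eventually.of_forall fun z => ?_)
    rw [norm_smul, norm_pow]
  -- Up to a nonzero constant the moments of `φ` are the derivatives at 0 of its transform `Ψ`,
  -- which vanishes near 0.
  have hmom : ∀ n : ℕ, ∫ z : ℝ, φ z * (z : ℂ) ^ n = 0 := by
    intro n
    have h1 := congrFun (Real.iteratedDeriv_fourier (f := φ) (N := ⊤) (n := n) (fun n _ => hint n)
      le_top) 0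
    have h2 : 𝓕 (φ : ℝ → ℂ) = Ψ := by
      rw [← SchwartzMap.fourier_coe, hφ, FourierTransform.fourier_fourierInv_eq]
    rw [h2, Filter.EventuallyEq.iteratedDeriv_eq (g := fun _ => 0) n hΨ, ← ft_eq_fourier, ft] at h1
    simp only [iteratedDeriv_fun_const_zero, zero_mul, neg_zero, cis_zero, one_mul, smul_eq_mul] at h1
    have h3 : ∀ z : ℝ, (-2 * Real.pi * Complex.I * z : ℂ) ^ n * φ z =
        (-2 * Real.pi * Complex.I) ^ n * (φ z * (z : ℂ) ^ n) := fun z => by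
      rw [mul_pow]; ring
    simp_rw [h3] at h1
    rw [integral_const_mul] at h1
    refine (mul_eq_zero.1 h1.symm).resolve_left (pow_ne_zero _ ?_)
    simp [Real.pi_ne_zero]
  set Q : ℂ[X] := P.comp (Polynomial.C (x : ℂ) - Polynomial.X) with hQ
  have h1 : conv φ (fun y => P.eval (y : ℂ)) x = ∫ z, φ z * Q.eval (z : ℂ) := by
    rw [conv, ← integral_sub_left_eq_self (fun y => φ (x - y) * P.eval (y : ℂ)) volume x]
    congr 1; ext z
    rw [hQ, Polynomial.eval_comp]
    simp
  rw [h1]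
  simp_rw [Polynomial.eval_eq_sum_range, Finset.mul_sum, mul_left_comm (φ _)]
  rw [integral_finsetSum]
  · refine Finset.sum_eq_zero fun n _ => ?_
    rw [integral_const_mul, hmom, mul_zero]
  · intro n _
    refine ((hint n).congr (Eventually.of_forall fun z => ?_)).const_mul _
    simp [mul_comm]

end

/-! ### The modified operator modulo polynomials -/

noncomputable section

lemma freqShift_eq (c : ℝ) (F : ℝ → ℂ) (x : ℝ) : freqShift c F x = cis (-(c * x)) * F x := by
  rw [freqShift, cis]
  congr 2; push_cast; ring

lemma tendsto_lenWeight {α : ℝ} (hα : 0 < α) (k : ℕ) (ℓ : ℝ) :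
    Tendsto (fun ε => lenWeight α k (ε * ℓ)) (𝓝 0) (𝓝 0) := by
  have hc : Continuous fun ε => lenWeight α k (ε * ℓ) := by
    unfold lenWeight
    have : Continuous fun ε : ℝ => |ε * ℓ| ^ α :=
      (by fun_prop : Continuous fun ε : ℝ => |ε * ℓ|).rpow_const fun _ => Or.inr hα.le
    fun_prop
  have h0 : lenWeight α k (0 * ℓ) = 0 := by simp [lenWeight, Real.zero_rpow hα.ne']
  simpa only [h0] using hc.tendsto 0

lemma ite_osTaylor_mem_polyFun (χ : ℝ → ℂ) (ℓ : ℝ) (r : ℕ) (c ρ y : ℝ) :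
    (fun x => if 2 * ρ ≤ |y - c| then osTaylor χ ℓ r c x y else 0) ∈ polyFun r := by
  split_ifs
  · exact osTaylor_mem_polyFun χ ℓ r c y
  · exact Submodule.zero_mem _

section
variable {χ : ℝ → ℂ} (hχ : IsCutoff χ) {k : ℕ} {α : ℝ} (hα0 : 0 ≤ α) (hα1 : α ≤ 1)
  {u : ℝ → ℂ} (hu : Tame (k + 2 - α) u)
include hχ hα0 hα1 hu

lemma IsCutoff.integrable_modKer_mul (a : ℝ) {ℓ : ℝ} (hℓ : ℓ ≠ 0) (c : ℝ) {ρ : ℝ} (hρ : 0 ≤ ρ)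
    (x : ℝ) : Integrable fun y => modKer χ ℓ (k + 1) c ρ x y * (cis (-(a * y)) * u y) := by
  obtain ⟨C, -, hC⟩ := hχ.exists_norm_modKer_le k hα0 hα1 c hρ (abs_nonneg x)
  exact (hu.integrable_mul a (measurable_modKer hχ.smooth.continuous ..).aestronglyMeasurable
    (hC ℓ x · hℓ le_rfl)).1

lemma IsCutoff.exists_norm_modOp_le (c : ℝ) {ρ : ℝ} (hρ : 0 ≤ ρ) {N : ℝ} (hN : 0 ≤ N) :
    ∃ C, 0 ≤ C ∧ ∀ a ℓ x, ℓ ≠ 0 → |x| ≤ N →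
      ‖modOp χ a ℓ (k + 1) c ρ u x‖ ≤ C * lenWeight α k ℓ := by
  obtain ⟨C, hC0, hC⟩ := hχ.exists_norm_modKer_le k hα0 hα1 c hρ hN
  refine ⟨C * ∫ y, (1 + |y|) ^ (-(k + 2 - α)) * ‖u y‖,
    mul_nonneg hC0.le (integral_nonneg fun y => by positivity), fun a ℓ x hℓ hx => ?_⟩
  refine (hu.integrable_mul a (measurable_modKer hχ.smooth.continuous ..).aestronglyMeasurable
    (hC ℓ x · hℓ hx)).2.trans_eq ?_
  ring

lemma IsCutoff.modOp_sub {v : ℝ → ℂ} (hv : Tame (k + 2 - α) v) (a : ℝ) {ℓ : ℝ} (hℓ : ℓ ≠ 0) (c : ℝ)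
    {ρ : ℝ} (hρ : 0 ≤ ρ) (x : ℝ) :
    modOp χ a ℓ (k + 1) c ρ (fun y => u y - v y) x =
      modOp χ a ℓ (k + 1) c ρ u x - modOp χ a ℓ (k + 1) c ρ v x := by
  unfold modOp
  rw [← integral_sub (hχ.integrable_modKer_mul hα0 hα1 hu a hℓ c hρ x)
    (hχ.integrable_modKer_mul hα0 hα1 hv a hℓ c hρ x)]
  congr 1; ext y; ring

/-- A change of the interval changes the operator by polynomials. -/
lemma IsCutoff.modOp_sub_modOp_mem (a : ℝ) {ℓ : ℝ} (hℓ : ℓ ≠ 0) (c c' : ℝ) {ρ ρ' : ℝ} (hρ : 0 ≤ ρ)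
    (hρ' : 0 ≤ ρ') :
    (fun x => modOp χ a ℓ (k + 1) c ρ u x - modOp χ a ℓ (k + 1) c' ρ' u x) ∈ polyFun (k + 1) := by
  have h2 := fun x => (hχ.integrable_modKer_mul hα0 hα1 hu a hℓ c hρ x).sub
    (hχ.integrable_modKer_mul hα0 hα1 hu a hℓ c' hρ' x)
  have h3 := integral_mem_polyFun (μ := volume) (r := k + 1) (p := fun y x =>
    modKer χ ℓ (k + 1) c ρ x y * (cis (-(a * y)) * u y) -
      modKer χ ℓ (k + 1) c' ρ' x y * (cis (-(a * y)) * u y)) (fun y => ?_) h2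
  · convert h3 using 2 with x
    exact (integral_sub (hχ.integrable_modKer_mul hα0 hα1 hu a hℓ c hρ x)
      (hχ.integrable_modKer_mul hα0 hα1 hu a hℓ c' hρ' x)).symm
  · convert Submodule.smul_mem _ (cis (-(a * y)) * u y) (Submodule.sub_mem _
      (ite_osTaylor_mem_polyFun χ ℓ (k + 1) c' ρ' y) (ite_osTaylor_mem_polyFun χ ℓ (k + 1) c ρ y))
      using 1
    ext x
    simp only [modKer, Pi.smul_apply, Pi.sub_apply, smul_eq_mul]
    ring

-- For fixed `y` the shifted convolution kernel equals the difference of the two unmodified kernels,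
-- so only Taylor polynomials in `x` are left. They are integrated in `y` together with the kernels,
-- never alone.
open FourierTransform in
lemma IsCutoff.freqShift_conv_sub_mem {a ℓ ε : ℝ} (hℓ : ℓ ≠ 0)
    (hε : 0 < ε) (hε' : ε ≤ 1 / 3) {Ψ : 𝓢(ℝ, ℂ)}
    (hΨ : ∀ ξ, Ψ ξ = χ ((ξ - a) / ℓ) * (1 - χ ((ξ - a) / ℓ / ε))) (c : ℝ) {ρ : ℝ} (hρ : 0 ≤ ρ) :
    (fun x => freqShift a (conv (𝓕⁻ Ψ : 𝓢(ℝ, ℂ)) u) x - (modOp χ a ℓ (k + 1) c ρ u x -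
      modOp χ a (ε * ℓ) (k + 1) c ρ u x)) ∈ polyFun (k + 1) := by
  have hεℓ : ε * ℓ ≠ 0 := mul_ne_zero hε.ne' hℓ
  have i1 := fun x => ((hu.integrable_conv (by have := k.cast_nonneg (α := ℝ); linarith)
    (𝓕⁻ Ψ) x).const_mul (cis (-(a * x))))
  have i2 : ∀ x, Integrable fun y => modKer χ ℓ (k + 1) c ρ x y * (cis (-(a * y)) * u y) -
      modKer χ (ε * ℓ) (k + 1) c ρ x y * (cis (-(a * y)) * u y) := fun x =>
    (hχ.integrable_modKer_mul hα0 hα1 hu a hℓ c hρ x).sub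
      (hχ.integrable_modKer_mul hα0 hα1 hu a hεℓ c hρ x)
  have h3 := integral_mem_polyFun (μ := volume) (r := k + 1) (p := fun y x =>
    cis (-(a * x)) * ((𝓕⁻ Ψ : 𝓢(ℝ, ℂ)) (x - y) * u y) -
      (modKer χ ℓ (k + 1) c ρ x y * (cis (-(a * y)) * u y) -
      modKer χ (ε * ℓ) (k + 1) c ρ x y * (cis (-(a * y)) * u y))) (fun y => ?_)
      fun x => (i1 x).sub (i2 x)
  · convert h3 using 2 with x
    rw [integral_sub (i1 x) (i2 x), freqShift_eq, conv, ← integral_const_mul]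
    congr 1
    exact (integral_sub (hχ.integrable_modKer_mul hα0 hα1 hu a hℓ c hρ x)
      (hχ.integrable_modKer_mul hα0 hα1 hu a hεℓ c hρ x)).symm
  · convert Submodule.smul_mem _ (cis (-(a * y)) * u y) (Submodule.sub_mem _
      (ite_osTaylor_mem_polyFun χ ℓ (k + 1) c ρ y)
      (ite_osTaylor_mem_polyFun χ (ε * ℓ) (k + 1) c ρ y)) using 1
    ext x
    have h4 : cis (-(a * x)) * cis (a * (x - y)) = cis (-(a * y)) := by
      rw [← cis_add]; congr 1; ring
    simp only [modKer, Pi.smul_apply, Pi.sub_apply, smul_eq_mul]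
    rw [hχ.fourierInv_apply hℓ hε hε' hΨ, ← h4]
    ring

end

/-- The origin is outside the open segment, and the symbol vanishes on a full neighbourhood of the
complement of the open segment, both ends included. -/
lemma IsCutoff.eventually_eq_zero {χ : ℝ → ℂ} (hχ : IsCutoff χ) {a ℓ ε : ℝ} (hℓ : ℓ ≠ 0)
    (hε : 0 < ε) (h0 : ∀ t ∈ Ioo (0 : ℝ) 1, a + t * ℓ ≠ 0) :
    ∀ᶠ ξ in 𝓝 0, χ ((ξ - a) / ℓ) * (1 - χ ((ξ - a) / ℓ / ε)) = 0 := by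
  have hc : Continuous fun ξ : ℝ => (ξ - a) / ℓ := by fun_prop
  have h1 : (0 - a) / ℓ ∉ Ioo (0 : ℝ) 1 := fun h => h0 _ h (by field_simp; ring)
  rw [mem_Ioo, not_and_or, not_lt, not_lt] at h1
  rcases h1 with h1 | h1
  · filter_upwards [(isOpen_Iio.preimage hc).mem_nhds
      (show (0 - a) / ℓ < ε / 3 by linarith [div_pos hε (show (0 : ℝ) < 3 by norm_num)])] with ξ hξ
    have : (ξ - a) / ℓ / ε < 1 / 3 := by
      rw [div_lt_iff₀ hε]
      have : (ξ - a) / ℓ < ε / 3 := hξ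
      linarith
    rw [hχ.one _ this, sub_self, mul_zero]
  · filter_upwards [(isOpen_Ioi.preimage hc).mem_nhds
      (show 2 / 3 < (0 - a) / ℓ by linarith)] with ξ hξ
    rw [hχ.zero _ hξ, zero_mul]

/-- The modified operator maps polynomials to polynomials. -/
lemma IsCutoff.modOp_eval_mem {χ : ℝ → ℂ} (hχ : IsCutoff χ) {a ℓ : ℝ} (hℓ : ℓ ≠ 0)
    (h0 : ∀ t ∈ Ioo (0 : ℝ) 1, a + t * ℓ ≠ 0) (c : ℝ) {ρ : ℝ} (hρ : 0 ≤ ρ) {k : ℕ} {P : ℂ[X]}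
    (hP : P ∈ Polynomial.degreeLT ℂ (k + 1)) :
    modOp χ a ℓ (k + 1) c ρ (fun y => P.eval (y : ℂ)) ∈ polyFun (k + 1) := by
  have hu : Tame (k + 2 - 1 / 2) fun y => P.eval (y : ℂ) := tame_eval (by linarith) hP
  let ε : ℕ → ℝ := fun n => 1 / 3 * (1 / (n + 1))
  have hε0 : ∀ n, 0 < ε n := fun n => by positivity
  have hε1 : ∀ n, ε n ≤ 1 / 3 := fun n => by
    have : (1 : ℝ) / (n + 1) ≤ 1 := by
      rw [div_le_one (by positivity)]; linarith [n.cast_nonneg (α := ℝ)]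
    simp only [ε]; linarith
  have hεt : Tendsto ε atTop (𝓝 0) := by
    simpa only [mul_zero] using
      (tendsto_one_div_add_atTop_nhds_zero_nat (𝕜 := ℝ)).const_mul (1 / 3 : ℝ)
  -- The smooth multiplier kills `P`, so the operators for `ℓ` and `εℓ` agree on `P` modulo
  -- polynomials. The second tends to zero pointwise, and `polyFun` is closed.
  have hmem : ∀ n, (fun x => modOp χ a ℓ (k + 1) c ρ (fun y => P.eval (y : ℂ)) x -
      modOp χ a (ε n * ℓ) (k + 1) c ρ (fun y => P.eval (y : ℂ)) x) ∈ polyFun (k + 1) := by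
    intro n
    obtain ⟨Ψ, hΨ⟩ := hχ.exists_schwartz a hℓ (hε0 n)
    have h1 := hχ.freqShift_conv_sub_mem (by norm_num) (by norm_num) hu hℓ (hε0 n) (hε1 n) hΨ c hρ
    have h2 : ∀ᶠ ξ in 𝓝 0, Ψ ξ = 0 := by
      simp_rw [hΨ]; exact hχ.eventually_eq_zero hℓ (hε0 n) h0
    simp only [freqShift_eq, conv_fourierInv_eval h2, mul_zero, zero_sub] at h1
    convert Submodule.neg_mem _ h1 using 1
    ext x; simp
  obtain ⟨C, hC0, hC⟩ : ∃ C : ℝ → ℝ, (∀ x, 0 ≤ C x) ∧ ∀ x n, ‖modOp χ a (ε n * ℓ) (k + 1) c ρ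
      (fun y => P.eval (y : ℂ)) x‖ ≤ C x * lenWeight (1 / 2) k (ε n * ℓ) := by
    choose C hC0 hC using fun x =>
      hχ.exists_norm_modOp_le (by norm_num) (by norm_num) hu c hρ (abs_nonneg x)
    exact ⟨C, hC0, fun x n => hC x a _ x (mul_ne_zero (hε0 n).ne' hℓ) le_rfl⟩
  refine (isClosed_polyFun (k + 1)).mem_of_tendsto (b := atTop) (tendsto_pi_nhds.2 fun x => ?_)
    (Eventually.of_forall hmem)
  have h2 : Tendsto (fun n => modOp χ a (ε n * ℓ) (k + 1) c ρ (fun y => P.eval (y : ℂ)) x) atTop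
      (𝓝 0) := by
    refine squeeze_zero_norm (hC x) ?_
    simpa using ((tendsto_lenWeight (α := 1 / 2) (by norm_num) k ℓ).comp hεt).const_mul (C x)
  simpa using h2.const_sub (modOp χ a ℓ (k + 1) c ρ (fun y => P.eval (y : ℂ)) x)

end

/-! ### Cut-offs from the given functions and convergence of the symbols -/

noncomputable section

/-- The function is 1 on `[0, 1/3)`, so continuing it by 1 to the left removes its jump at 0; the
jump reappears through integration over `[0, 1]` in the kernel. -/
lemma exists_isCutoff {ψ : ℝ → ℂ} (hψ : ContDiffOn ℝ ∞ ψ (Icc 0 1))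
    (h1 : ∀ t ∈ Icc (0 : ℝ) 1, t < 1 / 3 → ψ t = 1) (h0 : ∀ t > 2 / 3, ψ t = 0) :
    ∃ χ : ℝ → ℂ, IsCutoff χ ∧ ∀ t ∈ Icc (0 : ℝ) 1, χ t = ψ t := by
  set χ : ℝ → ℂ := fun t => if t < 1 / 3 then 1 else ψ t with hχ
  have hone : ∀ t < 1 / 3, χ t = 1 := fun t ht => if_pos ht
  have hzero : ∀ t > 2 / 3, χ t = 0 := fun t ht => by
    rw [hχ]; simp only
    rw [if_neg (by linarith), h0 t ht]
  have heq : ∀ t ∈ Icc (0 : ℝ) 1, χ t = ψ t := fun t ht => by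
    rw [hχ]; simp only
    split_ifs with h
    · exact (h1 t ht h).symm
    · rfl
  refine ⟨χ, ⟨contDiff_iff_contDiffAt.2 fun t => ?_, hone, hzero⟩, heq⟩
  rcases lt_or_ge t (1 / 3) with h | h
  · exact contDiffAt_const.congr_of_eventuallyEq (eventually_of_mem (Iio_mem_nhds h) hone)
  rcases lt_or_ge (2 / 3) t with h' | h'
  · exact contDiffAt_const.congr_of_eventuallyEq (eventually_of_mem (Ioi_mem_nhds h') hzero)
  have hn : Icc (0 : ℝ) 1 ∈ 𝓝 t := Icc_mem_nhds (by linarith) (by linarith)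
  exact (hψ.contDiffAt hn).congr_of_eventuallyEq (eventually_of_mem hn heq)

/-- The difference is bounded and supported in a segment of length `ε|ℓ|` at the end `a`. -/
lemma IsCutoff.tendsto_eLpNorm_sub {χ : ℝ → ℂ} (hχ : IsCutoff χ) {a ℓ : ℝ} (hℓ : ℓ ≠ 0)
    {ε : ℕ → ℝ} (hε0 : ∀ ν, 0 < ε ν) (hε1 : ∀ ν, ε ν ≤ 1 / 3) (hε : Tendsto ε atTop (𝓝 0))
    {Ψ : ℕ → ℝ → ℂ} (hΨ : ∀ ν ξ, Ψ ν ξ = χ ((ξ - a) / ℓ) * (1 - χ ((ξ - a) / ℓ / ε ν)))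
    {w : ℝ → ℂ} (hw : ∀ ξ, (ξ - a) / ℓ ∈ Icc (0 : ℝ) 1 → w ξ = χ ((ξ - a) / ℓ))
    (hw0 : ∀ ξ, (ξ - a) / ℓ ∉ Icc (0 : ℝ) 1 → w ξ = 0) :
    Tendsto (fun ν => eLpNorm (fun ξ => Ψ ν ξ - w ξ) 2 volume) atTop (𝓝 0) := by
  obtain ⟨D, hD⟩ := isCompact_Icc.exists_bound_of_continuousOn (s := Icc (0 : ℝ) 1)
    hχ.smooth.continuous.continuousOn
  have hpt : ∀ ν ξ, ‖Ψ ν ξ - w ξ‖ₑ ^ 2 ≤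
      (uIcc a (a + ε ν * ℓ)).indicator (fun _ => ENNReal.ofReal (D ^ 2)) ξ := by
    intro ν ξ
    set t := (ξ - a) / ℓ with ht
    have hξ : ξ = a + t * ℓ := by rw [ht]; field_simp; ring
    by_cases h : t / ε ν ∈ Icc (0 : ℝ) 1
    · have h1 : t ∈ Icc (0 : ℝ) 1 := by
        have e := hε0 ν
        have := (le_div_iff₀ e).1 h.1
        have := (div_le_iff₀ e).1 h.2
        exact ⟨by linarith, by linarith [hε1 ν]⟩
      rw [indicator_of_mem, hΨ, hw ξ h1, ← ht, hχ.mul_one_sub (hε0 ν) (hε1 ν), sub_sub_cancel_left,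
        enorm_neg, ← ofReal_norm, ← ENNReal.ofReal_pow (norm_nonneg _)]
      · apply ENNReal.ofReal_le_ofReal
        have := hD _ h
        gcongr
      · rw [hξ, ← segment_eq_uIcc, segment_eq_image']
        refine ⟨t / ε ν, h, ?_⟩
        have := (hε0 ν).ne'
        simp only [smul_eq_mul, add_sub_cancel_left]
        field_simp
    · have hz : Ψ ν ξ - w ξ = 0 := by
        rw [mem_Icc, not_and_or, not_le, not_le] at h
        rcases h with h | h
        · have h1 : t < 0 := by
            by_contra! h'
            exact absurd h (not_lt.2 (div_nonneg h' (hε0 ν).le))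
          rw [hΨ, hw0 ξ fun h' => absurd h'.1 (not_le.2 h1), ← ht, hχ.one _ (h.trans (by norm_num))]
          ring
        · have h2 : χ (t / ε ν) = 0 := hχ.zero _ (by linarith)
          rw [hΨ, ← ht, h2, sub_zero, mul_one]
          by_cases h1 : t ∈ Icc (0 : ℝ) 1
          · rw [hw ξ h1, sub_self]
          · have h3 : 0 < t := by
              have := (lt_div_iff₀ (hε0 ν)).1 h
              linarith [hε0 ν]
            have h4 : 1 < t := by
              by_contra! h'
              exact h1 ⟨h3.le, h'⟩
            rw [hw0 ξ h1, hχ.zero t (by linarith), sub_zero]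
      rw [hz]; simp
  have hsq : Tendsto (fun ν => eLpNorm (fun ξ => Ψ ν ξ - w ξ) 2 volume ^ 2) atTop (𝓝 0) := by
    have hlim : Tendsto (fun ν => ENNReal.ofReal (D ^ 2) * ENNReal.ofReal |ε ν * ℓ|) atTop (𝓝 0) := by
      have h1 : Tendsto (fun ν => |ε ν * ℓ|) atTop (𝓝 0) := by
        simpa using (hε.mul_const ℓ).abs
      have h2 := ENNReal.Tendsto.const_mul (a := ENNReal.ofReal (D ^ 2))
        (ENNReal.tendsto_ofReal h1) (Or.inr ENNReal.ofReal_ne_top)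
      simpa using h2
    refine tendsto_of_tendsto_of_tendsto_of_le_of_le tendsto_const_nhds hlim (fun ν => zero_le)
      fun ν => ?_
    simp only
    rw [eLpNorm_two_sq]
    refine (lintegral_mono (hpt ν)).trans_eq ?_
    rw [lintegral_indicator_const measurableSet_uIcc, Real.volume_interval]
    congr 3; ring
  have h := (ENNReal.continuous_rpow_const (y := 1 / 2)).tendsto 0 |>.comp hsq
  rw [ENNReal.zero_rpow_of_pos (by norm_num)] at h
  refine h.congr fun ν => ?_
  simp only [Function.comp]
  rw [← ENNReal.rpow_two, ← ENNReal.rpow_mul]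
  norm_num

end

/-! ### The estimate for `f - P` and the comparison of intervals -/

noncomputable section

/-- Growth of `f - P` combined with the estimate on one interval. The condition `γ + α < k + 1`
serves both: `γ < k + 1` for the shells, and `1 + γ < k + 2 - α` for integrability against the
kernel. -/
lemma IsCutoff.exists_modOp_sub_eval_le {χ : ℝ → ℂ} (hχ : IsCutoff χ) (i k : ℕ) {s α γ : ℝ}
    (hγ : max s ((i : ℝ) - 1) < γ) (hα1 : α ≤ 1) (hγα : γ + α < k + 1) (hα0 : 0 < α) :
    ∃ C : ℝ, 0 < C ∧ ∀ {ι : Type} [Countable ι] {a ℓ : ι → ℝ}, DisjointSegments a ℓ →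
      ∀ {f : ℝ → ℂ} {x A : ℝ}, AEStronglyMeasurable f →
      maximalFn i 2 s (fun _ : Unit => f) x < ENNReal.ofReal A → ∀ {c ρ : ℝ}, 0 < ρ →
      x ∈ Icc (c - ρ) (c + ρ) → ∃ P ∈ Polynomial.degreeLT ℂ i,
        Tame (k + 2 - α) (fun y => f y - P.eval (y : ℂ)) ∧
        ∫⁻ y in Icc (c - ρ) (c + ρ), ∑' m,
          ‖modOp χ (a m) (ℓ m) (k + 1) c ρ (fun y => f y - P.eval (y : ℂ)) y‖ₑ ^ 2 ≤
          ENNReal.ofReal ((C * A) ^ 2 * (2 * ρ) ^ (1 + 2 * s)) := by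
  obtain ⟨C₁, hC₁, h₁⟩ := exists_growth_bound i s hγ
  obtain ⟨C₂, hC₂, h₂⟩ := hχ.exists_lintegral_modOp_le k (γ := γ) (by linarith)
  set D : ℝ := C₂ * C₁ ^ 2 / 2 ^ (1 + 2 * s) with hD
  have hD0 : 0 < D := by positivity
  refine ⟨Real.sqrt D, Real.sqrt_pos.2 hD0, ?_⟩
  intro ι _ a ℓ hdis f x A hf hA c ρ hρ hx
  have hA0 : 0 ≤ A := by
    by_contra! h0
    rw [ENNReal.ofReal_of_nonpos h0.le] at hA
    exact not_lt_zero hA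
  -- All the dilations contain `x`, so the single value of the maximal function at `x` controls
  -- them.
  have hP : ∀ j : ℕ, ∃ P ∈ Polynomial.degreeLT ℂ i,
      ∫⁻ y in Icc (c - 2 ^ (j + 1) * ρ) (c + 2 ^ (j + 1) * ρ), ‖f y - P.eval (y : ℂ)‖ₑ ^ 2 ≤
        ENNReal.ofReal (A ^ 2 * (2 ^ (j + 2) * ρ) ^ (1 + 2 * s)) := by
    intro j
    have h1 : ρ ≤ 2 ^ (j + 1) * ρ := le_mul_of_one_le_left hρ.le (one_le_pow₀ (by norm_num))
    obtain ⟨P, hP, h⟩ := exists_poly_of_maximalFn_lt hA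
      (show c - 2 ^ (j + 1) * ρ < c + 2 ^ (j + 1) * ρ by linarith)
      ⟨by linarith [hx.1], by linarith [hx.2]⟩
    refine ⟨P, hP, h.trans_eq ?_⟩
    congr 3; ring
  choose P hP hPj using hP
  have hg := h₁ hf hρ hA0 hP hPj
  have hm : AEStronglyMeasurable fun y : ℝ => f y - (P 0).eval (y : ℂ) :=
    hf.sub (by fun_prop : Continuous fun y : ℝ => (P 0).eval (y : ℂ)).aestronglyMeasurable
  refine ⟨P 0, hP 0, tame_of_growth hm hρ (by linarith)
    (by have := k.cast_nonneg (α := ℝ); linarith) hg, ?_⟩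
  refine (h₂ hdis hρ hm hg).trans_eq ?_
  congr 1
  rw [mul_pow (Real.sqrt D), Real.sq_sqrt hD0.le, Real.mul_rpow (by norm_num) hρ.le,
    Real.rpow_add hρ, Real.rpow_one, mul_comm 2 s, Real.rpow_mul hρ.le, Real.rpow_two, hD]
  field_simp

/-- Changing the interval alters the Taylor corrections only, and changing the subtracted polynomial
alters the input by a polynomial, which the operator maps to a polynomial. Hence all local
constructions represent one function modulo polynomials. -/
lemma IsCutoff.modOp_sub_eval_sub_mem {χ : ℝ → ℂ} (hχ : IsCutoff χ) {k : ℕ} {α : ℝ} (hα0 : 0 ≤ α)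
    (hα1 : α < 1) {a ℓ : ℝ} (hℓ : ℓ ≠ 0) (h0 : ∀ t ∈ Ioo (0 : ℝ) 1, a + t * ℓ ≠ 0) {f : ℝ → ℂ}
    {P Q : ℂ[X]} (hP : P ∈ Polynomial.degreeLT ℂ (k + 1)) (hQ : Q ∈ Polynomial.degreeLT ℂ (k + 1))
    (hfQ : Tame (k + 2 - α) fun y => f y - Q.eval (y : ℂ))
    (c c' : ℝ) {ρ ρ' : ℝ} (hρ : 0 ≤ ρ) (hρ' : 0 ≤ ρ') :
    (fun x => modOp χ a ℓ (k + 1) c ρ (fun y => f y - P.eval (y : ℂ)) x -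
      modOp χ a ℓ (k + 1) c' ρ' (fun y => f y - Q.eval (y : ℂ)) x) ∈ polyFun (k + 1) := by
  have hPQ : P - Q ∈ Polynomial.degreeLT ℂ (k + 1) := Submodule.sub_mem _ hP hQ
  have h1 : (fun y : ℝ => f y - P.eval (y : ℂ)) =
      fun y : ℝ => (f y - Q.eval (y : ℂ)) - (P - Q).eval (y : ℂ) := by
    ext y; rw [Polynomial.eval_sub]; ring
  rw [h1]
  convert Submodule.sub_mem _ (hχ.modOp_sub_modOp_mem hα0 hα1.le hfQ a hℓ c c' hρ hρ')
    (hχ.modOp_eval_mem hℓ h0 c hρ hPQ) using 1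
  ext x
  rw [hχ.modOp_sub hα0 hα1.le hfQ (tame_eval (by linarith) hPQ) a hℓ c hρ x]
  simp only [Pi.sub_apply]
  ring

/-- The dilation must depend on the segment, since the lengths are arbitrary: it is chosen so small
that the errors are square summable over the segments and decay geometrically in `ν`. No function
`f` enters the choice. -/
lemma exists_dilation_seq {ι : Type*} [Countable ι] {α : ℝ} (hα : 0 < α) (k : ℕ) (ℓ : ι → ℝ) :
    ∃ (ε : ι → ℕ → ℝ) (δ : ι → ℝ≥0), (∑' m, (δ m : ℝ≥0∞) ^ 2) ≤ 1 ∧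
      ∀ m ν, 0 < ε m ν ∧ ε m ν ≤ 1 / 3 ∧ ε m ν ≤ (1 / 2) ^ ν ∧
        lenWeight α k (ε m ν * ℓ m) ≤ (1 / 2) ^ ν * δ m := by
  obtain ⟨δ, hδ0, hδ⟩ := ENNReal.exists_pos_sum_of_countable one_ne_zero ι
  have h : ∀ (m : ι) (ν : ℕ), ∃ ε : ℝ, 0 < ε ∧ ε ≤ 1 / 3 ∧ ε ≤ (1 / 2) ^ ν ∧
      lenWeight α k (ε * ℓ m) ≤ (1 / 2) ^ ν * δ m := by
    intro m ν
    have hp : (0 : ℝ) < (1 / 2) ^ ν := by positivity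
    have hd : (0 : ℝ) < δ m := hδ0 m
    have h1 := (((tendsto_lenWeight hα k (ℓ m)).eventually_le_const
      (mul_pos hp hd)).filter_mono nhdsWithin_le_nhds).and
      (Ioc_mem_nhdsGT (lt_min (show (0 : ℝ) < 1 / 3 by norm_num) hp))
    obtain ⟨ε, h2, h3⟩ := h1.exists
    exact ⟨ε, h3.1, h3.2.trans (min_le_left _ _), h3.2.trans (min_le_right _ _), h2⟩
  choose ε hε using h
  refine ⟨ε, δ, (ENNReal.tsum_le_tsum fun m => ?_).trans hδ.le, hε⟩
  have h1 : (δ m : ℝ≥0∞) ≤ 1 := (ENNReal.le_tsum m).trans hδ.le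
  calc (δ m : ℝ≥0∞) ^ 2 = δ m * δ m := sq _
    _ ≤ δ m * 1 := by gcongr
    _ = δ m := mul_one _

/-- Polynomials that are square summable on one interval are so on every dilation of it. -/
lemma lintegral_tsum_eval_lt_top {ι : Type*} [Countable ι] {k : ℕ} {P : ι → ℂ[X]}
    (hP : ∀ m, P m ∈ Polynomial.degreeLT ℂ (k + 1)) {c ρ N : ℝ} (hρ : 0 < ρ) (hN : 1 ≤ N)
    (h : ∫⁻ x in Icc (c - ρ) (c + ρ), ∑' m, ‖(P m).eval (x : ℂ)‖ₑ ^ 2 < ⊤) :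
    ∫⁻ x in Icc (c - N * ρ) (c + N * ρ), ∑' m, ‖(P m).eval (x : ℂ)‖ₑ ^ 2 < ⊤ := by
  obtain ⟨C, hC0, hC⟩ := exists_enorm_eval_sq_le k
  have hm : ∀ m, Measurable fun x : ℝ => ‖(P m).eval (x : ℂ)‖ₑ ^ 2 := fun m =>
    (by fun_prop : Continuous fun x : ℝ => (P m).eval (x : ℂ)).enorm.measurable.pow_const 2
  calc _ ≤ ∫⁻ _ in Icc (c - N * ρ) (c + N * ρ), ENNReal.ofReal (C * N ^ (2 * k) / ρ) *
        ∫⁻ x in Icc (c - ρ) (c + ρ), ∑' m, ‖(P m).eval (x : ℂ)‖ₑ ^ 2 := by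
        refine setLIntegral_mono measurable_const fun y hy => ?_
        rw [lintegral_tsum fun m => (hm m).aemeasurable, ← ENNReal.tsum_mul_left]
        rw [Icc_eq_abs_sub_le] at hy
        exact ENNReal.tsum_le_tsum fun m => hC (P m) (hP m) hρ hN y hy
    _ < ⊤ := by
        rw [setLIntegral_const]
        exact ENNReal.mul_lt_top (ENNReal.mul_lt_top ENNReal.ofReal_lt_top h) measure_Icc_lt_top

lemma memL2Loc_iff {ι : Type*} {h : ι → ℝ → ℂ} (hm : ∀ m, Measurable (h m)) (x₀ : ℝ)
    (hh : ∀ N : ℝ, 1 ≤ N → ∫⁻ x in Icc (x₀ - N) (x₀ + N), ∑' m, ‖h m x‖ₑ ^ 2 < ⊤) : MemL2Loc h := by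
  refine ⟨fun m => (hm m).aemeasurable, fun c d => ?_⟩
  simp only [l2Norm_rpow_two]
  set N : ℝ := 1 + |c - x₀| + |d - x₀| with hN
  refine lt_of_le_of_lt (lintegral_mono_set ?_) (hh N (by
    rw [hN]; linarith [abs_nonneg (c - x₀), abs_nonneg (d - x₀)]))
  have h1 := neg_abs_le (c - x₀)
  have h2 := le_abs_self (d - x₀)
  exact Icc_subset_Icc (by rw [hN]; linarith [abs_nonneg (d - x₀)])
    (by rw [hN]; linarith [abs_nonneg (c - x₀)])

end

/-! ### The operator attached to one end of each segment -/

noncomputable section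

/-- The kernel bound is uniform in `a`, and on a bounded interval uniform in `x`; it depends on the
segment only through `lenWeight`, so the choice of the dilations makes the error summable pointwise.
-/
lemma IsCutoff.exists_lintegral_dilated_le {χ : ℝ → ℂ} (hχ : IsCutoff χ) {k : ℕ} {α : ℝ}
    (hα0 : 0 ≤ α) (hα1 : α ≤ 1) {u : ℝ → ℂ} (hu : Tame (k + 2 - α) u) {ι : Type*} (a : ι → ℝ)
    {ℓ : ι → ℝ} (hℓ : ∀ m, ℓ m ≠ 0) {ε : ι → ℕ → ℝ} {δ : ι → ℝ≥0}
    (hδ : (∑' m, (δ m : ℝ≥0∞) ^ 2) ≤ 1)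
    (hε : ∀ m ν, 0 < ε m ν ∧ lenWeight α k (ε m ν * ℓ m) ≤ (1 / 2) ^ ν * δ m)
    (c₀ : ℝ) {ρ₀ : ℝ} (hρ₀ : 0 ≤ ρ₀) (c d : ℝ) :
    ∃ K : ℝ, 0 ≤ K ∧ ∀ ν : ℕ, ∫⁻ x in Icc c d,
      ∑' m, ‖modOp χ (a m) (ε m ν * ℓ m) (k + 1) c₀ ρ₀ u x‖ₑ ^ 2 ≤
        ENNReal.ofReal (K * (1 / 4) ^ ν) := by
  obtain ⟨C, hC0, hC⟩ := hχ.exists_norm_modOp_le hα0 hα1 hu c₀ hρ₀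
    (N := |c| + |d|) (by positivity)
  refine ⟨C ^ 2 * |d - c|, by positivity, fun ν => ?_⟩
  have hpt : ∀ x ∈ Icc c d, ∑' m, ‖modOp χ (a m) (ε m ν * ℓ m) (k + 1) c₀ ρ₀ u x‖ₑ ^ 2 ≤
      ENNReal.ofReal (C ^ 2 * (1 / 4) ^ ν) := by
    intro x hx
    have hxN : |x| ≤ |c| + |d| :=
      (abs_le_max_abs_abs hx.1 hx.2).trans (max_le_add_of_nonneg (abs_nonneg _) (abs_nonneg _))
    calc _ ≤ ∑' m, ENNReal.ofReal (C ^ 2 * (1 / 4) ^ ν) * (δ m : ℝ≥0∞) ^ 2 := by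
          refine ENNReal.tsum_le_tsum fun m => ?_
          have h1 := (hC (a m) _ x (mul_ne_zero (hε m ν).1.ne' (hℓ m)) hxN).trans
            (mul_le_mul_of_nonneg_left (hε m ν).2 hC0)
          rw [← ofReal_norm, ← ENNReal.ofReal_pow (norm_nonneg _), ← ENNReal.ofReal_coe_nnreal,
            ← ENNReal.ofReal_pow (NNReal.coe_nonneg _), ← ENNReal.ofReal_mul (by positivity)]
          apply ENNReal.ofReal_le_ofReal
          calc _ ≤ (C * ((1 / 2) ^ ν * (δ m : ℝ))) ^ 2 := by gcongr
            _ = C ^ 2 * ((1 / 2 : ℝ) ^ 2) ^ ν * (δ m : ℝ) ^ 2 := by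
                rw [← pow_mul, mul_comm 2 ν, pow_mul]; ring
            _ = _ := by norm_num
      _ ≤ ENNReal.ofReal (C ^ 2 * (1 / 4) ^ ν) * 1 := by
          rw [ENNReal.tsum_mul_left]; gcongr
      _ = _ := mul_one _
  refine (setLIntegral_mono measurable_const hpt).trans ?_
  rw [setLIntegral_const, Real.volume_Icc, ← ENNReal.ofReal_mul (by positivity)]
  apply ENNReal.ofReal_le_ofReal
  rw [mul_right_comm]
  gcongr
  exact le_abs_self _

lemma tendstoL2Loc_of_sub_le {ι : Type*} [Countable ι] {h : ℕ → ι → ℝ → ℂ} {g : ι → ℝ → ℂ}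
    (hm : ∀ ν m, Measurable (h ν m)) (hg : MemL2Loc g) (hgm : ∀ m, Measurable (g m))
    (hK : ∀ c d : ℝ, ∃ K : ℝ, 0 ≤ K ∧ ∀ ν : ℕ,
      ∫⁻ x in Icc c d, ∑' m, ‖h ν m x - g m x‖ₑ ^ 2 ≤ ENNReal.ofReal (K * (1 / 4) ^ ν)) :
    TendstoL2Loc h g := by
  refine ⟨fun ν => ⟨fun m => (hm ν m).aemeasurable, fun c d => ?_⟩, hg, fun c d => ?_⟩
  · obtain ⟨K, hK0, hK⟩ := hK c d
    have h1 := hg.2 c d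
    simp only [l2Norm_rpow_two] at h1 ⊢
    have hmg : Measurable fun x => ∑' m, ‖g m x‖ₑ ^ 2 :=
      Measurable.tsum fun m => (hgm m).enorm.pow_const 2
    calc _ ≤ ∫⁻ x in Icc c d, 2 * ((∑' m, ‖g m x‖ₑ ^ 2) + ∑' m, ‖h ν m x - g m x‖ₑ ^ 2) := by
          refine lintegral_mono fun x => ?_
          simp only
          rw [← ENNReal.tsum_add, ← ENNReal.tsum_mul_left]
          refine ENNReal.tsum_le_tsum fun m => ?_
          calc ‖h ν m x‖ₑ ^ 2 = ‖g m x + (h ν m x - g m x)‖ₑ ^ 2 := by congr 2; ring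
            _ ≤ _ := (pow_le_pow_left' (enorm_add_le _ _) 2).trans (ENNReal.add_sq_le _ _)
      _ < ⊤ := by
          rw [lintegral_const_mul' _ _ (by simp), lintegral_add_left hmg]
          exact ENNReal.mul_lt_top (by simp)
            (ENNReal.add_lt_top.2 ⟨h1, (hK ν).trans_lt ENNReal.ofReal_lt_top⟩)
  · obtain ⟨K, hK0, hK⟩ := hK c d
    simp only [l2Norm_rpow_two]
    have h1 : Tendsto (fun ν : ℕ => ENNReal.ofReal (K * (1 / 4) ^ ν)) atTop (𝓝 0) := by
      have := (tendsto_pow_atTop_nhds_zero_of_lt_one (r := (1 / 4 : ℝ)) (by norm_num)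
        (by norm_num)).const_mul K
      rw [mul_zero] at this
      simpa using ENNReal.tendsto_ofReal this
    exact tendsto_of_tendsto_of_tendsto_of_le_of_le tendsto_const_nhds h1 (fun ν => zero_le) hK

open FourierTransform in
/-- The statement for the operator attached to one end of each segment. -/
lemma IsCutoff.exists_sideOperator {χ : ℝ → ℂ} (hχ : IsCutoff χ) (i k : ℕ) {s : ℝ}
    (hrs : max s ((i : ℝ) - 1) < k + 1) :
    ∃ C : ℝ≥0, ∀ {ι : Type} [Countable ι] {a ℓ : ι → ℝ}, DisjointSegments a ℓ →
      (∀ m, ∀ t ∈ Ioo (0 : ℝ) 1, a m + t * ℓ m ≠ 0) →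
      ∃ Ψ : ι → ℕ → 𝓢(ℝ, ℂ),
        (∀ m (w : ℝ → ℂ),
          (∀ ξ, (ξ - a m) / ℓ m ∈ Icc (0 : ℝ) 1 → w ξ = χ ((ξ - a m) / ℓ m)) →
          (∀ ξ, (ξ - a m) / ℓ m ∉ Icc (0 : ℝ) 1 → w ξ = 0) →
          Tendsto (fun ν => eLpNorm (fun ξ => Ψ m ν ξ - w ξ) 2 volume) atTop (𝓝 0)) ∧
        ∀ f : ℝ → ℂ, AEStronglyMeasurable f → (∃ x₀, maximalFn i 2 s (fun _ : Unit => f) x₀ < ⊤) →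
          ∃ q, 0 ≤ q ∧ Tame q f ∧ ∃ p : ι → ℕ → ℂ[X],
            (∀ m ν, p m ν ∈ Polynomial.degreeLT ℂ (k + 1)) ∧ ∃ g : ι → ℝ → ℂ,
            TendstoL2Loc (fun ν m x => freqShift (a m) (conv (𝓕⁻ (Ψ m ν) : 𝓢(ℝ, ℂ)) f) x -
              (p m ν).eval (x : ℂ)) g ∧
            ∀ x, maximalFn (k + 1) 2 s g x ≤ C * maximalFn i 2 s (fun _ : Unit => f) x := by
  set γ' : ℝ := max s ((i : ℝ) - 1) with hγ'
  -- The gap between `γ'` and `k + 1` is cut in three: one third raises `γ'` to the growth exponent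
  -- `γ`, at most another is spent on `α`, the rest keeps `γ + α < k + 1` strict. The bound `1/2`
  -- keeps polynomials of degree `≤ k` integrable against the weight.
  set α : ℝ := min ((k + 1 - γ') / 3) (1 / 2) with hα
  have hα0 : 0 < α := lt_min (by linarith) (by norm_num)
  have hα1 : α ≤ 1 / 2 := min_le_right _ _
  have hα3 : α ≤ (k + 1 - γ') / 3 := min_le_left _ _
  have hik : i ≤ k + 1 := by
    have h1 : (i : ℝ) - 1 < k + 1 := (le_max_right _ _).trans_lt hrs
    have h2 : (i : ℝ) < ((k + 2 : ℕ) : ℝ) := by push_cast; linarith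
    have := Nat.cast_lt.1 h2
    omega
  have hdeg : ∀ {P : ℂ[X]}, P ∈ Polynomial.degreeLT ℂ i → P ∈ Polynomial.degreeLT ℂ (k + 1) :=
    fun hP => Polynomial.degreeLT_mono hik hP
  obtain ⟨C, hC0, hC⟩ := hχ.exists_modOp_sub_eval_le i k (s := s) (α := α)
    (γ := γ' + (k + 1 - γ') / 3) (by linarith) (by linarith) (by linarith) hα0
  refine ⟨C.toNNReal, ?_⟩
  intro ι _ a ℓ hdis h0
  obtain ⟨ε, δ, hδ, hε⟩ := exists_dilation_seq hα0 k ℓ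
  choose Ψ hΨ using fun m ν => hχ.exists_schwartz (a m) (hdis.ne m) (hε m ν).1
  refine ⟨Ψ, fun m w hw hw0 => hχ.tendsto_eLpNorm_sub (hdis.ne m) (fun ν => (hε m ν).1)
    (fun ν => (hε m ν).2.1) ?_ (hΨ m) hw hw0, ?_⟩
  · exact squeeze_zero (fun ν => (hε m ν).1.le) (fun ν => (hε m ν).2.2.1)
      (tendsto_pow_atTop_nhds_zero_of_lt_one (by norm_num) (by norm_num))
  rintro f hf ⟨x₀, hx₀⟩
  have hlt : ∀ {x}, maximalFn i 2 s (fun _ : Unit => f) x < ⊤ → ∃ A : ℝ,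
      maximalFn i 2 s (fun _ : Unit => f) x < ENNReal.ofReal A := by
    intro x hx
    refine ⟨(maximalFn i 2 s (fun _ : Unit => f) x).toReal + 1, ?_⟩
    rw [ENNReal.lt_ofReal_iff_toReal_lt hx.ne]
    linarith
  obtain ⟨A₀, hA₀⟩ := hlt hx₀
  obtain ⟨P₀, hP₀, ht₀, hI₀⟩ := hC hdis hf hA₀ (c := x₀) one_pos ⟨by linarith, by linarith⟩
  set u : ℝ → ℂ := fun y => f y - P₀.eval (y : ℂ) with hu
  have hkq : (k : ℝ) + 1 < k + 2 - α := by linarith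
  have hq0 : (0 : ℝ) ≤ k + 2 - α := by have := k.cast_nonneg (α := ℝ); linarith
  have htP : Tame (k + 2 - α) fun y : ℝ => P₀.eval (y : ℂ) := tame_eval hkq (hdeg hP₀)
  have htf : Tame (k + 2 - α) f := by
    have := ht₀.add htP
    simpa [hu] using this
  -- The limit, normalised by the base interval `[x₀ - 1, x₀ + 1]`; any other interval would give it
  -- modulo polynomials.
  set g : ι → ℝ → ℂ := fun m => modOp χ (a m) (ℓ m) (k + 1) x₀ 1 u with hg
  have hconv : ∀ m ν x, conv (𝓕⁻ (Ψ m ν) : 𝓢(ℝ, ℂ)) f x = conv (𝓕⁻ (Ψ m ν) : 𝓢(ℝ, ℂ)) u x := by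
    intro m ν x
    have hz : ∀ᶠ ξ in 𝓝 0, Ψ m ν ξ = 0 := by
      simp_rw [hΨ]; exact hχ.eventually_eq_zero (hdis.ne m) (hε m ν).1 (h0 m)
    have h2 : conv (𝓕⁻ (Ψ m ν) : 𝓢(ℝ, ℂ)) f x = conv (𝓕⁻ (Ψ m ν) : 𝓢(ℝ, ℂ)) u x +
        conv (𝓕⁻ (Ψ m ν) : 𝓢(ℝ, ℂ)) (fun y : ℝ => P₀.eval (y : ℂ)) x := by
      rw [conv, conv, conv, ← integral_add (ht₀.integrable_conv hq0 _ x)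
        (htP.integrable_conv hq0 _ x)]
      congr 1; ext y; rw [hu]; ring
    rw [h2, conv_fourierInv_eval hz, add_zero]
  have hp : ∀ m ν, ∃ p ∈ Polynomial.degreeLT ℂ (k + 1), ∀ x,
      freqShift (a m) (conv (𝓕⁻ (Ψ m ν) : 𝓢(ℝ, ℂ)) f) x - p.eval (x : ℂ) =
        g m x - modOp χ (a m) (ε m ν * ℓ m) (k + 1) x₀ 1 u x := by
    intro m ν
    obtain ⟨p, hp, hpx⟩ := mem_polyFun.1 (hχ.freqShift_conv_sub_mem hα0.le (by linarith) ht₀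
      (hdis.ne m) (hε m ν).1 (hε m ν).2.1 (hΨ m ν) x₀ zero_le_one)
    refine ⟨p, hp, fun x => ?_⟩
    rw [← hpx x, freqShift_eq, freqShift_eq, hconv]
    ring
  choose p hp hpx using hp
  refine ⟨k + 2 - α, hq0, htf, p, hp, g, ?_, ?_⟩
  · have hmeas : ∀ ν m, Measurable fun x => freqShift (a m) (conv (𝓕⁻ (Ψ m ν) : 𝓢(ℝ, ℂ)) f) x -
        (p m ν).eval (x : ℂ) := by
      intro ν m
      have h1 := htf.continuous_conv hq0 (𝓕⁻ (Ψ m ν))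
      simp only [freqShift_eq]
      exact (by fun_prop : Continuous fun x : ℝ => cis (-(a m * x)) *
        conv (𝓕⁻ (Ψ m ν) : 𝓢(ℝ, ℂ)) f x - (p m ν).eval (x : ℂ)).measurable
    have hgm : ∀ m, Measurable (g m) := by
      intro m
      -- The limit is measurable as a pointwise limit of continuous functions, because the operators
      -- of the dilated segments tend to zero at each point.
      refine measurable_of_tendsto_metrizable (hmeas · m) (tendsto_pi_nhds.2 fun x => ?_)
      obtain ⟨K, hK0, hK⟩ := hχ.exists_norm_modOp_le hα0.le (by linarith) ht₀ x₀ zero_le_one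
        (abs_nonneg x)
      have h2 : Tendsto (fun ν => modOp χ (a m) (ε m ν * ℓ m) (k + 1) x₀ 1 u x) atTop (𝓝 0) := by
        refine squeeze_zero_norm (fun ν => (hK (a m) _ x (mul_ne_zero (hε m ν).1.ne' (hdis.ne m))
          le_rfl).trans (mul_le_mul_of_nonneg_left (hε m ν).2.2.2 hK0)) ?_
        simpa using ((tendsto_pow_atTop_nhds_zero_of_lt_one (r := (1 / 2 : ℝ)) (by norm_num)
          (by norm_num)).mul_const (δ m : ℝ)).const_mul K
      simpa only [hpx, sub_zero] using h2.const_sub (g m x)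
    refine tendstoL2Loc_of_sub_le hmeas ?_ hgm fun c d => ?_
    -- On a larger interval `g` is the operator adapted to that interval plus polynomials. These are
    -- square summable on the base interval, where both other terms are, and therefore on the larger
    -- one.
    · refine memL2Loc_iff hgm x₀ fun N hN => ?_
      obtain ⟨P, hP, htP, hIP⟩ := hC hdis hf hA₀ (c := x₀) (ρ := N) (by linarith)
        ⟨by linarith, by linarith⟩
      have hd := fun m => mem_polyFun.1 (hχ.modOp_sub_eval_sub_mem hα0.le (by linarith) (hdis.ne m)
        (h0 m) (hdeg hP₀) (hdeg hP) htP x₀ x₀ zero_le_one (by linarith : 0 ≤ N))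
      choose R hR hRx using hd
      have hRm : Measurable fun x : ℝ => ∑' m, ‖(R m).eval (x : ℂ)‖ₑ ^ 2 :=
        Measurable.tsum fun m =>
          (by fun_prop : Continuous fun x : ℝ => (R m).eval (x : ℂ)).enorm.measurable.pow_const 2
      have hgm2 : Measurable fun x => ∑' m, ‖g m x‖ₑ ^ 2 :=
        Measurable.tsum fun m => (hgm m).enorm.pow_const 2
      have hR1 : ∫⁻ x in Icc (x₀ - 1) (x₀ + 1), ∑' m, ‖(R m).eval (x : ℂ)‖ₑ ^ 2 < ⊤ := by
        refine lt_of_le_of_lt (lintegral_mono fun x => ?_) (lt_of_eq_of_lt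
          ((lintegral_const_mul' 2 (fun x => (∑' m, ‖g m x‖ₑ ^ 2) + ∑' m, ‖modOp χ (a m) (ℓ m)
            (k + 1) x₀ N (fun y => f y - P.eval (y : ℂ)) x‖ₑ ^ 2) (by simp)).trans
          (by rw [lintegral_add_left hgm2])) (ENNReal.mul_lt_top (by simp) (ENNReal.add_lt_top.2
            ⟨hI₀.trans_lt ENNReal.ofReal_lt_top, ((lintegral_mono_set (Icc_subset_Icc
              (by linarith) (by linarith))).trans hIP).trans_lt ENNReal.ofReal_lt_top⟩)))
        simp only
        rw [← ENNReal.tsum_add, ← ENNReal.tsum_mul_left]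
        refine ENNReal.tsum_le_tsum fun m => ?_
        rw [← hRx m x]
        exact enorm_sub_sq_le _ _
      have hRN := lintegral_tsum_eval_lt_top hR one_pos hN hR1
      rw [mul_one] at hRN
      calc _ ≤ ∫⁻ x in Icc (x₀ - N) (x₀ + N), 2 * ((∑' m, ‖(R m).eval (x : ℂ)‖ₑ ^ 2) +
            ∑' m, ‖modOp χ (a m) (ℓ m) (k + 1) x₀ N (fun y => f y - P.eval (y : ℂ)) x‖ₑ ^ 2) := by
            refine lintegral_mono fun x => ?_
            simp only
            rw [← ENNReal.tsum_add, ← ENNReal.tsum_mul_left]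
            refine ENNReal.tsum_le_tsum fun m => ?_
            rw [← hRx m x]
            refine le_trans (le_of_eq ?_) ((pow_le_pow_left' (enorm_add_le _ _) 2).trans
              (ENNReal.add_sq_le _ _))
            congr 2; ring
        _ < ⊤ := by
            rw [lintegral_const_mul' _ _ (by simp), lintegral_add_left hRm]
            exact ENNReal.mul_lt_top (by simp)
              (ENNReal.add_lt_top.2 ⟨hRN, hIP.trans_lt ENNReal.ofReal_lt_top⟩)
    · obtain ⟨K, hK0, hK⟩ := hχ.exists_lintegral_dilated_le hα0.le (by linarith) ht₀ a hdis.ne hδ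
        (fun m ν => ⟨(hε m ν).1, (hε m ν).2.2.2⟩) x₀ zero_le_one c d
      refine ⟨K, hK0, fun ν => ?_⟩
      simpa only [hpx, sub_sub_cancel_left, enorm_neg] using hK ν
  · intro x
    have hCne : (C.toNNReal : ℝ≥0∞) ≠ 0 := by simpa using hC0
    -- On each interval containing `x`, the competitor for `g` is its polynomial difference from the
    -- operator adapted to that interval; what remains is the quantity already estimated.
    have key : ∀ A : ℝ, maximalFn i 2 s (fun _ : Unit => f) x < ENNReal.ofReal A →
        maximalFn (k + 1) 2 s g x ≤ ENNReal.ofReal (C * A) := by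
      intro A hA
      have hA0 : 0 ≤ A := by
        by_contra! h
        rw [ENNReal.ofReal_of_nonpos h.le] at hA
        exact not_lt_zero hA
      refine maximalFn_le (by positivity) fun c d hcd hx => ?_
      have e1 : (c + d) / 2 - (d - c) / 2 = c := by ring
      have e2 : (c + d) / 2 + (d - c) / 2 = d := by ring
      have hρ : 0 < (d - c) / 2 := by linarith
      obtain ⟨P, hP, htP, hIP⟩ := hC hdis hf hA (c := (c + d) / 2) (ρ := (d - c) / 2) hρ
        (by rwa [e1, e2])
      rw [e1, e2, mul_div_cancel₀ _ two_ne_zero] at hIP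
      have hd := fun m => mem_polyFun.1 (hχ.modOp_sub_eval_sub_mem hα0.le (by linarith) (hdis.ne m)
        (h0 m) (hdeg hP₀) (hdeg hP) htP x₀ ((c + d) / 2) zero_le_one hρ.le)
      choose R hR hRx using hd
      refine ⟨R, hR, ?_⟩
      simp only [← hRx, hg, hu, sub_sub_cancel]
      exact hIP
    rcases eq_or_ne (maximalFn i 2 s (fun _ : Unit => f) x) ⊤ with h | h
    · rw [h, ENNReal.mul_top hCne]; exact le_top
    · rw [mul_comm, ← ENNReal.div_le_iff hCne ENNReal.coe_ne_top]
      -- The strict upper bound `B` decreases to the value of the maximal function, with the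
      -- constant unaffected.
      refine le_of_forall_gt_imp_ge_of_dense fun B hB => ?_
      rcases eq_or_ne B ⊤ with hB' | hB'
      · rw [hB']; exact le_top
      · rw [ENNReal.div_le_iff hCne ENNReal.coe_ne_top]
        have h1 := key B.toReal (by rwa [ENNReal.ofReal_toReal hB'])
        rw [ENNReal.ofReal_mul hC0.le, ENNReal.ofReal_toReal hB', mul_comm] at h1
        exact h1

end

/-! ### Both ends of the intervals -/

/-- The index `σ : Fin 2` stands for the two operators: `σ = 0` is the one with the cut-off that
vanishes near the right end and with the shift by the left end `a m`, `σ = 1` is the one with the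
cut-off that vanishes near the left end and with the shift by the right end `b m`. -/
theorem theorem2
    (i r : ℕ) (s : ℝ) (hr : 1 ≤ r) (hs : -(1 / 2 : ℝ) < s) (hsi : s ≤ (i : ℝ))
    (hrs : max s ((i : ℝ) - 1) < (r : ℝ))
    (ψ : Fin 2 → ℝ → ℂ)
    (hψ : ∀ σ, ContDiffOn ℝ ∞ (ψ σ) (Icc 0 1))
    (hψ0 : Function.support (ψ 0) ⊆ Icc 0 (2 / 3))
    (hψ1 : Function.support (ψ 1) ⊆ Icc (1 / 3) 1)
    (hψsum : ∀ ξ ∈ Icc (0 : ℝ) 1, ψ 0 ξ + ψ 1 ξ = 1) :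
    ∃ C : ℝ≥0, ∀ (ι : Type) [Countable ι] (a b : ι → ℝ),
      (∀ m, a m < b m) →
      (Pairwise fun m n => Disjoint (Icc (a m) (b m)) (Icc (a n) (b n))) →
      (∀ m, (0 : ℝ) ∉ Ioo (a m) (b m)) →
      ∃ Ψ : Fin 2 → ι → ℕ → 𝓢(ℝ, ℂ),
        (∀ σ m, Tendsto
          (fun ν => eLpNorm (fun ξ => Ψ σ m ν ξ - rescale (ψ σ) (a m) (b m) ξ) 2 volume)
          atTop (𝓝 0)) ∧
        ∀ f : ℝ → ℂ, AEMeasurable f volume →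
          (∃ x₀, maximalFn i 2 s (fun _ : Unit => f) x₀ < ⊤) →
          ∃ T : 𝓢'(ℝ, ℂ), IsGivenBy T f ∧
          ∃ F : Fin 2 → ι → ℕ → ℝ → ℂ,
            (∀ σ m ν, Continuous (F σ m ν) ∧
              IsGivenBy (TemperedDistribution.fourierMultiplierCLM ℂ (Ψ σ m ν) T) (F σ m ν)) ∧
          ∃ p : Fin 2 → ι → ℕ → ℂ[X],
            (∀ σ m ν, p σ m ν ∈ Polynomial.degreeLT ℂ r) ∧
          ∃ g : Fin 2 → ι → ℝ → ℂ, ∀ σ : Fin 2,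
            TendstoL2Loc
              (fun ν m x => freqShift (![a m, b m] σ) (F σ m ν) x - (p σ m ν).eval (x : ℂ))
              (g σ) ∧
            ∀ x, maximalFn r 2 s (g σ) x ≤ C * maximalFn i 2 s (fun _ : Unit => f) x := by
  obtain ⟨k, rfl⟩ : ∃ k, r = k + 1 := ⟨r - 1, by omega⟩
  have hrs' : max s ((i : ℝ) - 1) < k + 1 := by simpa using hrs
  have hmirror : ∀ {t : ℝ}, t ∈ Icc (0 : ℝ) 1 → 1 - t ∈ Icc (0 : ℝ) 1 := fun ht =>
    ⟨by linarith [ht.2], by linarith [ht.1]⟩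
  have hz0 : ∀ t > 2 / 3, ψ 0 t = 0 := fun t ht => by
    by_contra h
    exact absurd (hψ0 h).2 (not_le.2 ht)
  have hz1 : ∀ t < 1 / 3, ψ 1 t = 0 := fun t ht => by
    by_contra h
    exact absurd (hψ1 h).1 (not_le.2 ht)
  obtain ⟨χ₀, hχ₀, hχψ₀⟩ := exists_isCutoff (hψ 0) (fun t ht h => by
    rw [← hψsum t ht, hz1 t h, add_zero]) hz0
  -- The second cut-off, mirrored, has the shape of the first; correspondingly the intervals are run
  -- through from `b` with the negative length `a - b`.
  obtain ⟨χ₁, hχ₁, hχψ₁⟩ := exists_isCutoff (ψ := fun t => ψ 1 (1 - t))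
    ((hψ 1).comp (by fun_prop : ContDiff ℝ ∞ fun t : ℝ => 1 - t).contDiffOn fun t ht => hmirror ht)
    (fun t ht h => by
      rw [← hψsum _ (hmirror ht), hz0 _ (by linarith), zero_add])
    fun t ht => hz1 _ (by linarith)
  obtain ⟨C₀, hC₀⟩ := hχ₀.exists_sideOperator i k hrs'
  obtain ⟨C₁, hC₁⟩ := hχ₁.exists_sideOperator i k hrs'
  refine ⟨max C₀ C₁, ?_⟩
  intro ι _ a b hab hdisj h0
  have hpos : ∀ m, 0 < b m - a m := fun m => sub_pos.2 (hab m)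
  have hseg₀ : DisjointSegments a fun m => b m - a m := by
    refine ⟨fun m => (hpos m).ne', fun m n hmn => ?_⟩
    simp only [add_sub_cancel]
    rw [uIcc_of_le (hab m).le, uIcc_of_le (hab n).le]
    exact hdisj hmn
  have hseg₁ : DisjointSegments b fun m => a m - b m := by
    refine ⟨fun m => sub_ne_zero.2 (hab m).ne, fun m n hmn => ?_⟩
    simp only [add_sub_cancel]
    rw [uIcc_of_ge (hab m).le, uIcc_of_ge (hab n).le]
    exact hdisj hmn
  obtain ⟨Ψ₀, hΨ₀, h₀⟩ := hC₀ hseg₀ fun m t ht h => h0 m (by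
    rw [← h]; constructor <;> nlinarith [ht.1, ht.2, hpos m])
  obtain ⟨Ψ₁, hΨ₁, h₁⟩ := hC₁ hseg₁ fun m t ht h => h0 m (by
    rw [← h]; constructor <;> nlinarith [ht.1, ht.2, hpos m])
  refine ⟨![Ψ₀, Ψ₁], ?_, ?_⟩
  · intro σ m
    fin_cases σ
    · refine hΨ₀ m _ (fun ξ hξ => (hχψ₀ _ hξ).symm) fun ξ hξ => ?_
      by_contra h
      have := hψ0 h
      exact hξ ⟨this.1, this.2.trans (by norm_num)⟩
    · have hflip : ∀ ξ, (ξ - b m) / (a m - b m) = 1 - (ξ - a m) / (b m - a m) := fun ξ => by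
        have h1 := (hpos m).ne'
        have h2 : a m - b m ≠ 0 := sub_ne_zero.2 (hab m).ne
        field_simp
        ring
      refine hΨ₁ m _ (fun ξ hξ => ?_) fun ξ hξ => ?_
      · rw [hχψ₁ _ hξ, hflip, sub_sub_cancel]; rfl
      · by_contra h
        have := hψ1 h
        rw [hflip] at hξ
        exact hξ (hmirror ⟨(by norm_num : (0 : ℝ) ≤ 1 / 3).trans this.1, this.2⟩)
  · intro f hf hfin
    obtain ⟨q₀, hq₀, hf₀, p₀, hp₀, g₀, hg₀, hM₀⟩ := h₀ f hf.aestronglyMeasurable hfin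
    obtain ⟨-, -, -, p₁, hp₁, g₁, hg₁, hM₁⟩ := h₁ f hf.aestronglyMeasurable hfin
    obtain ⟨T, hT⟩ := hf₀.exists_isGivenBy
    refine ⟨T, hT, fun σ m ν => conv (FourierTransformInv.fourierInv (![Ψ₀, Ψ₁] σ m ν) : 𝓢(ℝ, ℂ)) f, fun σ m ν =>
      ⟨hf₀.continuous_conv hq₀ _, hf₀.isGivenBy_fourierMultiplier hq₀ hT _⟩, ![p₀, p₁], ?_,
      ![g₀, g₁], ?_⟩
    · intro σ m ν
      fin_cases σ
      · exact hp₀ m ν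
      · exact hp₁ m ν
    · intro σ
      fin_cases σ
      · refine ⟨hg₀, fun x => (hM₀ x).trans ?_⟩
        gcongr
        exact le_max_left _ _
      · refine ⟨hg₁, fun x => (hM₁ x).trans ?_⟩
        gcongr
        exact le_max_right _ _
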